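/- Let $X$ be a connected, locally finite simple graph with at least two vertices, and let $G=\operatorname{Aut}X$. Suppose that $X$ is $G$-finite, i.e. $G\backslash X$ is finite. For a subgraph $A$ of $X$ let $\delta A$ be the set of vertices of $A$ that are incident with an edge of $X$ not in $A$, and let $A^*$ be the subgraph with vertex set $(VX\setminus VA)\cup\delta A$ and edge set $EX\setminus EA$. Call $A$ a *1-separation* if $\delta A$ consists of one vertex, and this vertex is incident with an edge of $A$. Call $A$ a *2-separation* if $\delta A$ consists of two vertices, each of them is incident with an edge of $A$, and $A$ is neither a single edge (with its ends) nor obtained from $X$ by removing a single edge and no vertices. Let $\mathcal B_2X$ be the set of all 1- and 2-separations. Then there is a subset $\mathcal E\subseteq\mathcal B_2X$ that is $G$-invariant, closed under $A\mapsto A^*$, and consists of finitely many $G$-orbits, such that (i) for all $A,B\in\mathcal E$ at least one of $A\subseteq B$, $A\subseteq B^*$, $A^*\subseteq B$, $A^*\subseteq B^*$ holds; (ii) for all $A,B\in\mathcal E$ with $A\subseteq B$ there are only finitely many $C\in\mathcal E$ with $A\subseteq C\subseteq B$; and such that the following holds. For $A,B\in\mathcal E$ write $A\sim B$ if $A=B$,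 or if $A\subsetneq B^*$ and there is no $C\in\mathcal E$ with $A\subsetneq C\subsetneq B^*$. Let $T$ be the graph whose vertices are the sets $\{B\in\mathcal E: A\sim B\}$ with $A\in\mathcal E$ (if $\mathcal E=\emptyset$, then $T$ has the single vertex $\emptyset$), two distinct vertices $v,w$ being adjacent if there is an $A\in\mathcal E$ with $A\in v$, $A^*\in w$ or $A\in w$, $A^*\in v$. 1. $T$ is a tree, and $G$ acts on $T$ by automorphisms via $gv=\{gA: A\in v\}$. 2. The oriented edges of $T$ are in bijection with the elements of $\mathcal E$, with $A\in\mathcal E$ corresponding to an oriented edge from a vertex containing $A$ to a vertex containing $A^*$. For each $A\in\mathcal E$ we have $A\cup A^*=X$, and $A\cap A^*$ has no edges and exactly one or two vertices. 3. For a vertex $v$ of $T$ let $Z_v$ be the graph obtained from $\bigcap_{A\in v}A^*$ (which means $X$ if $v=\emptyset$) by joining, for each $A\in v$ such that $\delta A$ has two elements, these two vertices by an edge if they are not already joined. The stabilizer $G_v$ of $v$ acts on $Z_v$ by restriction, and one of the following holds: (a) there is a cut-point $c$ of $X$ such that $\delta A=\{c\}$ for all $A\in v$, and $c$ is the only vertex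 of $\bigcap_{A\in v}A^*$; (b) $Z_v$ is a finite cycle, of length at least $3$; (c) $Z_v$ is 3-connected, some subdivision of $Z_v$ is isomorphic to a subgraph of $X$, and $Z_v$ is planar if $X$ is planar. Here a graph is *3-connected* if it has at least two vertices and removing at most two vertices never disconnects it (so complete graphs on 2, 3 or 4 vertices are 3-connected). A graph is *planar* if it can be drawn in the plane, its vertices being distinct points and its edges simple arcs, so that an arc contains no vertices but its ends and two distinct arcs meet only in vertices. -/

import Mathlib

namespace TutteTree

/-- The set of vertices of a subgraph `A` of `X` that are incident with an edge of `X` which is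
not in `A`; this is the boundary of `A`, and its hinge if it has two elements. -/
def hinge {V : Type*} {X : SimpleGraph V} (A : X.Subgraph) : Set V :=
  {w | w ∈ A.verts ∧ ∃ z, X.Adj w z ∧ ¬ A.Adj w z}

/-- The opposite subgraph `A*`: its vertices are the vertices outside `A` and those in the boundary
of `A`, its edges are the edges of `X` that are not in `A`. -/
def opp {V : Type*} {X : SimpleGraph V} (A : X.Subgraph) : X.Subgraph where
  verts := A.vertsᶜ ∪ hinge A
  Adj x y := X.Adj x y ∧ ¬ A.Adj x y
  adj_sub h := h.1
  edge_vert := by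
    intro x y h
    by_cases hx : x ∈ A.verts
    · exact Or.inr ⟨hx, y, h⟩
    · exact Or.inl hx
  symm := ⟨fun x y h => ⟨h.1.symm, fun h2 => h.2 h2.symm⟩⟩

/-- Subgraphs with a single boundary vertex, some but not all of whose edges lie in `A`. -/
def IsOneSeparation {V : Type*} {X : SimpleGraph V} (A : X.Subgraph) : Prop :=
  ∃ u, hinge A = {u} ∧ ∃ z, A.Adj u z

/-- Subgraphs with exactly two boundary vertices, such that some but not all of the edges at each of
these lie in `A`; moreover `A` is not a single edge, nor `X` with a single edge removed. -/
def IsTwoSeparation {V : Type*} {X : SimpleGraph V} (A : X.Subgraph) : Prop :=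
  (∃ u v, u ≠ v ∧ hinge A = {u, v} ∧ (∃ z, A.Adj u z) ∧ (∃ z, A.Adj v z)) ∧
  ∀ a b (h : X.Adj a b),
    A ≠ X.subgraphOfAdj h ∧ A ≠ (⊤ : X.Subgraph).deleteEdges {s(a, b)}

/-- The set of all 1-separations and 2-separations of `X`. -/
def separations {V : Type*} (X : SimpleGraph V) : Set X.Subgraph :=
  {A | IsOneSeparation A ∨ IsTwoSeparation A}

/-- The translate `gA` of a subgraph `A` by an automorphism `g`. -/
def translate {V : Type*} {X : SimpleGraph V} (g : X ≃g X) (A : X.Subgraph) : X.Subgraph :=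
  A.map g.toHom

/-- `X` is finite modulo its automorphism group: finitely many orbits of vertices. For a locally
finite graph there are then also only finitely many orbits of edges. -/
def IsAutFinite {V : Type*} (X : SimpleGraph V) : Prop :=
  ∃ F : Set V, F.Finite ∧ ∀ v, ∃ w ∈ F, ∃ g : X ≃g X, g w = v

/-- The vertex `c` is a cut-point of `X`: its removal disconnects the graph. -/
def IsCutPoint {V : Type*} (X : SimpleGraph V) (c : V) : Prop :=
  ¬ (X.induce ({c}ᶜ : Set V)).Preconnected

/-- `A` and `B`, regarded as oriented edges, have the same initial vertex: `A = B`, or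
`A ⊂ B*` and no element of the family lies strictly between. -/
def SameOrigin {V : Type*} {X : SimpleGraph V} (E : Set X.Subgraph) (A B : X.Subgraph) : Prop :=
  A = B ∨ (A < opp B ∧ ∀ C ∈ E, ¬ (A < C ∧ C < opp B))

/-- The vertices of the structure tree of a family `E` are the classes of `SameOrigin`, each vertex
being identified with the set of oriented edges that start there. If `E` is empty, then
the tree has a single vertex, at which no edge starts. -/
def IsNode {V : Type*} {X : SimpleGraph V} (E v : Set X.Subgraph) : Prop :=
  (E = ∅ ∧ v = ∅) ∨ ∃ A ∈ E, v = {B | B ∈ E ∧ SameOrigin E A B}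

/-- The type of vertices of the structure tree. -/
abbrev Node {V : Type*} {X : SimpleGraph V} (E : Set X.Subgraph) : Type _ :=
  {v : Set X.Subgraph // IsNode E v}

/-- The structure tree `T(E)`: the oriented edge `A` goes from the class of `A` to the class
of `A*`. -/
def structureTree {V : Type*} {X : SimpleGraph V} (E : Set X.Subgraph) :
    SimpleGraph (Node E) :=
  SimpleGraph.fromRel fun v w => ∃ A ∈ v.1, opp A ∈ w.1

/-- The intersection of the subgraphs `A*`, for `A` in `v` (all of `X` if `v` is empty). -/
def core {V : Type*} {X : SimpleGraph V} (v : Set X.Subgraph) : X.Subgraph :=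
  sInf (opp '' v)

/-- The graph associated with `v`: the intersection of the `A*`, for `A` in `v`, together with a
virtual edge joining the two vertices of the hinge of `A`, for each `A` in `v` whose boundary has
two elements (no new edge if these vertices are already joined). -/
def vertexGraph {V : Type*} {X : SimpleGraph V} (v : Set X.Subgraph) :
    SimpleGraph (core v).verts :=
  (core v).coe ⊔ SimpleGraph.fromRel fun a b => ∃ A ∈ v, hinge A = {(a : V), (b : V)}

/-- `v` corresponds to the cut-point `c`: all edges at `v` have boundary `{c}`, and the
intersection of the subgraphs `A*`, for `A` in `v`, has `c` as its only vertex. -/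
def IsCutPointNode {V : Type*} {X : SimpleGraph V} (v : Set X.Subgraph) (c : V) : Prop :=
  IsCutPoint X c ∧ (∀ A ∈ v, hinge A = {c}) ∧ (core v).verts = {c}

/-- A finite cycle, of length at least three. -/
def IsCycleGraph {W : Type*} (Z : SimpleGraph W) : Prop :=
  ∃ n, 3 ≤ n ∧ Nonempty (Z ≃g SimpleGraph.cycleGraph n)

/-- 3-connected: at least two vertices, and removing at most two vertices never disconnects the
graph. A graph on two, three or four vertices is 3-connected in this sense if and only if
it is complete. -/
def IsThreeConnected {W : Type*} (Z : SimpleGraph W) : Prop :=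
  Nontrivial W ∧ ∀ S : Set W, S.encard ≤ 2 → (Z.induce Sᶜ).Preconnected

/-- Some subgraph of `X` is (isomorphic to) a subdivision of `Z`: vertices of `Z` are represented by
distinct vertices of `X`, and edges of `Z` by paths of `X` joining the representatives of their ends
that pass through no other representative and meet each other only in representatives. -/
def HasSubdivisionIn {W V : Type*} (Z : SimpleGraph W) (X : SimpleGraph V) : Prop :=
  ∃ (f : W → V) (p : ∀ a b, Z.Adj a b → X.Walk (f a) (f b)),
    Function.Injective f ∧
    (∀ a b h, (p a b h).IsPath) ∧
    (∀ a b (h : Z.Adj a b), p b a h.symm = (p a b h).reverse) ∧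
    (∀ a b h c, f c ∈ (p a b h).support → c = a ∨ c = b) ∧
    (∀ a b h c d h', s(a, b) ≠ s(c, d) →
      ∀ x, x ∈ (p a b h).support → x ∈ (p c d h').support → x ∈ Set.range f)

/-- Planar: the graph can be drawn in the plane with distinct points as vertices and simple arcs as
edges, so that an arc contains no vertices except its ends, and distinct arcs meet only in
vertices. -/
def IsPlanar {W : Type*} (Z : SimpleGraph W) : Prop :=
  ∃ (pt : W → EuclideanSpace ℝ (Fin 2)) (arc : Sym2 W → Set (EuclideanSpace ℝ (Fin 2))),
    Function.Injective pt ∧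
    (∀ a b, Z.Adj a b → ∃ γ : Path (pt a) (pt b),
      Function.Injective γ ∧ Set.range γ = arc s(a, b)) ∧
    (∀ e ∈ Z.edgeSet, ∀ w, pt w ∈ arc e → w ∈ e) ∧
    (∀ e ∈ Z.edgeSet, ∀ e' ∈ Z.edgeSet, e ≠ e' → arc e ∩ arc e' ⊆ Set.range pt)

end TutteTree


/-!
Subgraphs without isolated vertices are handled through their edge sets; the boundary of a set of
edges consists of the vertices incident with both the set and its complement.

The sets of edges with a one-vertex boundary that cross no other such set form a nested family,
which decomposes `X` at its cut-points. Edges not separated by a one-vertex boundary form the blocks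
of `X`. In a block, sets with a two-vertex boundary that cross no other such set are again nested.
To extend such a set from the block to `X` one has to decide, at each of the two boundary vertices,
on which side the edges outside the block go. Comparing numbers of uncrossed sets on the two sides
makes this choice depend only on the block, so that all extensions are nested with each other and
permuted by the automorphisms of `X`.

A separation of order two of a torso of the resulting tree set comes from a set with a two-vertex
boundary in a block. As that set does not occur in the tree set, it is crossed by another one,
which in turn gives a separation of the torso that crosses the first one. Thus either the torso has
no separation of order at most two, or all its separations of order two are crossed and it is a
cycle. Replacing the virtual edges of a torso by paths inside the separations attached there
exhibits a subdivision of the torso in `X`, along which a planar drawing can be transported.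
-/
namespace TutteTree

section EdgeSets
variable {V : Type*} {X : SimpleGraph V}

/-- The vertices incident with an edge in `F`. -/
def ends (F : Set (Sym2 V)) : Set V := {x | ∃ e ∈ F, x ∈ e}

/-- The boundary of a set of edges `F` relative to an ambient set of edges `Y`: the vertices at
which `F` and `Y \ F` meet. -/
def boundary (Y F : Set (Sym2 V)) : Set V := ends F ∩ ends (Y \ F)

/-- The edges of `Y` that are incident with the component of `x` after removal of the vertices
in `S`. -/
def componentEdges (Y : Set (Sym2 V)) (S : Set V) (x : V) : Set (Sym2 V) :=
  {e | e ∈ Y ∧ ∃ y ∈ e, ∃ p : (SimpleGraph.fromEdgeSet Y).Walk x y, ∀ z ∈ p.support, z ∉ S}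

variable {Y F F' : Set (Sym2 V)} {S : Set V} {x y : V} {e : Sym2 V}

theorem ends_mono (h : F ⊆ F') : ends F ⊆ ends F' :=
  fun _ ⟨e, he, hx⟩ => ⟨e, h he, hx⟩

theorem ends_union : ends (F ∪ F') = ends F ∪ ends F' := by
  ext x
  simp only [ends, Set.mem_union, Set.mem_ofPred_eq, or_and_right, exists_or]

theorem mem_ends_of_mk_mem (h : s(x, y) ∈ F) : x ∈ ends F :=
  ⟨_, h, Sym2.mem_mk_left x y⟩

theorem mem_ends_iff : x ∈ ends F ↔ ∃ y, s(x, y) ∈ F := by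
  constructor
  · rintro ⟨e, he, hx⟩
    obtain ⟨y, rfl⟩ := Sym2.mem_iff_exists.1 hx
    exact ⟨y, he⟩
  · rintro ⟨y, hy⟩
    exact mem_ends_of_mk_mem hy

theorem ends_nonempty (h : F.Nonempty) : (ends F).Nonempty := by
  obtain ⟨⟨x, y⟩, he⟩ := h
  exact ⟨x, mem_ends_of_mk_mem he⟩

theorem mem_ends_sdiff_of_notMem (hx : x ∈ ends Y) (hF : x ∉ ends F) : x ∈ ends (Y \ F) := by
  obtain ⟨e, he, hxe⟩ := hx
  exact ⟨e, ⟨he, fun h => hF ⟨e, h, hxe⟩⟩, hxe⟩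

theorem boundary_sdiff (h : F ⊆ Y) : boundary Y (Y \ F) = boundary Y F := by
  rw [boundary, boundary, Set.sdiff_sdiff_cancel_left h, Set.inter_comm]

theorem mem_of_notMem_boundary (hx : x ∈ ends F) (hb : x ∉ boundary Y F) (he : e ∈ Y)
    (hxe : x ∈ e) : e ∈ F := by
  by_contra hF
  exact hb ⟨hx, e, ⟨he, hF⟩, hxe⟩

theorem notMem_ends_or_of_notMem_boundary (hx : x ∉ boundary Y F) :
    x ∉ ends F ∨ x ∉ ends (Y \ F) :=
  not_and_or.1 hx

theorem mem_ends_of_walk {G : SimpleGraph V} (hG : G.edgeSet ⊆ Y) (p : G.Walk x y)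
    (hx : x ∈ ends F) (hp : ∀ z ∈ p.support, z ≠ y → z ∉ boundary Y F) : y ∈ ends F := by
  induction p with
  | nil => exact hx
  | @cons a b c hab p ih =>
    by_cases hac : a = c
    · exact hac ▸ hx
    · have hmem : s(a, b) ∈ F := mem_of_notMem_boundary hx
        (hp a (SimpleGraph.Walk.start_mem_support _) hac) (hG hab) (Sym2.mem_mk_left a b)
      exact ih ⟨_, hmem, Sym2.mem_mk_right a b⟩ fun z hz =>
        hp z (SimpleGraph.Walk.support_subset_support_cons p hab hz)

theorem fromEdgeSet_edgeSet_subset : (SimpleGraph.fromEdgeSet Y).edgeSet ⊆ Y := by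
  rw [SimpleGraph.edgeSet_fromEdgeSet]
  exact Set.sdiff_subset

theorem boundary_nonempty (hX : X.Connected) (hF : F.Nonempty) (hFc : (X.edgeSet \ F).Nonempty) :
    (boundary X.edgeSet F).Nonempty := by
  obtain ⟨x, hx⟩ := ends_nonempty hF
  obtain ⟨y, hy⟩ := ends_nonempty hFc
  obtain ⟨p⟩ := hX.preconnected x y
  by_contra! h
  have hyF : y ∈ ends F := mem_ends_of_walk le_rfl p hx fun z _ _ hz => by simp [h] at hz
  exact Set.notMem_empty y (h ▸ ⟨hyF, hy⟩)

theorem boundary_eq_singleton_of_subset (hX : X.Connected) (hF : F.Nonempty)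
    (hFc : (X.edgeSet \ F).Nonempty) {c : V} (h : boundary X.edgeSet F ⊆ {c}) :
    boundary X.edgeSet F = {c} :=
  (boundary_nonempty hX hF hFc).subset_singleton_iff.1 h

theorem ends_edgeSet [Nontrivial V] (hX : X.Connected) : ends X.edgeSet = Set.univ := by
  refine Set.eq_univ_of_forall fun x => mem_ends_iff.2 ?_
  exact hX.preconnected.exists_adj_of_nontrivial x

theorem componentEdges_subset : componentEdges Y S x ⊆ Y := fun _ h => h.1

theorem mem_componentEdges (hx : x ∉ S) (he : e ∈ Y) (hxe : x ∈ e) : e ∈ componentEdges Y S x :=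
  ⟨he, x, hxe, .nil, by simpa using hx⟩

theorem mem_componentEdges_edgeSet : e ∈ componentEdges X.edgeSet S x ↔
    e ∈ X.edgeSet ∧ ∃ y ∈ e, ∃ p : X.Walk x y, ∀ z ∈ p.support, z ∉ S := by
  rw [componentEdges, SimpleGraph.fromEdgeSet_edgeSet]
  rfl

theorem exists_walk_of_mem_componentEdges (he : e ∈ componentEdges Y S x) (hye : y ∈ e)
    (hy : y ∉ S) : ∃ p : (SimpleGraph.fromEdgeSet Y).Walk x y, ∀ z ∈ p.support, z ∉ S := by
  obtain ⟨heY, z, hze, p, hp⟩ := he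
  by_cases hyz : y = z
  · exact hyz ▸ ⟨p, hp⟩
  · obtain rfl := (Sym2.mem_and_mem_iff hyz).1 ⟨hye, hze⟩
    have hzy : (SimpleGraph.fromEdgeSet Y).Adj z y :=
      (SimpleGraph.fromEdgeSet_adj Y).2 ⟨Sym2.eq_swap ▸ heY, Ne.symm hyz⟩
    refine ⟨p.concat hzy, fun w hw => ?_⟩
    rw [SimpleGraph.Walk.support_concat, List.mem_append,
      List.mem_singleton] at hw
    rcases hw with hw | rfl
    · exact hp w hw
    · exact hy

theorem boundary_componentEdges_subset : boundary Y (componentEdges Y S x) ⊆ S := by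
  rintro y ⟨⟨e, he, hye⟩, e', he', hye'⟩
  by_contra hy
  obtain ⟨p, hp⟩ := exists_walk_of_mem_componentEdges he hye hy
  exact he'.2 ⟨he'.1, y, hye', p, hp⟩

theorem componentEdges_subset_of_boundary_subset (hF : boundary Y F ⊆ S) (hx : x ∈ ends F) :
    componentEdges Y S x ⊆ F := by
  rintro e ⟨heY, y, hye, p, hp⟩
  have hy : y ∈ ends F := mem_ends_of_walk fromEdgeSet_edgeSet_subset p hx fun z hz _ hzF =>
    hp z hz (hF hzF)
  exact mem_of_notMem_boundary hy (fun hyF => hp y p.end_mem_support (hF hyF)) heY hye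

end EdgeSets

section Subgraphs
variable {V : Type*} {X : SimpleGraph V}

/-- The subgraph of `X` formed by the edges in `F` and their ends. -/
def ofEdgeSet (X : SimpleGraph V) (F : Set (Sym2 V)) : X.Subgraph where
  verts := {x | ∃ y, X.Adj x y ∧ s(x, y) ∈ F}
  Adj x y := X.Adj x y ∧ s(x, y) ∈ F
  adj_sub h := h.1
  edge_vert h := ⟨_, h⟩
  symm := ⟨fun _ _ h => ⟨h.1.symm, Sym2.eq_swap ▸ h.2⟩⟩

variable {F F' : Set (Sym2 V)}

theorem verts_ofEdgeSet (hF : F ⊆ X.edgeSet) : (ofEdgeSet X F).verts = ends F := by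
  ext x
  rw [mem_ends_iff]
  exact ⟨fun ⟨y, h⟩ => ⟨y, h.2⟩, fun ⟨y, h⟩ => ⟨y, hF h, h⟩⟩

theorem ofEdgeSet_adj (hF : F ⊆ X.edgeSet) {x y : V} :
    (ofEdgeSet X F).Adj x y ↔ s(x, y) ∈ F :=
  ⟨fun h => h.2, fun h => ⟨hF h, h⟩⟩

theorem edgeSet_ofEdgeSet (hF : F ⊆ X.edgeSet) : (ofEdgeSet X F).edgeSet = F := by
  ext ⟨x, y⟩
  exact ofEdgeSet_adj hF

theorem ofEdgeSet_le_ofEdgeSet (hF : F ⊆ X.edgeSet) (hF' : F' ⊆ X.edgeSet) :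
    ofEdgeSet X F ≤ ofEdgeSet X F' ↔ F ⊆ F' := by
  refine ⟨fun h => ?_, fun h => ⟨?_, fun x y hxy => ⟨hxy.1, h hxy.2⟩⟩⟩
  · rw [← edgeSet_ofEdgeSet hF, ← edgeSet_ofEdgeSet hF']
    exact SimpleGraph.Subgraph.edgeSet_mono h
  · rw [verts_ofEdgeSet hF, verts_ofEdgeSet hF']
    exact ends_mono h

theorem ofEdgeSet_injOn : Set.InjOn (ofEdgeSet X) {F | F ⊆ X.edgeSet} := by
  intro F hF F' hF' h
  rw [← edgeSet_ofEdgeSet hF, h, edgeSet_ofEdgeSet hF']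

theorem hinge_ofEdgeSet (hF : F ⊆ X.edgeSet) :
    hinge (ofEdgeSet X F) = boundary X.edgeSet F := by
  ext x
  rw [boundary, Set.mem_inter_iff, mem_ends_iff (F := X.edgeSet \ F), hinge, Set.mem_ofPred_eq,
    verts_ofEdgeSet hF]
  refine and_congr_right fun _ => exists_congr fun z => ?_
  rw [ofEdgeSet_adj hF]
  rfl

theorem opp_ofEdgeSet (hX : ends X.edgeSet = Set.univ) (hF : F ⊆ X.edgeSet) :
    opp (ofEdgeSet X F) = ofEdgeSet X (X.edgeSet \ F) := by
  ext x y
  · change x ∈ (ofEdgeSet X F).vertsᶜ ∪ hinge (ofEdgeSet X F) ↔ _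
    rw [verts_ofEdgeSet Set.sdiff_subset, hinge_ofEdgeSet hF, verts_ofEdgeSet hF]
    have hx : x ∉ ends F → x ∈ ends (X.edgeSet \ F) :=
      mem_ends_sdiff_of_notMem (hX ▸ Set.mem_univ x)
    simp only [boundary, Set.mem_union, Set.mem_compl_iff, Set.mem_inter_iff]
    tauto
  · rw [ofEdgeSet_adj Set.sdiff_subset]
    change X.Adj x y ∧ ¬ (ofEdgeSet X F).Adj x y ↔ _
    rw [ofEdgeSet_adj hF]
    rfl

theorem ofEdgeSet_sup_opp (hX : ends X.edgeSet = Set.univ) (hF : F ⊆ X.edgeSet) :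
    ofEdgeSet X F ⊔ opp (ofEdgeSet X F) = ⊤ := by
  rw [opp_ofEdgeSet hX hF]
  ext x y
  · simp only [SimpleGraph.Subgraph.verts_sup, verts_ofEdgeSet hF,
      verts_ofEdgeSet Set.sdiff_subset, ← ends_union, Set.union_sdiff_cancel hF, hX,
      SimpleGraph.Subgraph.verts_top]
  · rw [SimpleGraph.Subgraph.sup_adj, ofEdgeSet_adj hF, ofEdgeSet_adj Set.sdiff_subset,
      ← Set.mem_union, Set.union_sdiff_cancel hF]
    rfl

theorem verts_ofEdgeSet_inf_opp (hX : ends X.edgeSet = Set.univ) (hF : F ⊆ X.edgeSet) :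
    (ofEdgeSet X F ⊓ opp (ofEdgeSet X F)).verts = boundary X.edgeSet F := by
  rw [opp_ofEdgeSet hX hF, SimpleGraph.Subgraph.verts_inf, verts_ofEdgeSet hF,
    verts_ofEdgeSet Set.sdiff_subset, boundary]

theorem edgeSet_inf_opp (A : X.Subgraph) : (A ⊓ opp A).edgeSet = ∅ := by
  refine Set.eq_empty_of_forall_notMem ?_
  rintro ⟨x, y⟩ ⟨hA, -, hA'⟩
  exact hA' hA

theorem exists_mem_ends_ne (hF : F ⊆ X.edgeSet) {c : V} (hc : c ∈ ends F) :
    ∃ x ∈ ends F, x ≠ c := by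
  obtain ⟨x, hx⟩ := mem_ends_iff.1 hc
  exact ⟨x, ⟨_, hx, Sym2.mem_mk_right c x⟩, (X.ne_of_adj (hF hx)).symm⟩

theorem isCutPoint_of_boundary (hF : F ⊆ X.edgeSet) {c : V} (hc : boundary X.edgeSet F = {c}) :
    IsCutPoint X c := by
  obtain ⟨hcF, hcF'⟩ : c ∈ boundary X.edgeSet F := hc ▸ Set.mem_singleton c
  obtain ⟨x, hx, hxc⟩ := exists_mem_ends_ne hF hcF
  obtain ⟨y, hy, hyc⟩ := exists_mem_ends_ne Set.sdiff_subset hcF'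
  intro hconn
  obtain ⟨p⟩ := hconn ⟨x, hxc⟩ ⟨y, hyc⟩
  let q : X.Walk x y := p.map (SimpleGraph.Embedding.induce _).toHom
  have hq : ∀ z ∈ q.support, z ≠ c := by
    intro z hz
    obtain ⟨z, -, rfl⟩ := List.mem_map.1 (SimpleGraph.Walk.support_map _ p ▸ hz)
    exact z.2
  have hyF : y ∈ ends F := mem_ends_of_walk le_rfl q hx fun z hz _ hzF =>
    hq z hz (by simpa [hc] using hzF)
  have hyb : y ∈ boundary X.edgeSet F := ⟨hyF, hy⟩
  rw [hc] at hyb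
  exact hyc hyb

/-- The translate of a set of edges by an automorphism. -/
def mapEdges (g : X ≃g X) (F : Set (Sym2 V)) : Set (Sym2 V) := Sym2.map g '' F

theorem mapEdges_subset_edgeSet (g : X ≃g X) (hF : F ⊆ X.edgeSet) :
    mapEdges g F ⊆ X.edgeSet := by
  rintro _ ⟨⟨x, y⟩, he, rfl⟩
  exact g.map_adj_iff.2 (hF he)

theorem ends_mapEdges (g : X ≃g X) : ends (mapEdges g F) = g '' ends F := by
  ext x
  constructor
  · rintro ⟨_, ⟨e, he, rfl⟩, hx⟩
    obtain ⟨y, hy, rfl⟩ := Sym2.mem_map.1 hx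
    exact ⟨y, ⟨e, he, hy⟩, rfl⟩
  · rintro ⟨y, ⟨e, he, hy⟩, rfl⟩
    exact ⟨_, ⟨e, he, rfl⟩, Sym2.mem_map.2 ⟨y, hy, rfl⟩⟩

theorem translate_ofEdgeSet (g : X ≃g X) (hF : F ⊆ X.edgeSet) :
    translate g (ofEdgeSet X F) = ofEdgeSet X (mapEdges g F) := by
  have hgF := mapEdges_subset_edgeSet g hF
  ext x y
  · rw [verts_ofEdgeSet hgF, ends_mapEdges, ← verts_ofEdgeSet hF]
    rfl
  · rw [ofEdgeSet_adj hgF, translate, SimpleGraph.Subgraph.map_adj]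
    constructor
    · rintro ⟨a, b, hab, rfl, rfl⟩
      exact ⟨s(a, b), hab.2, rfl⟩
    · rintro ⟨⟨a, b⟩, he, hxy⟩
      rcases Sym2.eq_iff.1 hxy with ⟨rfl, rfl⟩ | ⟨rfl, rfl⟩
      · exact ⟨a, b, ⟨hF he, he⟩, rfl, rfl⟩
      · exact ⟨b, a, ⟨(hF he).symm, Sym2.eq_swap ▸ he⟩, rfl, rfl⟩

end Subgraphs

end TutteTree

/-! ### Structure trees of nested families -/

namespace TutteTree

section TreeSets
variable {V : Type*} {X : SimpleGraph V} {E v : Set X.Subgraph} {A B C D : X.Subgraph}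

/-- A tree set of subgraphs: a nested family on which `opp` is an order-reversing involution, whose
intervals are finite, and in which no member lies below both another one and its opposite.
Its structure tree is a tree. -/
structure IsTreeSet (E : Set X.Subgraph) : Prop where
  opp_mem : ∀ {A}, A ∈ E → opp A ∈ E
  opp_opp : ∀ {A}, A ∈ E → opp (opp A) = A
  anti : ∀ {A B}, A ∈ E → B ∈ E → A ≤ B → opp B ≤ opp A
  nested : ∀ {A B}, A ∈ E → B ∈ E → A ≤ B ∨ A ≤ opp B ∨ opp A ≤ B ∨ opp A ≤ opp B
  not_le_opp : ∀ {A B}, A ∈ E → B ∈ E → A ≤ B → ¬ A ≤ opp B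
  finite_interval : ∀ {A B}, A ∈ E → B ∈ E → A ≤ B → {C | C ∈ E ∧ A ≤ C ∧ C ≤ B}.Finite

/-- The oriented edges of the structure tree of `E` with the same initial node as `A`. -/
def originSet (E : Set X.Subgraph) (A : X.Subgraph) : Set X.Subgraph :=
  {B | B ∈ E ∧ SameOrigin E A B}

/-- The initial node of the oriented edge `A` of the structure tree. -/
def origin (hA : A ∈ E) : Node E := ⟨originSet E A, Or.inr ⟨A, hA, rfl⟩⟩

theorem mem_originSet (hA : A ∈ E) : A ∈ originSet E A := ⟨hA, Or.inl rfl⟩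

theorem subset_of_isNode (hv : IsNode E v) : v ⊆ E := by
  rcases hv with ⟨-, rfl⟩ | ⟨A, -, rfl⟩
  · exact Set.empty_subset E
  · exact fun B hB => hB.1

namespace IsTreeSet

theorem le_opp_comm (h : IsTreeSet E) (hA : A ∈ E) (hB : B ∈ E) (hAB : A ≤ opp B) :
    B ≤ opp A := by
  simpa only [h.opp_opp hB] using h.anti hA (h.opp_mem hB) hAB

theorem opp_le_comm (h : IsTreeSet E) (hA : A ∈ E) (hB : B ∈ E) (hAB : opp A ≤ B) :
    opp B ≤ A := by
  simpa only [h.opp_opp hA] using h.anti (h.opp_mem hA) hB hAB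

theorem le_of_opp_le_opp (h : IsTreeSet E) (hA : A ∈ E) (hB : B ∈ E) (hAB : opp A ≤ opp B) :
    B ≤ A := by
  simpa only [h.opp_opp hA] using h.le_opp_comm (h.opp_mem hA) hB hAB

theorem lt_opp_comm (h : IsTreeSet E) (hA : A ∈ E) (hB : B ∈ E) (hAB : A < opp B) :
    B < opp A := by
  refine lt_of_le_of_ne (h.le_opp_comm hA hB hAB.le) ?_
  rintro rfl
  exact lt_irrefl _ (h.opp_opp hA ▸ hAB)

theorem opp_lt_comm (h : IsTreeSet E) (hA : A ∈ E) (hB : B ∈ E) (hAB : opp A < B) :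
    opp B < A := by
  refine lt_of_le_of_ne (h.opp_le_comm hA hB hAB.le) ?_
  rintro rfl
  exact lt_irrefl _ (h.opp_opp hB ▸ hAB)

theorem opp_lt_opp (h : IsTreeSet E) (hA : A ∈ E) (hB : B ∈ E) (hAB : A < B) : opp B < opp A :=
  h.lt_opp_comm hA (h.opp_mem hB) ((h.opp_opp hB).symm ▸ hAB)

theorem lt_of_opp_lt_opp (h : IsTreeSet E) (hA : A ∈ E) (hB : B ∈ E) (hAB : opp A < opp B) :
    B < A := by
  simpa only [h.opp_opp hA] using h.lt_opp_comm (h.opp_mem hA) hB hAB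

theorem sameOrigin_symm (h : IsTreeSet E) (hA : A ∈ E) (hB : B ∈ E)
    (hAB : SameOrigin E A B) : SameOrigin E B A := by
  rcases hAB with rfl | ⟨hlt, hno⟩
  · exact Or.inl rfl
  · refine Or.inr ⟨h.lt_opp_comm hA hB hlt, fun C hC ⟨hBC, hCA⟩ => hno (opp C) (h.opp_mem hC) ?_⟩
    exact ⟨h.lt_opp_comm hC hA hCA, h.opp_lt_opp hB hC hBC⟩

theorem le_opp_of_sameOrigin (h : IsTreeSet E) (hA : A ∈ E) (hB : B ∈ E) (hC : C ∈ E)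
    (hAB : SameOrigin E A B) (hCB : SameOrigin E C B) (hAC : A ≠ C) : A ≤ opp C := by
  rcases hAB with rfl | ⟨hAB, hnAB⟩
  · exact (hCB.resolve_left hAC.symm).1.le |> h.le_opp_comm hC hA
  rcases hCB with rfl | ⟨hCB, hnCB⟩
  · exact hAB.le
  rcases h.nested hA hC with hle | hle | hle | hle
  · exact absurd ⟨hle.lt_of_ne hAC, hCB⟩ (hnAB C hC)
  · exact hle
  · have hBA : B < A := (h.lt_opp_comm hC hB hCB).trans_le (h.opp_le_comm hA hC hle)
    exact absurd (h.lt_opp_comm hA hB hAB).le (h.not_le_opp hB hA hBA.le)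
  · exact absurd ⟨(h.le_of_opp_le_opp hA hC hle).lt_of_ne hAC.symm, hAB⟩ (hnCB A hA)

theorem not_between_of_sameOrigin (h : IsTreeSet E) (hA : A ∈ E) (hB : B ∈ E) (hC : C ∈ E)
    (hAB : SameOrigin E A B) (hBC : SameOrigin E B C) (hD : D ∈ E) : ¬ (A < D ∧ D < opp C) := by
  rcases hAB with rfl | ⟨hAB, hnAB⟩
  · rcases hBC with rfl | ⟨-, hnBC⟩
    · rintro ⟨hAD, hDA⟩
      exact h.not_le_opp hA hA le_rfl (hAD.trans hDA).le
    · exact hnBC D hD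
  rcases hBC with rfl | ⟨hBC, hnBC⟩
  · exact hnAB D hD
  rintro ⟨hAD, hDC⟩
  have not_opp_lt_opp : ¬ opp B < opp C := fun hlt =>
    h.not_le_opp hC hB (h.lt_of_opp_lt_opp hB hC hlt).le (h.lt_opp_comm hB hC hBC).le
  rcases h.nested hD hB with hle | hle | hle | hle
  · exact h.not_le_opp hA hB (hAD.le.trans hle) hAB.le
  · rcases hle.eq_or_lt with rfl | hlt
    · exact not_opp_lt_opp hDC
    · exact hnAB D hD ⟨hAD, hlt⟩
  · exact not_opp_lt_opp ((h.opp_le_comm hD hB hle).trans_lt hDC)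
  · rcases (h.le_of_opp_le_opp hD hB hle).eq_or_lt with rfl | hlt
    · exact h.not_le_opp hA hB hAD.le hAB.le
    · exact hnBC D hD ⟨hlt, hDC⟩

theorem sameOrigin_trans (h : IsTreeSet E) (hA : A ∈ E) (hB : B ∈ E) (hC : C ∈ E)
    (hAB : SameOrigin E A B) (hBC : SameOrigin E B C) : SameOrigin E A C := by
  by_cases hAC : A = C
  · exact Or.inl hAC
  have hCB := h.sameOrigin_symm hB hC hBC
  refine Or.inr ⟨(h.le_opp_of_sameOrigin hA hB hC hAB hCB hAC).lt_of_ne ?_,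
    fun D hD => h.not_between_of_sameOrigin hA hB hC hAB hBC hD⟩
  rintro rfl
  rcases hBC with rfl | ⟨hBC, -⟩
  · rcases hAB with hAB | ⟨hAB, -⟩
    exacts [hAC hAB, lt_irrefl _ hAB]
  · rcases h.sameOrigin_symm (h.opp_mem hC) hB hAB with rfl | ⟨hBA, -⟩
    exacts [lt_irrefl _ hBC, h.not_le_opp hB (h.opp_mem hC) hBC.le hBA.le]

theorem originSet_eq (h : IsTreeSet E) (hA : A ∈ E) (hB : B ∈ originSet E A) :
    originSet E B = originSet E A := by
  ext C
  refine and_congr_right fun hC => ⟨h.sameOrigin_trans hA hB.1 hC hB.2, ?_⟩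
  exact h.sameOrigin_trans hB.1 hA hC (h.sameOrigin_symm hA hB.1 hB.2)

theorem eq_originSet (h : IsTreeSet E) (hv : IsNode E v) (hA : A ∈ v) : v = originSet E A := by
  rcases hv with ⟨-, rfl⟩ | ⟨B, hB, rfl⟩
  · exact absurd hA (Set.notMem_empty A)
  · exact (h.originSet_eq hB hA).symm

theorem eq_origin (h : IsTreeSet E) (v : Node E) (hA : A ∈ v.1) :
    v = origin (subset_of_isNode v.2 hA) :=
  Subtype.ext (h.eq_originSet v.2 hA)

theorem le_opp_of_mem_node (h : IsTreeSet E) (hv : IsNode E v) (hA : A ∈ v) (hB : B ∈ v)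
    (hne : A ≠ B) : A ≤ opp B := by
  rw [h.eq_originSet hv hA] at hB
  exact (hB.2.resolve_left hne).1.le

theorem opp_notMem_originSet (h : IsTreeSet E) (hA : A ∈ E) : opp A ∉ originSet E A := by
  rintro ⟨-, hAA | ⟨hAA, -⟩⟩
  · exact h.not_le_opp hA hA le_rfl hAA.le
  · exact lt_irrefl _ (h.opp_opp hA ▸ hAA)

theorem adj_origin (h : IsTreeSet E) (hA : A ∈ E) :
    (structureTree E).Adj (origin hA) (origin (h.opp_mem hA)) := by
  refine ⟨fun he => h.opp_notMem_originSet hA ?_,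
    Or.inl ⟨A, mem_originSet hA, mem_originSet (h.opp_mem hA)⟩⟩
  rw [show originSet E A = originSet E (opp A) from congrArg Subtype.val he]
  exact mem_originSet (h.opp_mem hA)

theorem exists_of_adj (h : IsTreeSet E) {v w : Node E} (hvw : (structureTree E).Adj v w) :
    ∃ A ∈ v.1, opp A ∈ w.1 := by
  obtain ⟨-, hA | ⟨A, hA, hoA⟩⟩ := hvw
  · exact hA
  · exact ⟨opp A, hoA, by rwa [h.opp_opp (subset_of_isNode w.2 hA)]⟩

theorem eq_of_mem_originSet (h : IsTreeSet E) (hA : A ∈ E) (hB : B ∈ E)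
    (hAB : B ∈ originSet E A) (hoAB : opp B ∈ originSet E (opp A)) : A = B := by
  rcases hAB.2 with hAB | ⟨hAB, -⟩
  · exact hAB
  rcases hoAB.2 with hoAB | ⟨hoAB, -⟩
  · rw [← h.opp_opp hA, hoAB, h.opp_opp hB]
  · rw [h.opp_opp hB] at hoAB
    exact absurd (hAB.trans (h.opp_lt_comm hA hB hoAB)) (lt_irrefl _)

theorem exists_cover (h : IsTreeSet E) (hA : A ∈ E) (hB : B ∈ E) (hAB : A < B) :
    ∃ C ∈ E, A < C ∧ C ≤ B ∧ ∀ D ∈ E, ¬ (A < D ∧ D < C) := by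
  have hfin : {C | C ∈ E ∧ A < C ∧ C ≤ B}.Finite :=
    (h.finite_interval hA hB hAB.le).subset fun C ⟨hC, hAC, hCB⟩ => ⟨hC, hAC.le, hCB⟩
  obtain ⟨C, ⟨hC, hAC, hCB⟩, hmin⟩ := hfin.exists_minimal ⟨B, hB, hAB, le_rfl⟩
  exact ⟨C, hC, hAC, hCB, fun D hD ⟨hAD, hDC⟩ =>
    hDC.not_ge (hmin ⟨hD, hAD, hDC.le.trans hCB⟩ hDC.le)⟩

theorem opp_mem_originSet_of_cover (h : IsTreeSet E) (hB : B ∈ E) (hAB : A < B)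
    (hno : ∀ D ∈ E, ¬ (A < D ∧ D < B)) : opp B ∈ originSet E A :=
  ⟨h.opp_mem hB, Or.inr ⟨by rwa [h.opp_opp hB], by rwa [h.opp_opp hB]⟩⟩

theorem exists_mem_originSet_opp_le (h : IsTreeSet E) (hD : D ∈ E) (hB : B ∈ E) (hDB : D ≤ B) :
    ∃ A ∈ originSet E D, B ≤ A ∨ opp B ≤ A := by
  rcases hDB.eq_or_lt with rfl | hlt
  · exact ⟨D, mem_originSet hD, Or.inl le_rfl⟩
  · obtain ⟨C, hC, hDC, hCB, hcover⟩ := h.exists_cover hD hB hlt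
    exact ⟨opp C, h.opp_mem_originSet_of_cover hC hDC hcover, Or.inr (h.anti hC hB hCB)⟩

theorem exists_mem_node_le_or_opp_le (h : IsTreeSet E) (hv : IsNode E v) (hB : B ∈ E) :
    ∃ A ∈ v, B ≤ A ∨ opp B ≤ A := by
  obtain ⟨rfl, -⟩ | ⟨D, hD, rfl⟩ := hv
  · exact absurd hB (Set.notMem_empty B)
  rcases h.nested hB hD with hle | hle | hle | hle
  · exact ⟨D, mem_originSet hD, Or.inl hle⟩
  · obtain ⟨A, hA, hBA⟩ :=
      h.exists_mem_originSet_opp_le hD (h.opp_mem hB) (h.le_opp_comm hB hD hle)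
    rw [h.opp_opp hB] at hBA
    exact ⟨A, hA, hBA.symm⟩
  · exact ⟨D, mem_originSet hD, Or.inr hle⟩
  · exact h.exists_mem_originSet_opp_le hD hB (h.le_of_opp_le_opp hB hD hle)

theorem reachable_of_le (h : IsTreeSet E) (hA : A ∈ E) (hB : B ∈ E) (hAB : A ≤ B) :
    (structureTree E).Reachable (origin hA) (origin hB) := by
  induction hn : {C | C ∈ E ∧ A ≤ C ∧ C ≤ B}.ncard using Nat.strong_induction_on
    generalizing A with
  | _ n ih =>
    rcases hAB.eq_or_lt with rfl | hlt
    · exact .rfl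
    obtain ⟨C, hC, hAC, hCB, hcover⟩ := h.exists_cover hA hB hlt
    have hAC' : origin hA = origin (h.opp_mem hC) :=
      h.eq_origin (origin hA) (h.opp_mem_originSet_of_cover hC hAC hcover)
    rw [hAC']
    refine (h.adj_origin hC).symm.reachable.trans (ih _ ?_ hC hCB rfl)
    rw [← hn]
    refine Set.ncard_lt_ncard ⟨fun D ⟨hD, hCD, hDB⟩ => ⟨hD, hAC.le.trans hCD, hDB⟩, fun hsub => ?_⟩
      (h.finite_interval hA hB hAB)
    exact hAC.not_ge (hsub ⟨hA, le_rfl, hAB⟩).2.1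

theorem reachable_origin (h : IsTreeSet E) (hA : A ∈ E) (hB : B ∈ E) :
    (structureTree E).Reachable (origin hA) (origin hB) := by
  have hoA := (h.adj_origin hA).reachable
  have hoB := (h.adj_origin hB).symm.reachable
  rcases h.nested hA hB with hle | hle | hle | hle
  · exact h.reachable_of_le hA hB hle
  · exact (h.reachable_of_le hA (h.opp_mem hB) hle).trans hoB
  · exact hoA.trans (h.reachable_of_le (h.opp_mem hA) hB hle)
  · exact hoA.trans ((h.reachable_of_le (h.opp_mem hA) (h.opp_mem hB) hle).trans hoB)

theorem preconnected (h : IsTreeSet E) : (structureTree E).Preconnected := by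
  rintro ⟨v, ⟨hE, rfl⟩ | ⟨A, hA, rfl⟩⟩ ⟨w, ⟨hE', rfl⟩ | ⟨B, hB, rfl⟩⟩
  · exact .rfl
  · exact absurd (hE ▸ hB) (Set.notMem_empty B)
  · exact absurd (hE' ▸ hA) (Set.notMem_empty A)
  · exact h.reachable_origin hA hB

theorem exists_ge_mem_originSet_opp (h : IsTreeSet E) (hA : A ∈ E) (hD : D ∈ E) (hne : D ≠ A)
    (hB : B ∈ originSet E D) (hAB : A ≤ B) : ∃ B' ∈ originSet E (opp D), A ≤ B' := by
  rcases hB.2 with rfl | ⟨hDB, -⟩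
  · obtain ⟨C, hC, hDC, hCA, hcover⟩ := h.exists_cover (h.opp_mem hD) (h.opp_mem hA)
      (h.opp_lt_opp hA hD (hAB.lt_of_ne hne.symm))
    exact ⟨opp C, h.opp_mem_originSet_of_cover hC hDC hcover, h.le_opp_comm hC hA hCA⟩
  · exact ⟨opp D, mem_originSet (h.opp_mem hD), hAB.trans (h.lt_opp_comm hD hB.1 hDB).le⟩

/-- A walk that avoids the tree edge of `A` never leaves the side to which `A` points. -/
theorem exists_ge_of_walk (h : IsTreeSet E) (hA : A ∈ E) {v w a b : Node E} (hv : A ∈ v.1)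
    (hw : opp A ∈ w.1)
    (p : ((structureTree E) \ SimpleGraph.fromEdgeSet {s(v, w)}).Walk a b) :
    (∃ B ∈ a.1, A ≤ B) → ∃ B ∈ b.1, A ≤ B := by
  induction p with
  | nil => exact id
  | @cons a b c hab q ih =>
    rintro ⟨B, hB, hAB⟩
    apply ih
    obtain ⟨hadj, hvw⟩ := (SimpleGraph.sdiff_adj _ _ _ _).1 hab
    obtain ⟨D, hDa, hDb⟩ := h.exists_of_adj hadj
    have hDE := subset_of_isNode a.2 hDa
    have hne : D ≠ A := by
      rintro rfl
      have hav : a = v := (h.eq_origin a hDa).trans (h.eq_origin v hv).symm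
      have hbw : b = w := (h.eq_origin b hDb).trans (h.eq_origin w hw).symm
      subst hav hbw
      exact hvw ⟨rfl, hadj.ne⟩
    rw [h.eq_originSet a.2 hDa] at hB
    rw [h.eq_originSet b.2 hDb]
    exact h.exists_ge_mem_originSet_opp hA hDE hne hB hAB

theorem isAcyclic (h : IsTreeSet E) : (structureTree E).IsAcyclic := by
  rw [SimpleGraph.isAcyclic_iff_forall_adj_isBridge]
  intro v w hvw
  rw [SimpleGraph.isBridge_iff]
  rintro ⟨p⟩
  obtain ⟨A, hv, hw⟩ := h.exists_of_adj hvw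
  have hA := subset_of_isNode v.2 hv
  obtain ⟨B, hB, hAB⟩ := h.exists_ge_of_walk hA hv hw p ⟨A, hv, le_rfl⟩
  rw [h.eq_originSet w.2 hw] at hB
  rcases hB.2 with rfl | ⟨hlt, -⟩
  · exact h.not_le_opp hA hA le_rfl hAB
  · exact (h.lt_of_opp_lt_opp hA hB.1 hlt).not_ge hAB

theorem isTree (h : IsTreeSet E) : (structureTree E).IsTree := by
  have : Nonempty (Node E) := by
    rcases E.eq_empty_or_nonempty with hE | ⟨A, hA⟩
    · exact ⟨⟨∅, Or.inl ⟨hE, rfl⟩⟩⟩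
    · exact ⟨origin hA⟩
  exact { preconnected := h.preconnected, nonempty := this, isAcyclic := h.isAcyclic }

theorem exists_equiv_dart (h : IsTreeSet E) : ∃ Φ : E ≃ (structureTree E).Dart,
    ∀ A : E, A.1 ∈ (Φ A).fst.1 ∧ opp A.1 ∈ (Φ A).snd.1 := by
  let f (A : E) : (structureTree E).Dart :=
    ⟨(origin A.2, origin (h.opp_mem A.2)), h.adj_origin A.2⟩
  have hinj : Function.Injective f := by
    intro A B hAB
    have hfst : originSet E A.1 = originSet E B.1 := congrArg (fun d => d.fst.1) hAB
    have hsnd : originSet E (opp A.1) = originSet E (opp B.1) := congrArg (fun d => d.snd.1) hAB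
    refine Subtype.ext (h.eq_of_mem_originSet A.2 B.2 ?_ ?_)
    · exact hfst ▸ mem_originSet B.2
    · exact hsnd ▸ mem_originSet (h.opp_mem B.2)
  have hsurj : Function.Surjective f := by
    rintro ⟨⟨v, w⟩, hvw⟩
    obtain ⟨A, hv, hw⟩ := h.exists_of_adj hvw
    refine ⟨⟨A, subset_of_isNode v.2 hv⟩, SimpleGraph.Dart.ext _ _ ?_⟩
    exact Prod.ext (h.eq_origin v hv).symm (h.eq_origin w hw).symm
  exact ⟨Equiv.ofBijective f ⟨hinj, hsurj⟩,
    fun A => ⟨mem_originSet A.2, mem_originSet (h.opp_mem A.2)⟩⟩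

end IsTreeSet

end TreeSets

end TutteTree

/-! ### Automorphisms -/

namespace TutteTree

section Action
open SimpleGraph
variable {V : Type*} {X : SimpleGraph V} {E v : Set X.Subgraph} {A B : X.Subgraph}

theorem translate_one (A : X.Subgraph) : translate 1 A = A := by
  ext x y <;> simp [translate, Subgraph.map_adj, Relation.Map]

theorem translate_mul (g h : X ≃g X) (A : X.Subgraph) :
    translate (g * h) A = translate g (translate h A) := by
  ext x y <;> simp [translate, Subgraph.map_adj, Relation.Map]

theorem translate_inv_translate (g : X ≃g X) (A : X.Subgraph) :
    translate g⁻¹ (translate g A) = A := by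
  rw [← translate_mul, inv_mul_cancel, translate_one]

theorem translate_translate_inv (g : X ≃g X) (A : X.Subgraph) :
    translate g (translate g⁻¹ A) = A := by
  rw [← translate_mul, mul_inv_cancel, translate_one]

theorem translate_mono (g : X ≃g X) (h : A ≤ B) : translate g A ≤ translate g B :=
  Subgraph.map_mono h

theorem translate_le (g : X ≃g X) : translate g A ≤ translate g B ↔ A ≤ B := by
  refine ⟨fun h => ?_, translate_mono g⟩
  simpa only [translate_inv_translate] using translate_mono g⁻¹ h

theorem translate_lt (g : X ≃g X) : translate g A < translate g B ↔ A < B := by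
  simp only [lt_iff_le_not_ge, translate_le]

theorem mem_translate_verts {g : X ≃g X} {x : V} : g x ∈ (translate g A).verts ↔ x ∈ A.verts := by
  simp [translate]

theorem translate_adj {g : X ≃g X} {x y : V} : (translate g A).Adj (g x) (g y) ↔ A.Adj x y := by
  simp [translate, Subgraph.map_adj, Relation.Map]

theorem mem_hinge_translate {g : X ≃g X} {x : V} : g x ∈ hinge (translate g A) ↔ x ∈ hinge A := by
  simp only [hinge, Set.mem_ofPred_eq, mem_translate_verts]
  refine and_congr_right fun _ => ?_
  rw [g.surjective.exists]
  simp only [g.map_adj_iff, translate_adj]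

theorem hinge_translate (g : X ≃g X) : hinge (translate g A) = g '' hinge A := by
  ext x
  obtain ⟨x, rfl⟩ := g.surjective x
  rw [mem_hinge_translate, g.injective.mem_set_image]

theorem opp_translate (g : X ≃g X) : opp (translate g A) = translate g (opp A) := by
  ext x y
  · obtain ⟨x, rfl⟩ := g.surjective x
    rw [mem_translate_verts]
    simp only [opp, Set.mem_union, Set.mem_compl_iff, mem_translate_verts, mem_hinge_translate]
  · obtain ⟨x, rfl⟩ := g.surjective x
    obtain ⟨y, rfl⟩ := g.surjective y
    rw [translate_adj]
    simp only [opp, translate_adj, g.map_adj_iff]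

theorem SameOrigin.translate (hE : ∀ g : X ≃g X, ∀ A ∈ E, translate g A ∈ E) (g : X ≃g X)
    (h : SameOrigin E A B) : SameOrigin E (translate g A) (translate g B) := by
  rcases h with rfl | ⟨hAB, hno⟩
  · exact Or.inl rfl
  · refine Or.inr ⟨by rwa [opp_translate, translate_lt], fun C hC hbetween => ?_⟩
    rw [opp_translate, ← translate_translate_inv g C, translate_lt, translate_lt] at hbetween
    exact hno _ (hE g⁻¹ C hC) hbetween

theorem IsNode.translate (hE : ∀ g : X ≃g X, ∀ A ∈ E, translate g A ∈ E) (g : X ≃g X)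
    (h : IsNode E v) : IsNode E (translate g '' v) := by
  rcases h with ⟨hempty, rfl⟩ | ⟨A, hA, rfl⟩
  · exact Or.inl ⟨hempty, Set.image_empty _⟩
  · refine Or.inr ⟨_, hE g A hA, ?_⟩
    ext B
    constructor
    · rintro ⟨B, ⟨hB, h⟩, rfl⟩
      exact ⟨hE g B hB, h.translate hE g⟩
    · rintro ⟨hB, h⟩
      have hback := h.translate hE g⁻¹
      rw [translate_inv_translate] at hback
      exact ⟨_, ⟨hE g⁻¹ B hB, hback⟩, translate_translate_inv g B⟩

/-- The action of an automorphism on the nodes of the structure tree of an invariant family. -/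
def nodeMap (hE : ∀ g : X ≃g X, ∀ A ∈ E, translate g A ∈ E) (g : X ≃g X) (v : Node E) : Node E :=
  ⟨translate g '' v.1, v.2.translate hE g⟩

theorem nodeMap_one (hE : ∀ g : X ≃g X, ∀ A ∈ E, translate g A ∈ E) (v : Node E) :
    nodeMap hE 1 v = v :=
  Subtype.ext (by simp [nodeMap, translate_one])

theorem nodeMap_mul (hE : ∀ g : X ≃g X, ∀ A ∈ E, translate g A ∈ E) (g h : X ≃g X) (v : Node E) :
    nodeMap hE (g * h) v = nodeMap hE g (nodeMap hE h v) :=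
  Subtype.ext (by simp [nodeMap, translate_mul, Set.image_image])

theorem nodeMap_adj (hE : ∀ g : X ≃g X, ∀ A ∈ E, translate g A ∈ E) (g : X ≃g X) {v w : Node E}
    (h : (structureTree E).Adj v w) :
    (structureTree E).Adj (nodeMap hE g v) (nodeMap hE g w) := by
  refine ⟨fun he => h.1 ?_, h.2.imp ?_ ?_⟩
  · rw [← nodeMap_one hE v, ← nodeMap_one hE w, ← inv_mul_cancel g, nodeMap_mul, he, nodeMap_mul]
  all_goals
    rintro ⟨A, hA, hoA⟩
    exact ⟨translate g A, ⟨A, hA, rfl⟩, by rw [opp_translate]; exact ⟨_, hoA, rfl⟩⟩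

/-- The automorphism of the structure tree of an invariant family induced by an automorphism of the
graph. -/
def structureTreeIso (hE : ∀ g : X ≃g X, ∀ A ∈ E, translate g A ∈ E) (g : X ≃g X) :
    structureTree E ≃g structureTree E where
  toFun := nodeMap hE g
  invFun := nodeMap hE g⁻¹
  left_inv v := by rw [← nodeMap_mul, inv_mul_cancel, nodeMap_one]
  right_inv v := by rw [← nodeMap_mul, mul_inv_cancel, nodeMap_one]
  map_rel_iff' {v w} := by
    refine ⟨fun h => ?_, nodeMap_adj hE g⟩
    have hback := nodeMap_adj hE g⁻¹ h
    simpa [← nodeMap_mul, nodeMap_one] using hback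

theorem exists_structureTree_action (hE : ∀ g : X ≃g X, ∀ A ∈ E, translate g A ∈ E) :
    ∃ ρ : (X ≃g X) →* (structureTree E ≃g structureTree E),
      ∀ g v, (ρ g v).1 = translate g '' v.1 :=
  ⟨{ toFun := structureTreeIso hE
     map_one' := RelIso.ext fun v => nodeMap_one hE v
     map_mul' := fun g h => RelIso.ext fun v => nodeMap_mul hE g h v }, fun _ _ => rfl⟩

theorem mem_core {x : V} : x ∈ (core v).verts ↔ ∀ A ∈ v, x ∈ (opp A).verts := by
  simp [core]

theorem core_adj {x y : V} : (core v).Adj x y ↔ X.Adj x y ∧ ∀ A ∈ v, ¬ A.Adj x y := by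
  simp only [core, Subgraph.sInf_adj, Set.forall_mem_image, opp]
  exact ⟨fun h => ⟨h.2, fun A hA => (h.1 hA).2⟩, fun h => ⟨fun A hA => ⟨h.1, h.2 A hA⟩, h.1⟩⟩

theorem vertexGraph_adj {a b : (core v).verts} : (vertexGraph v).Adj a b ↔
    a ≠ b ∧ ((X.Adj a b ∧ ∀ A ∈ v, ¬ A.Adj a b) ∨ ∃ A ∈ v, hinge A = {(a : V), (b : V)}) := by
  rw [vertexGraph, sup_adj, fromRel_adj, Subgraph.coe_adj, core_adj]
  constructor
  · rintro (h | ⟨hne, h | h⟩)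
    · exact ⟨fun he => h.1.ne (congrArg _ he), Or.inl h⟩
    · exact ⟨hne, Or.inr h⟩
    · rw [Set.pair_comm] at h
      exact ⟨hne, Or.inr h⟩
  · rintro ⟨hne, h | h⟩
    · exact Or.inl h
    · exact Or.inr ⟨hne, Or.inl h⟩

theorem exists_vertexGraph_iso {g : X ≃g X} (hg : translate g '' v = v) :
    ∃ ψ : vertexGraph v ≃g vertexGraph v, ∀ z, (ψ z : V) = g (z : V) := by
  have hall : ∀ P : X.Subgraph → Prop, (∀ A ∈ v, P A) ↔ ∀ A ∈ v, P (translate g A) := by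
    intro P
    conv_lhs => rw [← hg]
    exact Set.forall_mem_image
  have hex : ∀ P : X.Subgraph → Prop, (∃ A ∈ v, P A) ↔ ∃ A ∈ v, P (translate g A) := by
    intro P
    conv_lhs => rw [← hg]
    exact Set.exists_mem_image
  have hcore : ∀ x, x ∈ (core v).verts ↔ g x ∈ (core v).verts := by
    intro x
    rw [mem_core, mem_core, hall (fun A => g x ∈ (opp A).verts)]
    simp only [opp_translate, mem_translate_verts]
  refine ⟨⟨g.toEquiv.subtypeEquiv hcore, ?_⟩, fun z => rfl⟩
  intro a b
  rw [vertexGraph_adj, vertexGraph_adj, hall (fun A => ¬ A.Adj _ _),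
    hex (fun A => hinge A = _)]
  refine and_congr ((Equiv.injective _).ne_iff) (or_congr ?_ ?_)
  · exact and_congr g.map_adj_iff (forall₂_congr fun A _ => not_congr translate_adj)
  · refine exists_congr fun A => and_congr_right fun _ => ?_
    rw [hinge_translate]
    change g '' hinge A = {g a, g b} ↔ _
    rw [← Set.image_pair, g.injective.image_injective.eq_iff]

end Action

end TutteTree

/-! ### Graphs whose separations of order two are all crossed -/

namespace TutteTree

section CycleGraphs
open SimpleGraph
variable {W : Type*} {Z : SimpleGraph W} {S C D : Set W} {u v w x y z : W}

theorem isPath_append {p : Z.Walk x y} {q : Z.Walk y z} (hp : p.IsPath) (hq : q.IsPath)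
    (h : ∀ a ∈ p.support, a ∈ q.support → a = y) : (p.append q).IsPath := by
  have hq' := hq.support_nodup
  rw [← q.cons_tail_support, List.nodup_cons] at hq'
  rw [Walk.isPath_def, Walk.support_append, List.nodup_append']
  refine ⟨hp.support_nodup, hq'.2, fun a ha ha' => hq'.1 ?_⟩
  obtain rfl := h a ha (List.mem_of_mem_tail ha')
  exact ha'

theorem cycleGraph_adj_iff_mod {n : ℕ} (hn : 2 ≤ n) {i j : Fin n} :
    (cycleGraph n).Adj i j ↔ j.1 = (i.1 + 1) % n ∨ i.1 = (j.1 + 1) % n := by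
  have sub_val_eq_one (i j : Fin n) : (i - j).val = 1 ↔ i.1 = (j.1 + 1) % n := by
    have hi := i.2
    have hmod : (j.1 + 1) % n = if j.1 + 1 = n then 0 else j.1 + 1 := by
      split_ifs with hj
      · rw [hj, Nat.mod_self]
      · exact Nat.mod_eq_of_lt (by omega)
    rw [hmod]
    rcases lt_or_ge i j with hij | hij
    · rw [Fin.coe_sub_iff_lt.2 hij]
      have : i.1 < j.1 := hij
      split_ifs <;> omega
    · rw [Fin.sub_val_of_le hij]
      have : j.1 ≤ i.1 := hij
      split_ifs <;> omega
  rw [cycleGraph_adj', sub_val_eq_one, sub_val_eq_one, or_comm]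

theorem isCycleGraph_of_isCycle {c : Z.Walk x x} (hc : c.IsCycle) (hverts : ∀ y, y ∈ c.support)
    (hedges : ∀ y z, Z.Adj y z → s(y, z) ∈ c.edges) : IsCycleGraph Z := by
  have hlen := hc.three_le_length
  refine ⟨c.length, hlen, ⟨RelIso.symm ?_⟩⟩
  let f (i : Fin c.length) : W := c.getVert i
  let next (i : Fin c.length) : Fin c.length := ⟨(i.1 + 1) % c.length, Nat.mod_lt _ (by omega)⟩
  have hinj : Function.Injective f := fun i j hij =>
    Fin.ext (hc.getVert_injOn' (show i.1 ≤ c.length - 1 by omega)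
      (show j.1 ≤ c.length - 1 by omega) hij)
  have f_next (i : Fin c.length) : f (next i) = c.getVert (i.1 + 1) := by
    rcases Nat.lt_or_ge (i.1 + 1) c.length with hi | hi
    · exact congrArg c.getVert (Nat.mod_eq_of_lt hi)
    · have hi : i.1 + 1 = c.length := by omega
      change c.getVert ((i.1 + 1) % c.length) = _
      rw [hi, Nat.mod_self, c.getVert_zero, c.getVert_length]
  have hsurj : Function.Surjective f := by
    intro y
    obtain ⟨k, rfl, hk⟩ := Walk.mem_support_iff_exists_getVert.1 (hverts y)
    rcases hk.lt_or_eq with hk | rfl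
    · exact ⟨⟨k, hk⟩, rfl⟩
    · exact ⟨⟨0, by omega⟩, c.getVert_zero.trans c.getVert_length.symm⟩
  have adj_next (i : Fin c.length) : Z.Adj (f i) (f (next i)) :=
    f_next i ▸ c.adj_getVert_succ i.2
  refine ⟨Equiv.ofBijective f ⟨hinj, hsurj⟩, fun {i j} => ?_⟩
  change Z.Adj (f i) (f j) ↔ _
  rw [cycleGraph_adj_iff_mod (by omega)]
  constructor
  · intro hij
    obtain ⟨k, hk, hkij⟩ := (Walk.mk_mem_edges_iff_exists c).1 (hedges _ _ hij)
    rw [← f_next ⟨k, hk⟩] at hkij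
    rcases Sym2.eq_iff.1 hkij with ⟨hi, hj⟩ | ⟨hj, hi⟩
    · obtain rfl : ⟨k, hk⟩ = i := hinj hi
      exact Or.inl (congrArg Fin.val (hinj hj.symm))
    · obtain rfl : ⟨k, hk⟩ = j := hinj hj
      exact Or.inr (congrArg Fin.val (hinj hi.symm))
  · rintro (hj | hi)
    · exact (Fin.ext hj : j = next i) ▸ adj_next i
    · exact (Fin.ext hi : i = next j) ▸ (adj_next j).symm

/-- A separation `(C, D)` of the graph `Z` with separator `S`: the vertex set is the disjoint union
of `S`, `C` and `D`, there is no edge between `C` and `D`, and neither of these is empty. -/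
structure Separates (Z : SimpleGraph W) (S C D : Set W) : Prop where
  cover : ∀ x, x ∈ S ∨ x ∈ C ∨ x ∈ D
  notMem_left : ∀ {x}, x ∈ S → x ∉ C
  notMem_right : ∀ {x}, x ∈ S → x ∉ D
  disj : ∀ {x}, x ∈ C → x ∉ D
  not_adj : ∀ {x y}, x ∈ C → y ∈ D → ¬ Z.Adj x y
  left_nonempty : C.Nonempty
  right_nonempty : D.Nonempty

theorem separates_compl (hC : C.Nonempty) (hD : (C ∪ S)ᶜ.Nonempty) (hSC : ∀ x ∈ S, x ∉ C)
    (hadj : ∀ x ∈ C, ∀ y, Z.Adj x y → y ∉ S → y ∈ C) : Separates Z S C (C ∪ S)ᶜ where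
  cover x := by
    rw [Set.mem_compl_iff, Set.mem_union]
    tauto
  notMem_left := hSC _
  notMem_right hx hx' := hx' (Or.inr hx)
  disj hx hx' := hx' (Or.inl hx)
  not_adj hx hy hxy := hy (Or.inl (hadj _ hx _ hxy fun hyS => hy (Or.inr hyS)))
  left_nonempty := hC
  right_nonempty := hD

theorem exists_separates (h : ¬ (Z.induce Sᶜ).Preconnected) : ∃ C D, Separates Z S C D := by
  rw [Preconnected] at h
  push Not at h
  obtain ⟨x, y, hxy⟩ := h
  refine ⟨{z | ∃ hz : z ∈ Sᶜ, (Z.induce Sᶜ).Reachable x ⟨z, hz⟩}, _,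
    separates_compl ⟨x, x.2, .rfl⟩ ⟨y, ?_⟩ (fun z hz ⟨hz', _⟩ => hz' hz) ?_⟩
  · rintro (⟨_, hy⟩ | hy)
    exacts [hxy hy, y.2 hy]
  · rintro a ⟨ha, hxa⟩ b hab hb
    exact ⟨hb, hxa.trans (Adj.reachable (show (Z.induce Sᶜ).Adj ⟨a, ha⟩ ⟨b, hb⟩ from hab))⟩

namespace Separates

theorem symm (h : Separates Z S C D) : Separates Z S D C where
  cover x := (h.cover x).imp_right Or.symm
  notMem_left := h.notMem_right
  notMem_right := h.notMem_left
  disj hx hx' := h.disj hx' hx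
  not_adj hx hy hxy := h.not_adj hy hx hxy.symm
  left_nonempty := h.right_nonempty
  right_nonempty := h.left_nonempty

theorem mem_of_adj (h : Separates Z S C D) (hx : x ∈ C) (hxy : Z.Adj x y) (hy : y ∉ S) :
    y ∈ C := by
  rcases h.cover y with hyS | hyC | hyD
  · exact absurd hyS hy
  · exact hyC
  · exact absurd hxy (h.not_adj hx hyD)

theorem mem_of_isPath (h : Separates Z S C D) {p : Z.Walk x y} (hp : p.IsPath) (hx : x ∈ C)
    (hS : ∀ z ∈ p.support, z ∈ S → z = y) : ∀ z ∈ p.support, z ≠ y → z ∈ C := by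
  induction p with
  | nil => exact fun z hz hne => absurd (Walk.mem_support_nil_iff.1 hz) hne
  | @cons a b c hab p ih =>
    intro z hz hzc
    rw [Walk.support_cons, List.mem_cons] at hz
    rcases hz with rfl | hz
    · exact hx
    by_cases hbc : b = c
    · subst hbc
      rw [Walk.isPath_iff_nil.1 hp.of_cons |> Walk.nil_iff_support_eq.1, List.mem_singleton] at hz
      exact absurd hz hzc
    · refine ih hp.of_cons (h.mem_of_adj hx hab fun hb => hbc (hS b (by simp) hb)) ?_ z hz hzc
      exact fun z hz => hS z (List.mem_cons_of_mem _ hz)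

theorem exists_mem_support (h : Separates Z S C D) (p : Z.Walk x y) (hx : x ∈ C) (hy : y ∈ D) :
    ∃ z ∈ p.support, z ∈ S := by
  by_contra! hno
  induction p with
  | nil => exact h.disj hx hy
  | @cons a b c hab p ih =>
    exact ih (h.mem_of_adj hx hab (hno b (by simp))) hy
      fun z hz => hno z (List.mem_cons_of_mem _ hz)

theorem exists_walk (hconn : ∀ c C D, ¬ Separates Z {c} C D) (huv : u ≠ v)
    (h : Separates Z {u, v} C D) : ∃ p : Z.Walk u v, ∀ x ∈ p.support, x ∈ C ∨ x = u ∨ x = v := by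
  by_contra! hno
  let K : Set W := {x | x ∈ C ∧ ∃ p : Z.Walk u x, ∀ y ∈ p.support, y ∈ C ∨ y = u}
  have huC : u ∉ C := h.notMem_left (Set.mem_insert u {v})
  have hvC : v ∉ C := h.notMem_left (Set.mem_insert_of_mem u rfl)
  have hvK : ∀ x ∈ K, ¬ Z.Adj x v := by
    rintro x ⟨-, p, hp⟩ hxv
    obtain ⟨y, hy, hyC, hyu, hyv⟩ := hno (p.concat hxv)
    rw [Walk.support_concat, List.mem_append, List.mem_singleton] at hy
    rcases hy with hy | hy
    exacts [(hp y hy).elim hyC hyu, hyv hy]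
  rcases K.eq_empty_or_nonempty with hK | hK
  · have huK : ∀ x ∈ C, ¬ Z.Adj x u := fun x hx hxu =>
      Set.notMem_empty x (hK ▸ ⟨hx, hxu.symm.toWalk, by simp [hx]⟩)
    refine hconn v C _ (separates_compl h.left_nonempty ⟨u, ?_⟩ ?_ ?_)
    · rintro (hu | hu)
      exacts [huC hu, huv hu]
    · rintro x rfl
      exact hvC
    · intro x hx y hxy hyv
      refine h.mem_of_adj hx hxy ?_
      rintro (rfl | hy)
      exacts [huK x hx hxy, hyv hy]
  · refine hconn u K _ (separates_compl hK ⟨v, ?_⟩ ?_ ?_)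
    · rintro (hv | hv)
      exacts [hvC hv.1, huv hv.symm]
    · rintro x rfl hx
      exact huC hx.1
    · rintro x ⟨hxC, p, hp⟩ y hxy hyu
      have hyC : y ∈ C := by
        refine h.mem_of_adj hxC hxy ?_
        rintro (hy | rfl)
        exacts [hyu hy, hvK x ⟨hxC, p, hp⟩ hxy]
      refine ⟨hyC, p.concat hxy, fun z hz => ?_⟩
      rw [Walk.support_concat, List.mem_append, List.mem_singleton] at hz
      rcases hz with hz | rfl
      exacts [hp z hz, Or.inl hyC]

theorem corner {Cu Cv : Set W} (h : Separates Z {u, v} C D) (h' : Separates Z {w, z} Cu Cv)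
    (hw : w ∈ C) (hz : z ∈ D) (hu : u ∈ Cu) (hv : v ∈ Cv) (hne : (C ∩ Cu).Nonempty) :
    Separates Z {u, w} (C ∩ Cu) (C ∩ Cu ∪ {u, w})ᶜ := by
  refine separates_compl hne ⟨v, ?_⟩ ?_ ?_
  · rintro (hv' | rfl | rfl)
    · exact h'.disj hv'.2 hv
    · exact h'.disj hu hv
    · exact h.notMem_left (Set.mem_insert_of_mem u rfl) hw
  · rintro x (rfl | rfl) hx
    · exact h.notMem_left (Set.mem_insert x {v}) hx.1
    · exact h'.notMem_left (Set.mem_insert x {z}) hx.2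
  · intro x hx y hxy hy
    rw [Set.mem_insert_iff, Set.mem_singleton_iff, not_or] at hy
    have hyC : y ∈ C := by
      refine h.mem_of_adj hx.1 hxy ?_
      rintro (hyu | rfl)
      exacts [hy.1 hyu, h'.not_adj hx.2 hv hxy]
    refine ⟨hyC, h'.mem_of_adj hx.2 hxy ?_⟩
    rintro (hyw | rfl)
    exacts [hy.2 hyw, h.disj hyC hz]

end Separates

/-- The walk `p` is an induced path whose inner vertices are the elements of `C`. -/
structure IsArc (p : Z.Walk u v) (C : Set W) : Prop where
  isPath : p.IsPath
  mem_support : ∀ x, x ∈ p.support ↔ x ∈ C ∨ x = u ∨ x = v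
  mk_mem_edges : ∀ x ∈ p.support, ∀ y ∈ p.support, Z.Adj x y → s(x, y) ∈ p.edges

namespace IsArc

theorem mem_of_ne {p : Z.Walk u v} {C' : Set W} (h : IsArc p C) (hC : C ⊆ C') (hu : u ∈ C')
    (hx : x ∈ p.support) (hxv : x ≠ v) : x ∈ C' := by
  rcases (h.mem_support x).1 hx with hx | rfl | hx
  exacts [hC hx, hu, absurd hx hxv]

theorem append_reverse {p : Z.Walk u w} {q : Z.Walk v w} {C' Cu Cv : Set W} (hp : IsArc p C)
    (hq : IsArc q C') (h : Separates Z S Cu Cv) (hC : C ⊆ Cu) (hu : u ∈ Cu) (hC' : C' ⊆ Cv)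
    (hv : v ∈ Cv) : IsArc (p.append q.reverse) (C ∪ C' ∪ {w}) := by
  have hpw : ∀ x ∈ p.support, x ≠ w → x ∈ Cu := fun x hx => hp.mem_of_ne hC hu hx
  have hqw : ∀ x ∈ q.support, x ≠ w → x ∈ Cv := fun x hx => hq.mem_of_ne hC' hv hx
  have cross : ∀ x ∈ p.support, ∀ y ∈ q.support, Z.Adj x y →
      s(x, y) ∈ p.edges ∨ s(x, y) ∈ q.edges := by
    intro x hx y hy hxy
    by_cases hxw : x = w
    · exact Or.inr (hq.mk_mem_edges _ (hxw ▸ q.end_mem_support) y hy hxy)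
    by_cases hyw : y = w
    · exact Or.inl (hp.mk_mem_edges x hx _ (hyw ▸ p.end_mem_support) hxy)
    exact absurd hxy (h.not_adj (hpw x hx hxw) (hqw y hy hyw))
  refine ⟨isPath_append hp.isPath hq.isPath.reverse fun x hx hx' => ?_, fun x => ?_, ?_⟩
  · rw [Walk.support_reverse, List.mem_reverse] at hx'
    by_contra hxw
    exact h.disj (hpw x hx hxw) (hqw x hx' hxw)
  · rw [Walk.mem_support_append_iff, Walk.support_reverse, List.mem_reverse, hp.mem_support,
      hq.mem_support, Set.mem_union, Set.mem_union, Set.mem_singleton_iff]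
    tauto
  · intro x hx y hy hxy
    rw [Walk.mem_support_append_iff, Walk.support_reverse, List.mem_reverse] at hx hy
    rw [Walk.edges_append, List.mem_append, Walk.edges_reverse, List.mem_reverse]
    rcases hx with hx | hx <;> rcases hy with hy | hy
    · exact Or.inl (hp.mk_mem_edges x hx y hy hxy)
    · exact cross x hx y hy hxy
    · rw [Sym2.eq_swap]
      exact cross y hy x hx hxy.symm
    · exact Or.inr (hq.mk_mem_edges x hx y hy hxy)

theorem mk_mem_edges_or {p q : Z.Walk u v} (hp : IsArc p C) (hq : IsArc q D)
    (h : Separates Z {u, v} C D) (hx : x ∈ p.support) (hxy : Z.Adj x y) :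
    s(x, y) ∈ p.edges ∨ s(x, y) ∈ q.edges := by
  by_cases hy : y ∈ p.support
  · exact Or.inl (hp.mk_mem_edges x hx y hy hxy)
  rw [hp.mem_support, not_or, ← Set.mem_singleton_iff (b := v), ← Set.mem_insert_iff] at hy
  have hyD : y ∈ D := ((h.cover y).resolve_left hy.2).resolve_left hy.1
  refine Or.inr (hq.mk_mem_edges x ((hq.mem_support x).2 (Or.inr ?_)) y
    ((hq.mem_support y).2 (Or.inl hyD)) hxy)
  exact ((hp.mem_support x).1 hx).resolve_left fun hxC => h.not_adj hxC hyD hxy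

theorem one_lt_length {p : Z.Walk u v} (hp : IsArc p C) (huv : u ≠ v) (hC : C.Nonempty)
    (huC : u ∉ C) (hvC : v ∉ C) : 1 < p.length := by
  obtain ⟨c, hc⟩ := hC
  have hcp := (hp.mem_support c).2 (Or.inl hc)
  match p, hcp with
  | .nil, _ => exact absurd rfl huv
  | .cons _ .nil, hcp =>
    rw [Walk.support_cons, Walk.support_nil, List.mem_pair] at hcp
    rcases hcp with rfl | rfl
    exacts [absurd hc huC, absurd hc hvC]
  | .cons _ (.cons _ _), _ => simp only [Walk.length_cons, lt_add_iff_pos_left, Nat.succ_pos']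

theorem isCycleGraph {p q : Z.Walk u v} (hp : IsArc p C) (hq : IsArc q D) (huv : u ≠ v)
    (h : Separates Z {u, v} C D) : IsCycleGraph Z := by
  have huS : u ∈ ({u, v} : Set W) := Set.mem_insert u {v}
  have hvS : v ∈ ({u, v} : Set W) := Set.mem_insert_of_mem u rfl
  have hlen : 1 < p.length :=
    hp.one_lt_length huv h.left_nonempty (h.notMem_left huS) (h.notMem_left hvS)
  have hcycle : (p.append q.reverse).IsCycle := by
    refine hp.isPath.isCycle_append hq.isPath.reverse (fun x hxp hxq => ?_) (Or.inl hlen)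
    have hpn := hp.isPath.support_nodup
    have hqn := hq.isPath.reverse.support_nodup
    rw [← Walk.cons_tail_support, List.nodup_cons] at hpn hqn
    have hxu : x ≠ u := fun he => hpn.1 (he ▸ hxp)
    have hxv : x ≠ v := fun he => hqn.1 (he ▸ hxq)
    have hxq := List.mem_of_mem_tail hxq
    rw [Walk.support_reverse, List.mem_reverse, hq.mem_support] at hxq
    exact h.disj (((hp.mem_support x).1 (List.mem_of_mem_tail hxp)).resolve_right (by tauto))
      (hxq.resolve_right (by tauto))
  have hverts : ∀ x, x ∈ p.support ∨ x ∈ q.support := by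
    intro x
    rw [hp.mem_support, hq.mem_support]
    rcases h.cover x with (hx | hx) | hx | hx <;> tauto
  refine isCycleGraph_of_isCycle hcycle (fun x => ?_) fun x y hxy => ?_
  · rw [Walk.mem_support_append_iff, Walk.support_reverse, List.mem_reverse]
    exact hverts x
  · rw [Walk.edges_append, List.mem_append, Walk.edges_reverse, List.mem_reverse]
    rcases hverts x with hx | hx
    · exact hp.mk_mem_edges_or hq h hx hxy
    · exact (hq.mk_mem_edges_or hp h.symm hx hxy).symm

end IsArc

/-- Every separation of order two is crossed by another one: the separator of the latter has one
vertex on either side of the former, and conversely. -/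
def IsTotallyCrossed (Z : SimpleGraph W) : Prop :=
  ∀ u v C D, u ≠ v → Separates Z {u, v} C D → ∃ w ∈ C, ∃ z ∈ D, ∃ Cu Cv,
    Separates Z {w, z} Cu Cv ∧ u ∈ Cu ∧ v ∈ Cv

theorem exists_isArc_empty {p : Z.Walk u v} (huv : u ≠ v)
    (hpC : ∀ x ∈ p.support, x = u ∨ x = v) : ∃ q : Z.Walk u v, IsArc q ∅ := by
  have hadj : Z.Adj u v := by
    cases p with
    | nil => exact absurd rfl huv
    | @cons _ b _ hab p =>
      rcases hpC b (by simp) with rfl | rfl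
      exacts [absurd rfl hab.ne, hab]
  have hsupp : hadj.toWalk.support = [u, v] := rfl
  have hedges : hadj.toWalk.edges = [s(u, v)] := rfl
  refine ⟨hadj.toWalk, by simp [huv], fun x => by simp, fun x hx y hy hxy => ?_⟩
  rw [hsupp, List.mem_pair] at hx hy
  rw [hedges, List.mem_singleton, Sym2.eq_iff]
  rcases hx with rfl | rfl <;> rcases hy with rfl | rfl
  exacts [absurd rfl hxy.ne, Or.inl ⟨rfl, rfl⟩, Or.inr ⟨rfl, rfl⟩, absurd rfl hxy.ne]

theorem Separates.exists_shorter_path {r : Z.Walk u v} {Cu Cv : Set W}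
    (h : Separates Z {u, v} C D) (h' : Separates Z {w, z} Cu Cv) (hw : w ∈ C) (hz : z ∈ D)
    (hu : u ∈ Cu) (hv : v ∈ Cv) (hr : r.IsPath) (hrC : ∀ x ∈ r.support, x ∈ C ∨ x = u ∨ x = v) :
    ∃ q : Z.Walk u w, q.IsPath ∧ q.length < r.length ∧
      ∀ x ∈ q.support, x ∈ C ∩ Cu ∨ x = u ∨ x = w := by
  classical
  have huS : u ∈ ({u, v} : Set W) := Set.mem_insert u {v}
  have hvS : v ∈ ({u, v} : Set W) := Set.mem_insert_of_mem u rfl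
  have hzr : z ∉ r.support := by
    intro hzr
    rcases hrC z hzr with hzC | rfl | rfl
    exacts [h.disj hzC hz, h.notMem_right huS hz, h.notMem_right hvS hz]
  have hwr : w ∈ r.support := by
    obtain ⟨x, hx, rfl | rfl⟩ := h'.exists_mem_support r hu hv
    exacts [hx, absurd hx hzr]
  have hsub : ∀ x ∈ (r.takeUntil w hwr).support, x ∈ r.support :=
    fun x hx => r.support_takeUntil_subset_support hwr hx
  have hside : ∀ x ∈ (r.takeUntil w hwr).support, x ≠ w → x ∈ Cu := by
    refine h'.mem_of_isPath (hr.takeUntil hwr) hu ?_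
    rintro x hx (rfl | rfl)
    exacts [rfl, absurd (hsub _ hx) hzr]
  have hwv : w ≠ v := fun he => h.notMem_left hvS (he ▸ hw)
  refine ⟨_, hr.takeUntil hwr, Walk.length_takeUntil_lt_length hwr hwv, fun x hx => ?_⟩
  by_cases hxw : x = w
  · exact Or.inr (Or.inr hxw)
  have hxu := hside x hx hxw
  rcases hrC x (hsub x hx) with hxC | rfl | rfl
  exacts [Or.inl ⟨hxC, hxu⟩, Or.inr (Or.inl rfl), absurd hv (h'.disj hxu)]

theorem IsTotallyCrossed.exists_isArc (hZ : IsTotallyCrossed Z) {p : Z.Walk u v} (hp : p.IsPath)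
    (hpC : ∀ x ∈ p.support, x ∈ C ∨ x = u ∨ x = v) (huv : u ≠ v)
    (hC : C = ∅ ∨ ∃ D, Separates Z {u, v} C D) : ∃ q : Z.Walk u v, IsArc q C := by
  induction hn : p.length using Nat.strong_induction_on generalizing u v C with
  | _ n ih =>
    rcases hC with rfl | ⟨D, hD⟩
    · exact exists_isArc_empty huv fun x hx => (hpC x hx).resolve_left (Set.notMem_empty x)
    obtain ⟨w, hw, z, hz, Cu, Cv, hS, hu, hv⟩ := hZ u v C D huv hD
    have half : ∀ {a b : W} {Ca Cb : Set W} {r : Z.Walk a b}, r.IsPath → r.length = n →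
        (∀ x ∈ r.support, x ∈ C ∨ x = a ∨ x = b) → Separates Z {a, b} C D →
        Separates Z {w, z} Ca Cb → a ∈ Ca → b ∈ Cb → ∃ q : Z.Walk a w, IsArc q (C ∩ Ca) := by
      intro a b Ca Cb r hr hrn hrC hD hS ha hb
      obtain ⟨q, hq, hqr, hqC⟩ := hD.exists_shorter_path hS hw hz ha hb hr hrC
      have haw : a ≠ w := fun he => hD.notMem_left (Set.mem_insert a {b}) (he ▸ hw)
      exact ih _ (hrn ▸ hqr) hq hqC haw ((C ∩ Ca).eq_empty_or_nonempty.imp_right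
        fun hne => ⟨_, hD.corner hS hw hz ha hb hne⟩) rfl
    obtain ⟨q, hq⟩ := half hp hn hpC hD hS hu hv
    obtain ⟨r, hr⟩ := half hp.reverse (p.length_reverse.trans hn)
      (fun x hx => by
        rw [Walk.support_reverse, List.mem_reverse] at hx
        exact (hpC x hx).imp_right Or.symm)
      (Set.pair_comm u v ▸ hD) hS.symm hv hu
    have hunion : C ∩ Cu ∪ C ∩ Cv ∪ {w} = C := by
      ext x
      refine ⟨?_, fun hx => ?_⟩
      · rintro ((hx | hx) | rfl)
        exacts [hx.1, hx.1, hw]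
      · rcases hS.cover x with (rfl | rfl) | hxu | hxv
        exacts [Or.inr rfl, absurd hz (hD.disj hx), Or.inl (Or.inl ⟨hx, hxu⟩),
          Or.inl (Or.inr ⟨hx, hxv⟩)]
    exact ⟨_, hunion ▸ hq.append_reverse hr hS Set.inter_subset_right hu Set.inter_subset_right hv⟩

theorem IsTotallyCrossed.isCycleGraph (hZ : IsTotallyCrossed Z)
    (hconn : ∀ c C D, ¬ Separates Z {c} C D) (huv : u ≠ v) (h : Separates Z {u, v} C D) :
    IsCycleGraph Z := by
  classical
  have exists_arc : ∀ {C D : Set W}, Separates Z {u, v} C D → ∃ q : Z.Walk u v, IsArc q C := by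
    intro C D h
    obtain ⟨p, hp⟩ := h.exists_walk hconn huv
    exact hZ.exists_isArc p.bypass_isPath (fun x hx => hp x (p.support_bypass_subset_support hx))
      huv (Or.inr ⟨D, h⟩)
  obtain ⟨q, hq⟩ := exists_arc h
  obtain ⟨r, hr⟩ := exists_arc h.symm
  exact hq.isCycleGraph hr huv h

end CycleGraphs

end TutteTree

/-! ### Planarity of subdivided graphs -/

namespace TutteTree

section Planarity
open SimpleGraph

theorem injective_path_trans {Y : Type*} [TopologicalSpace Y] {x y z : Y} {γ : Path x y}
    {δ : Path y z} (hγ : Function.Injective γ) (hδ : Function.Injective δ)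
    (h : Set.range γ ∩ Set.range δ ⊆ {y}) : Function.Injective (γ.trans δ) := by
  have halves_ne : ∀ s t : unitInterval, (s : ℝ) ≤ 1 / 2 → ¬ (t : ℝ) ≤ 1 / 2 →
      γ.trans δ s ≠ γ.trans δ t := by
    intro s t hs ht hst
    rw [Path.trans_apply, Path.trans_apply, dif_pos hs, dif_neg ht] at hst
    have hy := h ⟨⟨_, rfl⟩, ⟨_, hst.symm⟩⟩
    rw [Set.mem_singleton_iff, hst] at hy
    have ht' := congrArg Subtype.val (hδ (hy.trans δ.source.symm))
    simp only [Set.Icc.coe_zero] at ht'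
    linarith
  intro s t hst
  by_cases hs : (s : ℝ) ≤ 1 / 2 <;> by_cases ht : (t : ℝ) ≤ 1 / 2
  · rw [Path.trans_apply, Path.trans_apply, dif_pos hs, dif_pos ht] at hst
    have hst := congrArg Subtype.val (hγ hst)
    exact Subtype.ext (by simp only at hst; linarith)
  · exact absurd hst (halves_ne s t hs ht)
  · exact absurd hst.symm (halves_ne t s ht hs)
  · rw [Path.trans_apply, Path.trans_apply, dif_neg hs, dif_neg ht] at hst
    have hst := congrArg Subtype.val (hδ hst)
    exact Subtype.ext (by simp only at hst; linarith)

/-- A drawing of the graph `X` in the plane: the data whose existence `IsPlanar X` asserts. -/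
structure IsDrawing {V : Type*} (X : SimpleGraph V) (pt : V → EuclideanSpace ℝ (Fin 2))
    (arc : Sym2 V → Set (EuclideanSpace ℝ (Fin 2))) : Prop where
  injective : Function.Injective pt
  exists_path : ∀ a b, X.Adj a b → ∃ γ : Path (pt a) (pt b),
    Function.Injective γ ∧ Set.range γ = arc s(a, b)
  mem_of_mem_arc : ∀ e ∈ X.edgeSet, ∀ w, pt w ∈ arc e → w ∈ e
  arc_inter_subset : ∀ e ∈ X.edgeSet, ∀ e' ∈ X.edgeSet, e ≠ e' → arc e ∩ arc e' ⊆ Set.range pt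

theorem mem_support_of_mem_of_mem_edges {V : Type*} {X : SimpleGraph V} {x y w : V}
    {p : X.Walk x y} {e : Sym2 V} (he : e ∈ p.edges) (hw : w ∈ e) : w ∈ p.support := by
  obtain ⟨w', rfl⟩ := Sym2.mem_iff_exists.1 hw
  exact p.fst_mem_support_of_mem_edges he

namespace IsDrawing

variable {V : Type*} {X : SimpleGraph V} {pt : V → EuclideanSpace ℝ (Fin 2)}
  {arc : Sym2 V → Set (EuclideanSpace ℝ (Fin 2))}

theorem arc_inter_iUnion_subset (hX : IsDrawing X pt arc) {a b c : V} (hab : X.Adj a b)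
    {q : X.Walk b c} (ha : a ∉ q.support) : arc s(a, b) ∩ ⋃ e ∈ q.edges, arc e ⊆ {pt b} := by
  rintro z ⟨hz, hz'⟩
  obtain ⟨e, he, hz'⟩ := Set.mem_iUnion₂.1 hz'
  have heX := q.edges_subset_edgeSet he
  have hne : s(a, b) ≠ e := by
    rintro rfl
    exact ha (q.fst_mem_support_of_mem_edges he)
  obtain ⟨w, rfl⟩ := hX.arc_inter_subset _ hab e heX hne ⟨hz, hz'⟩
  have hwq := mem_support_of_mem_of_mem_edges he (hX.mem_of_mem_arc e heX w hz')
  rcases Sym2.mem_iff.1 (hX.mem_of_mem_arc _ hab w hz) with rfl | rfl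
  exacts [absurd hwq ha, rfl]

theorem exists_path_of_isPath (hX : IsDrawing X pt arc) {x y : V} {p : X.Walk x y}
    (hp : p.IsPath) (hxy : x ≠ y) :
    ∃ γ : Path (pt x) (pt y), Function.Injective γ ∧ Set.range γ = ⋃ e ∈ p.edges, arc e := by
  induction p with
  | nil => exact absurd rfl hxy
  | @cons a b c hab q ih =>
    obtain ⟨γ, hγ, hγ_range⟩ := hX.exists_path a b hab
    by_cases hbc : b = c
    · subst hbc
      obtain rfl := Walk.isPath_iff_nil.1 hp.of_cons |>.eq_nil
      exact ⟨γ, hγ, by simp [hγ_range]⟩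
    · obtain ⟨δ, hδ, hδ_range⟩ := ih hp.of_cons hbc
      refine ⟨γ.trans δ, injective_path_trans hγ hδ ?_, ?_⟩
      · rw [hγ_range, hδ_range]
        exact hX.arc_inter_iUnion_subset hab ((Walk.cons_isPath_iff _ _).1 hp).2
      · rw [Path.trans_range, hγ_range, hδ_range, Walk.edges_cons]
        simp only [List.mem_cons, Set.iUnion_iUnion_eq_or_left]

end IsDrawing

/-- The branch vertices `f` and the paths `p` of a subdivision of `Z` in `X`: the data whose
existence `HasSubdivisionIn Z X` asserts. -/
structure IsSubdivision {W V : Type*} {Z : SimpleGraph W} {X : SimpleGraph V} (f : W → V)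
    (p : ∀ a b, Z.Adj a b → X.Walk (f a) (f b)) : Prop where
  injective : Function.Injective f
  isPath : ∀ a b h, (p a b h).IsPath
  symm : ∀ a b (h : Z.Adj a b), p b a h.symm = (p a b h).reverse
  eq_or_eq : ∀ a b h c, f c ∈ (p a b h).support → c = a ∨ c = b
  mem_range : ∀ a b h c d h', s(a, b) ≠ s(c, d) →
    ∀ x, x ∈ (p a b h).support → x ∈ (p c d h').support → x ∈ Set.range f

namespace IsSubdivision

variable {W V : Type*} {Z : SimpleGraph W} {X : SimpleGraph V} {f : W → V}
  {p : ∀ a b, Z.Adj a b → X.Walk (f a) (f b)} {a b c d : W}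

theorem edge_ne (hf : IsSubdivision f p) (hab : Z.Adj a b) (hcd : Z.Adj c d)
    (hne : s(a, b) ≠ s(c, d)) {e e' : Sym2 V} (he : e ∈ (p a b hab).edges)
    (he' : e' ∈ (p c d hcd).edges) : e ≠ e' := by
  rintro rfl
  have heX := (p a b hab).edges_subset_edgeSet he
  have ends_mem : ∀ x ∈ e, ∃ i, f i = x ∧ (i = a ∨ i = b) ∧ (i = c ∨ i = d) := by
    intro x hx
    have hx₁ := mem_support_of_mem_of_mem_edges he hx
    have hx₂ := mem_support_of_mem_of_mem_edges he' hx
    obtain ⟨i, rfl⟩ := hf.mem_range a b hab c d hcd hne x hx₁ hx₂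
    exact ⟨i, rfl, hf.eq_or_eq a b hab i hx₁, hf.eq_or_eq c d hcd i hx₂⟩
  induction e with
  | h x y =>
    obtain ⟨i, rfl, hi, hi'⟩ := ends_mem x (Sym2.mem_mk_left x y)
    obtain ⟨j, rfl, hj, hj'⟩ := ends_mem y (Sym2.mem_mk_right _ y)
    have hij : i ≠ j := fun h => X.ne_of_adj heX (congrArg f h)
    have hab : s(a, b) = s(i, j) := (Sym2.mem_and_mem_iff hij).1
      ⟨Sym2.mem_iff.2 hi, Sym2.mem_iff.2 hj⟩
    have hcd : s(c, d) = s(i, j) := (Sym2.mem_and_mem_iff hij).1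
      ⟨Sym2.mem_iff.2 hi', Sym2.mem_iff.2 hj'⟩
    exact hne (hab.trans hcd.symm)

/-- The arcs of the drawing of `Z` obtained from a drawing of `X` by following the paths `p`. -/
def arc (p : ∀ a b, Z.Adj a b → X.Walk (f a) (f b))
    (arcX : Sym2 V → Set (EuclideanSpace ℝ (Fin 2))) (e : Sym2 W) :
    Set (EuclideanSpace ℝ (Fin 2)) :=
  {z | ∃ a b, ∃ h : Z.Adj a b, e = s(a, b) ∧ ∃ e' ∈ (p a b h).edges, z ∈ arcX e'}

variable {pt : V → EuclideanSpace ℝ (Fin 2)} {arcX : Sym2 V → Set (EuclideanSpace ℝ (Fin 2))}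

theorem arc_mk (hf : IsSubdivision f p) (h : Z.Adj a b) :
    arc p arcX s(a, b) = ⋃ e ∈ (p a b h).edges, arcX e := by
  ext z
  rw [Set.mem_iUnion₂]
  constructor
  · rintro ⟨c, d, h', he, e', he', hz⟩
    rcases Sym2.eq_iff.1 he with ⟨rfl, rfl⟩ | ⟨rfl, rfl⟩
    · exact ⟨e', he', hz⟩
    · rw [hf.symm _ _ h, Walk.edges_reverse, List.mem_reverse] at he'
      exact ⟨e', he', hz⟩
  · rintro ⟨e', he', hz⟩
    exact ⟨a, b, h, rfl, e', he', hz⟩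

theorem isDrawing (hf : IsSubdivision f p) (hX : IsDrawing X pt arcX) :
    IsDrawing Z (pt ∘ f) (arc p arcX) where
  injective := hX.injective.comp hf.injective
  exists_path a b h :=
    hf.arc_mk h ▸ hX.exists_path_of_isPath (hf.isPath a b h) (hf.injective.ne h.ne)
  mem_of_mem_arc e he w hw := by
    obtain ⟨a, b, h, rfl, e', he', hw⟩ := hw
    have hwe' := hX.mem_of_mem_arc e' ((p a b h).edges_subset_edgeSet he') _ hw
    exact Sym2.mem_iff.2 (hf.eq_or_eq a b h w (mem_support_of_mem_of_mem_edges he' hwe'))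
  arc_inter_subset e _ e' _ hne z hz := by
    obtain ⟨⟨a, b, h, rfl, d, hd, hz⟩, ⟨a', b', h', rfl, d', hd', hz'⟩⟩ := hz
    have hdX := (p a b h).edges_subset_edgeSet hd
    have hdX' := (p a' b' h').edges_subset_edgeSet hd'
    obtain ⟨w, rfl⟩ := hX.arc_inter_subset d hdX d' hdX' (hf.edge_ne h h' hne hd hd') ⟨hz, hz'⟩
    obtain ⟨i, rfl⟩ := hf.mem_range a b h a' b' h' hne w
      (mem_support_of_mem_of_mem_edges hd (hX.mem_of_mem_arc d hdX w hz))
      (mem_support_of_mem_of_mem_edges hd' (hX.mem_of_mem_arc d' hdX' w hz'))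
    exact ⟨i, rfl⟩

end IsSubdivision

theorem isPlanar_of_hasSubdivisionIn {W V : Type*} {Z : SimpleGraph W} {X : SimpleGraph V}
    (h : HasSubdivisionIn Z X) (hX : IsPlanar X) : IsPlanar Z := by
  obtain ⟨f, p, hinj, hpath, hsymm, heq, hrange⟩ := h
  obtain ⟨pt, arc, hpt, hexists, hmem, hinter⟩ := hX
  obtain ⟨hpt', hexists', hmem', hinter'⟩ :=
    IsSubdivision.isDrawing ⟨hinj, hpath, hsymm, heq, hrange⟩ ⟨hpt, hexists, hmem, hinter⟩
  exact ⟨_, _, hpt', hexists', hmem', hinter'⟩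

end Planarity

end TutteTree

/-! ### Blocks -/

namespace TutteTree

section Blocks
open SimpleGraph

/-- `F` and `F'` do not cross, as subsets of `Y`. -/
def Nested {α : Type*} (Y F F' : Set α) : Prop :=
  F ⊆ F' ∨ F ⊆ Y \ F' ∨ Y \ F ⊆ F' ∨ Y \ F ⊆ Y \ F'

namespace Nested

variable {α : Type*} {Y F F' : Set α}

theorem symm (hF' : F' ⊆ Y) (h : Nested Y F F') : Nested Y F' F := by
  rcases h with h | h | h | h
  · exact Or.inr (Or.inr (Or.inr (Set.sdiff_subset_sdiff_right h)))
  · exact Or.inr (Or.inl fun x hx => ⟨hF' hx, fun hx' => (h hx').2 hx⟩)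
  · exact Or.inr (Or.inr (Or.inl fun x hx => by_contra fun hx' => hx.2 (h ⟨hx.1, hx'⟩)))
  · exact Or.inl fun x hx => by_contra fun hx' => (h ⟨hF' hx, hx'⟩).2 hx

theorem compl_left_iff (hF : F ⊆ Y) : Nested Y (Y \ F) F' ↔ Nested Y F F' := by
  rw [Nested, Nested, Set.sdiff_sdiff_cancel_left hF]
  tauto

theorem compl_right_iff (hF' : F' ⊆ Y) : Nested Y F (Y \ F') ↔ Nested Y F F' := by
  rw [Nested, Nested, Set.sdiff_sdiff_cancel_left hF']
  tauto

theorem of_subset_or (h : F ⊆ F' ∨ F' ⊆ F) : Nested Y F F' :=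
  h.imp_right fun h => Or.inr (Or.inr (Set.sdiff_subset_sdiff_right h))

end Nested

variable {V : Type*} {X : SimpleGraph V}

theorem reachable_of_mem_edge {G : SimpleGraph V} {e : Sym2 V} {x y : V} (he : e ∈ G.edgeSet)
    (hx : x ∈ e) (hy : y ∈ e) : G.Reachable x y := by
  by_cases hxy : x = y
  · exact hxy ▸ .rfl
  · obtain rfl : e = s(x, y) := (Sym2.mem_and_mem_iff hxy).1 ⟨hx, hy⟩
    exact Adj.reachable he

/-- `F` is a set of edges of `Y` with a single boundary vertex. -/
def HasPointBoundary (Y F : Set (Sym2 V)) : Prop :=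
  F ⊆ Y ∧ ∃ c, boundary Y F = {c}

/-- The blocks: the classes of edges not separated by a single vertex. -/
def IsBlock (X : SimpleGraph V) (Y : Set (Sym2 V)) : Prop :=
  ∃ e ∈ X.edgeSet, Y = {f | f ∈ X.edgeSet ∧ ∀ M, HasPointBoundary X.edgeSet M → (e ∈ M ↔ f ∈ M)}

theorem HasPointBoundary.compl {Y F : Set (Sym2 V)} (h : HasPointBoundary Y F) :
    HasPointBoundary Y (Y \ F) :=
  ⟨Set.sdiff_subset, by rw [boundary_sdiff h.1]; exact h.2⟩

namespace IsBlock

variable {Y Y' M : Set (Sym2 V)} {x y : V}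

theorem subset (hY : IsBlock X Y) : Y ⊆ X.edgeSet := by
  obtain ⟨e, -, rfl⟩ := hY
  exact fun f hf => hf.1

theorem nonempty (hY : IsBlock X Y) : Y.Nonempty := by
  obtain ⟨e, he, rfl⟩ := hY
  exact ⟨e, he, fun _ _ => Iff.rfl⟩

theorem exists_mem {e : Sym2 V} (he : e ∈ X.edgeSet) : ∃ Y, IsBlock X Y ∧ e ∈ Y :=
  ⟨_, ⟨e, he, rfl⟩, he, fun _ _ => Iff.rfl⟩

theorem subset_or (hY : IsBlock X Y) (hM : HasPointBoundary X.edgeSet M) :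
    Y ⊆ M ∨ Y ⊆ X.edgeSet \ M := by
  obtain ⟨e, -, rfl⟩ := hY
  by_cases h : e ∈ M
  · exact Or.inl fun f hf => (hf.2 M hM).1 h
  · exact Or.inr fun f hf => ⟨hf.1, fun h' => h ((hf.2 M hM).2 h')⟩

theorem exists_hasPointBoundary (hY : IsBlock X Y) {f : Sym2 V} (hf : f ∈ X.edgeSet)
    (hfY : f ∉ Y) : ∃ M, HasPointBoundary X.edgeSet M ∧ f ∈ M ∧ Y ⊆ X.edgeSet \ M := by
  suffices h : ∃ M, HasPointBoundary X.edgeSet M ∧ f ∈ M ∧ ¬ Y ⊆ M by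
    obtain ⟨M, hM, hfM, hYM⟩ := h
    exact ⟨M, hM, hfM, (hY.subset_or hM).resolve_left hYM⟩
  obtain ⟨e, he, rfl⟩ := hY
  by_contra! h
  refine hfY ⟨hf, fun M hM => ⟨fun heM => ?_, fun hfM => h M hM hfM ⟨he, fun _ _ => Iff.rfl⟩⟩⟩
  by_contra hfM
  exact (h _ hM.compl ⟨hf, hfM⟩ ⟨he, fun _ _ => Iff.rfl⟩).2 heM

theorem exists_hasPointBoundary_of_ne (hY : IsBlock X Y) (hY' : IsBlock X Y') (h : Y ≠ Y') :
    ∃ M, HasPointBoundary X.edgeSet M ∧ Y ⊆ M ∧ Y' ⊆ X.edgeSet \ M := by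
  obtain ⟨f, hf, hf'⟩ : ∃ f ∈ Y, f ∉ Y' := by
    by_contra! hsub
    refine h (Set.Subset.antisymm hsub fun f hf => ?_)
    by_contra hfY
    obtain ⟨M, hM, hfM, hYM⟩ := hY.exists_hasPointBoundary (hY'.subset hf) hfY
    obtain ⟨e, he⟩ := hY.nonempty
    rcases hY'.subset_or hM with hM | hM
    · exact (hYM he).2 (hM (hsub e he))
    · exact (hM hf).2 hfM
  obtain ⟨M, hM, hfM, hYM⟩ := hY'.exists_hasPointBoundary (hY.subset hf) hf'
  exact ⟨M, hM, (hY.subset_or hM).resolve_right fun hYM => (hYM hf).2 hfM, hYM⟩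

theorem eq_of_mem_ends (hY : IsBlock X Y) (hY' : IsBlock X Y') (hxy : x ≠ y)
    (hx : x ∈ ends Y) (hy : y ∈ ends Y) (hx' : x ∈ ends Y') (hy' : y ∈ ends Y') : Y = Y' := by
  by_contra h
  obtain ⟨M, ⟨-, c, hM⟩, hYM, hYM'⟩ := hY.exists_hasPointBoundary_of_ne hY' h
  have hx : x ∈ boundary X.edgeSet M := ⟨ends_mono hYM hx, ends_mono hYM' hx'⟩
  have hy : y ∈ boundary X.edgeSet M := ⟨ends_mono hYM hy, ends_mono hYM' hy'⟩
  rw [hM] at hx hy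
  exact hxy (hx.trans hy.symm)

theorem eq_of_reachable (hY : IsBlock X Y) (hx : x ∈ ends Y) (hy : y ∈ ends Y)
    (h : (X.deleteEdges Y).Reachable x y) : x = y := by
  obtain ⟨p, hp⟩ := h.exists_isPath
  cases p with
  | nil => rfl
  | @cons _ b _ hxb p =>
    exfalso
    obtain ⟨hxb, hbY⟩ := (deleteEdges_adj ..).1 hxb
    obtain ⟨M, ⟨-, c, hc⟩, heM, hYM⟩ := hY.exists_hasPointBoundary hxb hbY
    have hxM : x ∈ boundary X.edgeSet M := ⟨mem_ends_of_mk_mem heM, ends_mono hYM hx⟩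
    obtain rfl : x = c := by rwa [hc] at hxM
    have hxp : x ∉ p.support := ((Walk.cons_isPath_iff _ _).1 hp).2
    have hyM : y ∈ ends M := by
      refine mem_ends_of_walk (edgeSet_subset_edgeSet.2 (deleteEdges_le Y)) p
        (mem_ends_of_mk_mem (Sym2.eq_swap ▸ heM)) fun z hz _ hz' => hxp ?_
      rw [hc] at hz'
      exact Set.mem_singleton_iff.1 hz' ▸ hz
    have hyx : y ∈ boundary X.edgeSet M := ⟨hyM, ends_mono hYM hy⟩
    rw [hc] at hyx
    exact hxp (Set.mem_singleton_iff.1 hyx ▸ p.end_mem_support)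

theorem exists_reachable (hY : IsBlock X Y) (hX : X.Connected) (x : V) :
    ∃ w ∈ ends Y, (X.deleteEdges Y).Reachable x w := by
  obtain ⟨y, hy⟩ := ends_nonempty hY.nonempty
  obtain ⟨p⟩ := hX.preconnected x y
  induction p with
  | nil => exact ⟨_, hy, .rfl⟩
  | @cons a b c hab _ ih =>
    by_cases ha : a ∈ ends Y
    · exact ⟨a, ha, .rfl⟩
    · obtain ⟨w, hw, hbw⟩ := ih hy
      have hab' : (X.deleteEdges Y).Adj a b :=
        (deleteEdges_adj ..).2 ⟨hab, fun h => ha (mem_ends_of_mk_mem h)⟩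
      exact ⟨w, hw, hab'.reachable.trans hbw⟩

theorem mem_of_adj (hY : IsBlock X Y) (hx : x ∈ ends Y) (hy : y ∈ ends Y) (h : X.Adj x y) :
    s(x, y) ∈ Y := by
  by_contra h'
  have hadj : (X.deleteEdges Y).Adj x y := (deleteEdges_adj ..).2 ⟨h, h'⟩
  exact h.ne (hY.eq_of_reachable hx hy hadj.reachable)

end IsBlock

/-- The set `F` of edges of the block `Y`, extended to `X` by the edges outside `Y` that are
attached to `Y` at a vertex in `W`. -/
def extend (X : SimpleGraph V) (Y F : Set (Sym2 V)) (W : Set V) : Set (Sym2 V) :=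
  {e | e ∈ X.edgeSet ∧ (e ∈ F ∨ (e ∉ Y ∧ ∃ w ∈ W, w ∈ ends Y ∧
    ∃ x ∈ e, (X.deleteEdges Y).Reachable x w))}

variable {Y F F' M N : Set (Sym2 V)} {W W' : Set V} {e : Sym2 V} {c d u v w x : V}

theorem extend_subset : extend X Y F W ⊆ X.edgeSet := fun _ h => h.1

theorem mem_extend_of_mem (hY : IsBlock X Y) (he : e ∈ Y) : e ∈ extend X Y F W ↔ e ∈ F :=
  ⟨fun h => h.2.resolve_right fun h' => h'.1 he, fun h => ⟨hY.subset he, Or.inl h⟩⟩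

theorem mem_extend_of_reachable (hY : IsBlock X Y) (hF : F ⊆ Y) (he : e ∈ X.edgeSet) (heY : e ∉ Y)
    (hx : x ∈ e) (hw : w ∈ ends Y) (hxw : (X.deleteEdges Y).Reachable x w) :
    e ∈ extend X Y F W ↔ w ∈ W := by
  refine ⟨?_, fun h => ⟨he, Or.inr ⟨heY, w, h, hw, x, hx, hxw⟩⟩⟩
  rintro ⟨-, h | ⟨-, w', hw', hw'Y, y, hy, hyw'⟩⟩
  · exact absurd (hF h) heY
  · have hxy : (X.deleteEdges Y).Reachable x y :=
      reachable_of_mem_edge ((edgeSet_deleteEdges Y).symm ▸ ⟨he, heY⟩) hx hy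
    rwa [hY.eq_of_reachable hw hw'Y ((hxw.symm.trans hxy).trans hyw')]

theorem extend_inter (hY : IsBlock X Y) (hF : F ⊆ Y) : extend X Y F W ∩ Y = F := by
  ext e
  exact ⟨fun h => (mem_extend_of_mem hY h.2).1 h.1,
    fun h => ⟨(mem_extend_of_mem hY (hF h)).2 h, hF h⟩⟩

theorem subset_extend (hY : IsBlock X Y) (hF : F ⊆ Y) : F ⊆ extend X Y F W :=
  fun _ h => (mem_extend_of_mem hY (hF h)).2 h

theorem exists_attach (hX : X.Connected) (hY : IsBlock X Y) (e : Sym2 V) :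
    ∃ x ∈ e, ∃ w ∈ ends Y, (X.deleteEdges Y).Reachable x w := by
  induction e with
  | h x y =>
    obtain ⟨w, hw, h⟩ := hY.exists_reachable hX x
    exact ⟨x, Sym2.mem_mk_left x y, w, hw, h⟩

theorem sdiff_extend (hX : X.Connected) (hY : IsBlock X Y) (hF : F ⊆ Y) :
    X.edgeSet \ extend X Y F W = extend X Y (Y \ F) Wᶜ := by
  ext e
  by_cases heX : e ∈ X.edgeSet
  · by_cases he : e ∈ Y
    · rw [mem_extend_of_mem hY he, Set.mem_sdiff, mem_extend_of_mem hY he, Set.mem_sdiff]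
      tauto
    · obtain ⟨x, hx, w, hw, h⟩ := exists_attach hX hY e
      rw [mem_extend_of_reachable hY Set.sdiff_subset heX he hx hw h, Set.mem_sdiff,
        mem_extend_of_reachable hY hF heX he hx hw h, Set.mem_compl_iff]
      tauto
  · exact ⟨fun h => absurd h.1 heX, fun h => absurd h.1 heX⟩

theorem extend_mono (hF : F ⊆ F') (hW : ∀ w ∈ ends Y, w ∈ W → w ∈ W') :
    extend X Y F W ⊆ extend X Y F' W' := by
  rintro e ⟨he, h | ⟨h, w, hw, hwY, h'⟩⟩
  · exact ⟨he, Or.inl (hF h)⟩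
  · exact ⟨he, Or.inr ⟨h, w, hW w hwY hw, hwY, h'⟩⟩

theorem boundary_extend (hX : X.Connected) (hY : IsBlock X Y) (hF : F ⊆ Y)
    (hW : ∀ w ∈ ends Y, w ∉ boundary Y F → (w ∈ W ↔ w ∈ ends F)) :
    boundary X.edgeSet (extend X Y F W) = boundary Y F := by
  ext x
  constructor
  · rintro ⟨⟨e, he, hxe⟩, ⟨e', he', hxe'⟩⟩
    by_contra hxF
    suffices hall : ∃ P : Prop, ∀ d ∈ X.edgeSet, x ∈ d → (d ∈ extend X Y F W ↔ P) by
      obtain ⟨P, hP⟩ := hall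
      exact he'.2 ((hP e' he'.1 hxe').2 ((hP e he.1 hxe).1 he))
    by_cases hxY : x ∈ ends Y
    · refine ⟨x ∈ ends F, fun d hd hxd => ?_⟩
      by_cases hdY : d ∈ Y
      · rw [mem_extend_of_mem hY hdY]
        exact ⟨fun h => ⟨d, h, hxd⟩, fun h => mem_of_notMem_boundary h hxF hdY hxd⟩
      · rw [mem_extend_of_reachable hY hF hd hdY hxd hxY .rfl]
        exact hW x hxY hxF
    · obtain ⟨w, hw, h⟩ := hY.exists_reachable hX x
      exact ⟨w ∈ W, fun d hd hxd =>
        mem_extend_of_reachable hY hF hd (fun hdY => hxY ⟨d, hdY, hxd⟩) hxd hw h⟩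
  · rintro ⟨⟨e, he, hxe⟩, ⟨e', he', hxe'⟩⟩
    exact ⟨⟨e, (mem_extend_of_mem hY (hF he)).2 he, hxe⟩,
      ⟨e', ⟨hY.subset he'.1, fun h => he'.2 ((mem_extend_of_mem hY he'.1).1 h)⟩, hxe'⟩⟩

theorem IsBlock.not_boundary_subset (hX : X.Connected) (hY : IsBlock X Y) (hF : F ⊆ Y)
    (hne : F.Nonempty) (hne' : (Y \ F).Nonempty) (c : V) : ¬ boundary Y F ⊆ {c} := by
  intro hc
  obtain ⟨e, he⟩ := hne
  obtain ⟨f, hf⟩ := hne'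
  have he' : e ∈ extend X Y F (ends F) := subset_extend hY hF he
  have hf' : f ∉ extend X Y F (ends F) := fun h => hf.2 ((mem_extend_of_mem hY hf.1).1 h)
  have hext : HasPointBoundary X.edgeSet (extend X Y F (ends F)) := by
    refine ⟨extend_subset, c, boundary_eq_singleton_of_subset hX ⟨e, he'⟩
      ⟨f, hY.subset hf.1, hf'⟩ ?_⟩
    rwa [boundary_extend hX hY hF fun w _ _ => Iff.rfl]
  rcases hY.subset_or hext with h | h
  · exact hf' (h hf.1)
  · exact (h (hF he)).2 he'

theorem HasPointBoundary.subset_extend_or (hX : X.Connected) (hY : IsBlock X Y) (hF : F ⊆ Y)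
    (hM : HasPointBoundary X.edgeSet M) (hYM : Y ⊆ X.edgeSet \ M) :
    M ⊆ extend X Y F W ∨ M ⊆ X.edgeSet \ extend X Y F W := by
  obtain ⟨c, hc⟩ := hM.2
  obtain ⟨w, hw, hcw⟩ := hY.exists_reachable hX c
  have reachable_c : ∀ x ∈ ends M, (X.deleteEdges Y).Reachable x c := by
    intro x hx
    obtain ⟨y, hy⟩ := ends_nonempty (hY.nonempty.mono hYM)
    obtain ⟨p⟩ := hX.preconnected x y
    induction p with
    | nil =>
      have hxc : _ ∈ boundary X.edgeSet M := ⟨hx, hy⟩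
      rw [hc] at hxc
      exact hxc ▸ .rfl
    | @cons a b d hab _ ih =>
      by_cases hac : a = c
      · exact hac ▸ .rfl
      · have habM : s(a, b) ∈ M :=
          mem_of_notMem_boundary hx (fun ha => hac (hc.subset ha)) hab (Sym2.mem_mk_left a b)
        have hab' : (X.deleteEdges Y).Adj a b :=
          (deleteEdges_adj ..).2 ⟨hab, fun h => (hYM h).2 habM⟩
        exact hab'.reachable.trans (ih ⟨_, habM, Sym2.mem_mk_right a b⟩ hy)
  have mem_extend_iff : ∀ e ∈ M, e ∈ extend X Y F W ↔ w ∈ W := by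
    intro e he
    obtain ⟨x, hx, -⟩ := exists_attach hX hY e
    exact mem_extend_of_reachable hY hF (hM.1 he) (fun h => (hYM h).2 he) hx hw
      ((reachable_c x ⟨e, he, hx⟩).trans hcw)
  by_cases hw : w ∈ W
  · exact Or.inl fun e he => (mem_extend_iff e he).2 hw
  · exact Or.inr fun e he => ⟨hM.1 he, fun h => hw ((mem_extend_iff e he).1 h)⟩

theorem HasPointBoundary.nested_extend (hX : X.Connected) (hY : IsBlock X Y) (hF : F ⊆ Y)
    (hM : HasPointBoundary X.edgeSet M) : Nested X.edgeSet M (extend X Y F W) := by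
  rcases hY.subset_or hM with hYM | hYM
  · exact Or.inr (Or.inr (hM.compl.subset_extend_or hX hY hF
      ((Set.sdiff_sdiff_cancel_left hM.1).symm ▸ hYM)))
  · exact (hM.subset_extend_or hX hY hF hYM).imp_right Or.inl

theorem IsBlock.reachable_of_boundary (hX : X.Connected) (hY : IsBlock X Y) (hF : F ⊆ Y)
    (huv : u ≠ v) (h : boundary Y F = {u, v}) : (fromEdgeSet F).Reachable u v := by
  by_contra hno
  have hu : u ∈ boundary Y F := h ▸ Set.mem_insert u {v}
  obtain ⟨e, he, hue⟩ := hu.1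
  obtain ⟨f, hf, -⟩ := hu.2
  have huK : e ∈ componentEdges F ∅ u := mem_componentEdges (Set.notMem_empty u) he hue
  refine hY.not_boundary_subset hX (componentEdges_subset.trans hF) ⟨e, huK⟩
    ⟨f, hf.1, fun h => hf.2 (componentEdges_subset h)⟩ u ?_
  rintro x ⟨⟨a, ha, hxa⟩, ⟨b, hb, hxb⟩⟩
  obtain ⟨p, hp⟩ := exists_walk_of_mem_componentEdges ha hxa (Set.notMem_empty x)
  have hxF : x ∈ boundary Y F := ⟨⟨a, componentEdges_subset ha, hxa⟩, b,
    ⟨hb.1, fun h => hb.2 ⟨h, x, hxb, p, hp⟩⟩, hxb⟩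
  rw [h] at hxF
  rcases hxF with rfl | rfl
  · exact Set.mem_singleton x
  · exact absurd p.reachable hno

theorem sdiff_componentEdges_subset (hX : X.Connected) (hd : boundary X.edgeSet N = {d})
    (q : X.Walk x d) (hq : c ∉ q.support) (hcN : c ∈ ends N) :
    X.edgeSet \ componentEdges X.edgeSet {c} x ⊆ N := by
  classical
  rintro e ⟨he, heL⟩
  by_contra heN
  have hcd : c ≠ d := fun h => hq (h ▸ q.end_mem_support)
  have hcN' : c ∉ ends (X.edgeSet \ N) := fun h => hcd (hd.subset ⟨hcN, h⟩)
  obtain ⟨y, hy⟩ : ∃ y, y ∈ e := ⟨e.out.1, e.out_fst_mem⟩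
  obtain ⟨p, hp⟩ := hX.exists_isPath y d
  have hcp : c ∉ p.support := fun hc => by
    refine hcN' (mem_ends_of_walk le_rfl (p.takeUntil c hc) ⟨e, ⟨he, heN⟩, hy⟩ fun z hz _ hz' => ?_)
    have hzN : z ∈ boundary X.edgeSet N :=
      ⟨ends_mono (fun a ha => by_contra fun haN => ha.2 ⟨ha.1, haN⟩) hz'.2, hz'.1⟩
    obtain rfl : z = d := hd.subset hzN
    exact Walk.endpoint_notMem_support_takeUntil hp hc hcd.symm hz
  refine heL (mem_componentEdges_edgeSet.2 ⟨he, y, hy, q.append p.reverse, ?_⟩)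
  rintro z hz rfl
  rw [Walk.mem_support_append_iff, Walk.support_reverse, List.mem_reverse] at hz
  exact hz.elim hq hcp

theorem nested_componentEdges [Nontrivial V] (hX : X.Connected)
    (hN : HasPointBoundary X.edgeSet N) : Nested X.edgeSet (componentEdges X.edgeSet {c} x) N := by
  classical
  have mem_ends_or : ∀ z : V, z ∈ ends N ∨ z ∈ ends (X.edgeSet \ N) := by
    intro z
    by_cases hz : z ∈ ends N
    · exact Or.inl hz
    · exact Or.inr (mem_ends_sdiff_of_notMem (ends_edgeSet hX ▸ Set.mem_univ z) hz)
  obtain ⟨d, hd⟩ := hN.2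
  have hd' : boundary X.edgeSet (X.edgeSet \ N) = {d} := by rw [boundary_sdiff hN.1, hd]
  by_cases h : ∃ q : X.Walk x d, c ∉ q.support
  · obtain ⟨q, hq⟩ := h
    rcases mem_ends_or c with hc | hc
    · exact Or.inr (Or.inr (Or.inl (sdiff_componentEdges_subset hX hd q hq hc)))
    · exact Or.inr (Or.inr (Or.inr (sdiff_componentEdges_subset hX hd' q hq hc)))
  · have subset_of_mem : ∀ N, boundary X.edgeSet N = {d} → x ∈ ends N →
        componentEdges X.edgeSet {c} x ⊆ N := by
      rintro N hd hx e he
      obtain ⟨he, y, hy, p, hp⟩ := mem_componentEdges_edgeSet.1 he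
      have hdp : d ∉ p.support := fun hdp =>
        h ⟨p.takeUntil d hdp, fun hc => hp c (p.support_takeUntil_subset_support hdp hc) rfl⟩
      have hpN : ∀ z ∈ p.support, z ∉ boundary X.edgeSet N := fun z hz hz' =>
        hdp ((hd.subset hz' : z = d) ▸ hz)
      exact mem_of_notMem_boundary (mem_ends_of_walk le_rfl p hx fun z hz _ => hpN z hz)
        (hpN y p.end_mem_support) he hy
    exact (mem_ends_or x).imp (subset_of_mem N hd) fun hx => Or.inl (subset_of_mem _ hd' hx)

theorem HasPointBoundary.exists_nested [Nontrivial V] (hX : X.Connected)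
    (hM : HasPointBoundary X.edgeSet M) (hx : x ∈ ends M) (hxb : x ∉ boundary X.edgeSet M) :
    ∃ L, HasPointBoundary X.edgeSet L ∧ (∀ N, HasPointBoundary X.edgeSet N → Nested X.edgeSet L N) ∧
      L ⊆ M ∧ x ∈ ends L ∧ x ∉ ends (X.edgeSet \ L) := by
  obtain ⟨c, hc⟩ := hM.2
  have hxc : x ∉ ({c} : Set V) := hc ▸ hxb
  have hsub : componentEdges X.edgeSet {c} x ⊆ M :=
    componentEdges_subset_of_boundary_subset hc.subset hx
  obtain ⟨e, he, hxe⟩ := hx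
  obtain ⟨f, hf, -⟩ := (hc.superset (Set.mem_singleton c)).2
  have heL : e ∈ componentEdges X.edgeSet {c} x := mem_componentEdges hxc (hM.1 he) hxe
  have hL : boundary X.edgeSet (componentEdges X.edgeSet {c} x) = {c} :=
    boundary_eq_singleton_of_subset hX ⟨e, heL⟩ ⟨f, hf.1, fun h => hf.2 (hsub h)⟩
      boundary_componentEdges_subset
  refine ⟨_, ⟨componentEdges_subset, c, hL⟩, fun N hN => nested_componentEdges hX hN, hsub,
    ⟨e, heL, hxe⟩, ?_⟩
  rintro ⟨f, hf, hxf⟩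
  exact hf.2 (mem_componentEdges hxc hf.1 hxf)

end Blocks

end TutteTree

/-! ### Canonical splits -/

namespace TutteTree

section CanonicalSplits
open SimpleGraph

variable {V : Type*} {X : SimpleGraph V}

/-- `F` is a set of edges of `Y` with two boundary vertices. -/
def HasPairBoundary (Y F : Set (Sym2 V)) : Prop :=
  F ⊆ Y ∧ ∃ u v, u ≠ v ∧ boundary Y F = {u, v}

/-- `F` is a set of edges of `Y` with two boundary vertices that crosses no other such set. -/
def IsUncrossed (Y F : Set (Sym2 V)) : Prop :=
  HasPairBoundary Y F ∧ ∀ F', HasPairBoundary Y F' → Nested Y F F'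

/-- The number of uncrossed subsets of `F` with `w` in their boundary. Comparing the weights of `F`
and of its complement is an automorphism invariant way to choose a side of `F` for `w`. -/
noncomputable def weight (Y : Set (Sym2 V)) (w : V) (F : Set (Sym2 V)) : ℕ :=
  {F' | IsUncrossed Y F' ∧ F' ⊆ F ∧ w ∈ boundary Y F'}.ncard

/-- The vertices at which `F` outweighs its complement. -/
def heavy (Y F : Set (Sym2 V)) : Set V := {w | weight Y w (Y \ F) < weight Y w F}

/-- The vertices at which `F` is not outweighed by its complement. -/
def notLight (Y F : Set (Sym2 V)) : Set V := {w | weight Y w (Y \ F) ≤ weight Y w F}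

/-- `B` is one of the two canonical extensions to `X` of the subset `F` of the block `Y`. Both are
needed because complementation interchanges them. -/
def IsCanonicalExtension (X : SimpleGraph V) (Y F B : Set (Sym2 V)) : Prop :=
  B = extend X Y F (heavy Y F) ∨ B = extend X Y F (notLight Y F)

/-- Neither `F` nor its complement in `Y` is a single edge. -/
def IsNontrivialSplit (Y F : Set (Sym2 V)) : Prop := (∀ e, F ≠ {e}) ∧ ∀ e, Y \ F ≠ {e}

/-- The sets with one boundary vertex that cross no other such set. -/
def pointSplits (X : SimpleGraph V) : Set (Set (Sym2 V)) :=
  {M | HasPointBoundary X.edgeSet M ∧ ∀ N, HasPointBoundary X.edgeSet N → Nested X.edgeSet M N}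

/-- The canonical extensions of the nontrivial uncrossed subsets of the blocks. -/
def pairSplits (X : SimpleGraph V) : Set (Set (Sym2 V)) :=
  {B | ∃ Y F, IsBlock X Y ∧ IsUncrossed Y F ∧ IsNontrivialSplit Y F ∧ IsCanonicalExtension X Y F B}

/-- The edge sets of the separations from which the structure tree is built. -/
def canonicalSplits (X : SimpleGraph V) : Set (Set (Sym2 V)) := pointSplits X ∪ pairSplits X

variable {Y Y' F F' B B' : Set (Sym2 V)} {a b u v w : V}

theorem HasPairBoundary.compl (h : HasPairBoundary Y F) : HasPairBoundary Y (Y \ F) :=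
  ⟨Set.sdiff_subset, by rw [boundary_sdiff h.1]; exact h.2⟩

theorem HasPairBoundary.exists_eq_pair (h : HasPairBoundary Y F) (hu : u ∈ boundary Y F) :
    ∃ v, u ≠ v ∧ boundary Y F = {u, v} := by
  obtain ⟨-, x, y, hxy, h⟩ := h
  rw [h] at hu ⊢
  rcases hu with rfl | rfl
  · exact ⟨y, hxy, rfl⟩
  · exact ⟨x, hxy.symm, Set.pair_comm x u⟩

theorem HasPairBoundary.nonempty (h : HasPairBoundary Y F) : F.Nonempty := by
  obtain ⟨-, u, v, -, h⟩ := h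
  obtain ⟨e, he, -⟩ := (h.superset (Set.mem_insert u {v})).1
  exact ⟨e, he⟩

theorem IsUncrossed.compl (h : IsUncrossed Y F) : IsUncrossed Y (Y \ F) :=
  ⟨h.1.compl, fun F' hF' => (Nested.compl_left_iff h.1.1).2 (h.2 F' hF')⟩

theorem IsNontrivialSplit.compl (hF : F ⊆ Y) (h : IsNontrivialSplit Y F) :
    IsNontrivialSplit Y (Y \ F) :=
  ⟨h.2, (Set.sdiff_sdiff_cancel_left hF).symm ▸ h.1⟩

theorem heavy_compl (hF : F ⊆ Y) : heavy Y (Y \ F) = (notLight Y F)ᶜ := by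
  ext w
  simp [heavy, notLight, Set.sdiff_sdiff_cancel_left hF]

theorem notLight_compl (hF : F ⊆ Y) : notLight Y (Y \ F) = (heavy Y F)ᶜ := by
  ext w
  simp [heavy, notLight, Set.sdiff_sdiff_cancel_left hF]

theorem heavy_subset_notLight : heavy Y F ⊆ notLight Y F :=
  Set.ofPred_subset_ofPred.2 fun _ => le_of_lt

theorem IsCanonicalExtension.compl (hX : X.Connected) (hY : IsBlock X Y) (hF : F ⊆ Y)
    (h : IsCanonicalExtension X Y F B) : IsCanonicalExtension X Y (Y \ F) (X.edgeSet \ B) := by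
  rw [IsCanonicalExtension, heavy_compl hF, notLight_compl hF, ← sdiff_extend hX hY hF,
    ← sdiff_extend hX hY hF]
  exact (h.imp (congrArg (X.edgeSet \ ·)) (congrArg (X.edgeSet \ ·))).symm

theorem IsCanonicalExtension.exists_eq (h : IsCanonicalExtension X Y F B) :
    ∃ W, B = extend X Y F W :=
  h.elim (fun h => ⟨_, h⟩) fun h => ⟨_, h⟩

theorem IsCanonicalExtension.subset (h : IsCanonicalExtension X Y F B) : B ⊆ X.edgeSet := by
  obtain ⟨W, rfl⟩ := h.exists_eq
  exact extend_subset

theorem eq_of_boundary_eq (hX : X.Connected) (hB : B ⊆ X.edgeSet) (hB' : B' ⊆ X.edgeSet)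
    (hne : (boundary X.edgeSet B).Nonempty) (h : boundary X.edgeSet B = boundary X.edgeSet B')
    (hmem : ∀ e ∈ X.edgeSet, ∀ x ∈ boundary X.edgeSet B, x ∈ e → (e ∈ B ↔ e ∈ B')) :
    B = B' := by
  have mem_iff_mem : ∀ {B : Set (Sym2 V)} {x e f}, x ∉ boundary X.edgeSet B → e ∈ X.edgeSet →
      f ∈ X.edgeSet → x ∈ e → x ∈ f → (e ∈ B ↔ f ∈ B) := fun hx he hf hxe hxf =>
    ⟨fun h => mem_of_notMem_boundary ⟨_, h, hxe⟩ hx hf hxf,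
      fun h => mem_of_notMem_boundary ⟨_, h, hxf⟩ hx he hxe⟩
  obtain ⟨c, hc⟩ := hne
  obtain ⟨e₀, he₀, hce₀⟩ := hc.1
  let D : Set (Sym2 V) := {e | e ∈ X.edgeSet ∧ (e ∈ B ↔ e ∈ B')}
  have hD : X.edgeSet ⊆ D := by
    by_contra hD
    obtain ⟨f₀, hf₀, hf₀D⟩ := Set.not_subset.1 hD
    obtain ⟨x, ⟨e, he, hxe⟩, f, ⟨hfX, hfD⟩, hxf⟩ := boundary_nonempty (F := D) hX
      ⟨e₀, hB he₀, hmem e₀ (hB he₀) c hc hce₀⟩ ⟨f₀, hf₀, hf₀D⟩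
    by_cases hx : x ∈ boundary X.edgeSet B
    · exact hfD ⟨hfX, hmem f hfX x hx hxf⟩
    · exact hfD ⟨hfX, (mem_iff_mem hx hfX he.1 hxf hxe).trans
        (he.2.trans (mem_iff_mem (h ▸ hx) he.1 hfX hxe hxf))⟩
  exact Set.Subset.antisymm (fun e he => (hD (hB he)).2.1 he) fun e he => (hD (hB' he)).2.2 he

theorem finite_of_boundary_subset (hX : X.Connected) (hlf : ∀ v, (X.neighborSet v).Finite)
    {K : Set V} (hK : K.Finite) :
    {B | B ⊆ X.edgeSet ∧ (boundary X.edgeSet B).Nonempty ∧ boundary X.edgeSet B ⊆ K}.Finite := by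
  let D : Set (Sym2 V) := {e | e ∈ X.edgeSet ∧ ∃ x ∈ K, x ∈ e}
  have hD : D.Finite := by
    refine (hK.biUnion fun x _ => (hlf x).image fun y => s(x, y)).subset ?_
    rintro e ⟨he, x, hx, hxe⟩
    obtain ⟨y, rfl⟩ := Sym2.mem_iff_exists.1 hxe
    exact Set.mem_biUnion hx ⟨y, he, rfl⟩
  refine Set.Finite.of_finite_image (f := fun B => (boundary X.edgeSet B, B ∩ D))
    ((hK.powerset.prod hD.powerset).subset ?_) ?_
  · rintro _ ⟨B, hB, rfl⟩
    exact ⟨hB.2.2, Set.inter_subset_right⟩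
  · rintro B hB B' hB' h
    obtain ⟨hbd, hBD⟩ := Prod.mk.inj h
    refine eq_of_boundary_eq hX hB.1 hB'.1 hB.2.1 hbd fun e he x hx hxe => ?_
    have heD : e ∈ D := ⟨he, x, hB.2.2 hx, hxe⟩
    have := Set.ext_iff.1 hBD e
    rwa [Set.mem_inter_iff, Set.mem_inter_iff, and_iff_left heD, and_iff_left heD] at this

theorem finite_setOf_unavoidable (a b u : V) :
    {v | (∃ p : X.Walk a b, u ∉ p.support) ∧
      ∀ p : X.Walk a b, u ∉ p.support → v ∈ p.support}.Finite := by
  by_cases h : ∃ p : X.Walk a b, u ∉ p.support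
  · obtain ⟨p, hp⟩ := h
    exact p.support.finite_toSet.subset fun v hv => hv.2 p hp
  · exact Set.finite_empty.subset fun v hv => h hv.1

theorem IsBlock.exists_walk_notMem_support (hX : X.Connected) (hY : IsBlock X Y)
    (ha : s(u, a) ∈ Y) (hb : s(u, b) ∈ Y) : ∃ p : X.Walk a b, u ∉ p.support := by
  have hau : a ∉ ({u} : Set V) := (hY.subset ha : X.Adj u a).ne'
  have ha' : s(u, a) ∈ componentEdges X.edgeSet {u} a :=
    mem_componentEdges hau (hY.subset ha) (Sym2.mem_mk_right u a)
  by_contra hno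
  have hb' : s(u, b) ∉ componentEdges X.edgeSet {u} a := by
    intro h
    obtain ⟨-, y, hy, p, hp⟩ := mem_componentEdges_edgeSet.1 h
    obtain rfl : y = b := (Sym2.mem_iff.1 hy).resolve_left (hp y p.end_mem_support)
    exact hno ⟨p, fun hu => hp u hu rfl⟩
  have hpoint : HasPointBoundary X.edgeSet (componentEdges X.edgeSet {u} a) :=
    ⟨componentEdges_subset, u, boundary_eq_singleton_of_subset hX ⟨_, ha'⟩
      ⟨_, hY.subset hb, hb'⟩ boundary_componentEdges_subset⟩
  rcases hY.subset_or hpoint with h | h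
  · exact hb' (h hb)
  · exact (h ha).2 ha'

theorem IsBlock.mem_support_of_boundary_eq (hX : X.Connected) (hY : IsBlock X Y) (hF : F ⊆ Y)
    (hbd : boundary Y F = {u, v}) (ha : s(u, a) ∈ F) (hb : s(u, b) ∈ Y \ F) (p : X.Walk a b)
    (hu : u ∉ p.support) : v ∈ p.support := by
  by_contra hv
  have avoids : ∀ z ∈ p.support, z ∉ boundary X.edgeSet (extend X Y F (ends F)) := by
    rw [boundary_extend hX hY hF fun _ _ _ => Iff.rfl, hbd]
    rintro z hz (rfl | rfl)
    · exact hu hz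
    · exact hv hz
  have hb_ends : b ∈ ends (extend X Y F (ends F)) := mem_ends_of_walk le_rfl p
    ⟨_, subset_extend hY hF ha, Sym2.mem_mk_right u a⟩ fun z hz _ => avoids z hz
  exact avoids b p.end_mem_support ⟨hb_ends, s(u, b),
    ⟨hY.subset hb.1, fun h => hb.2 ((mem_extend_of_mem hY hb.1).1 h)⟩, Sym2.mem_mk_right u b⟩

theorem exists_finite_of_hasPairBoundary (hX : X.Connected)
    (hlf : ∀ v, (X.neighborSet v).Finite) (u : V) :
    ∃ K : Set V, K.Finite ∧ u ∈ K ∧ ∀ Y F, IsBlock X Y → HasPairBoundary Y F →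
      u ∈ boundary Y F → boundary Y F ⊆ K := by
  refine ⟨{u} ∪ ⋃ a ∈ X.neighborSet u, ⋃ b ∈ X.neighborSet u,
    {v | (∃ p : X.Walk a b, u ∉ p.support) ∧ ∀ p : X.Walk a b, u ∉ p.support → v ∈ p.support},
    (Set.finite_singleton u).union ((hlf u).biUnion fun a _ => (hlf u).biUnion fun b _ =>
      finite_setOf_unavoidable a b u), Or.inl rfl, ?_⟩
  intro Y F hY hF hu
  obtain ⟨v, -, hbd⟩ := hF.exists_eq_pair hu
  obtain ⟨a, ha⟩ := mem_ends_iff.1 hu.1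
  obtain ⟨b, hb⟩ := mem_ends_iff.1 hu.2
  rw [hbd]
  rintro x (rfl | rfl)
  · exact Or.inl rfl
  · exact Or.inr (Set.mem_biUnion (hY.subset (hF.1 ha)) (Set.mem_biUnion (hY.subset hb.1)
      ⟨hY.exists_walk_notMem_support hX (hF.1 ha) hb.1,
        hY.mem_support_of_boundary_eq hX hF.1 hbd ha hb⟩))

theorem finite_hasPairBoundary (hX : X.Connected) (hlf : ∀ v, (X.neighborSet v).Finite)
    (hY : IsBlock X Y) (w : V) : {F | HasPairBoundary Y F ∧ w ∈ boundary Y F}.Finite := by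
  obtain ⟨K, hK, -, hKw⟩ := exists_finite_of_hasPairBoundary hX hlf w
  refine Set.Finite.of_finite_image (f := fun F => extend X Y F (ends F))
    ((finite_of_boundary_subset hX hlf hK).subset ?_) ?_
  · rintro _ ⟨F, ⟨hF, hw⟩, rfl⟩
    have hbd : boundary X.edgeSet (extend X Y F (ends F)) = boundary Y F :=
      boundary_extend hX hY hF.1 fun _ _ _ => Iff.rfl
    exact ⟨extend_subset, hbd ▸ ⟨w, hw⟩, hbd ▸ hKw Y F hY hF hw⟩
  · rintro F ⟨hF, -⟩ F' ⟨hF', -⟩ h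
    rw [← extend_inter (W := ends F) hY hF.1, ← extend_inter (W := ends F') hY hF'.1]
    exact congrArg (· ∩ Y) h

theorem finite_setOf_weight (hX : X.Connected) (hlf : ∀ v, (X.neighborSet v).Finite)
    (hY : IsBlock X Y) (w : V) (F : Set (Sym2 V)) :
    {F' | IsUncrossed Y F' ∧ F' ⊆ F ∧ w ∈ boundary Y F'}.Finite :=
  (finite_hasPairBoundary hX hlf hY w).subset fun _ h => ⟨h.1.1, h.2.2⟩

theorem IsBlock.boundary_singleton (hX : X.Connected) (hY : IsBlock X Y) {e f : Sym2 V}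
    (he : e ∈ Y) (hf : f ∈ Y) (hef : e ≠ f) : boundary Y {e} = {x | x ∈ e} := by
  have hsub : boundary Y {e} ⊆ {x | x ∈ e} := by
    rintro x ⟨⟨_, rfl, hx⟩, -⟩
    exact hx
  have hnot := hY.not_boundary_subset hX (Set.singleton_subset_iff.2 he) ⟨e, rfl⟩
    ⟨f, hf, hef.symm⟩
  refine hsub.antisymm fun x hx => ?_
  obtain ⟨y, rfl⟩ := Sym2.mem_iff_exists.1 hx
  obtain ⟨z, hz, hzy⟩ := Set.not_subset.1 (hnot y)
  exact (Sym2.mem_iff.1 (hsub hz)).resolve_right hzy ▸ hz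

theorem IsBlock.isUncrossed_singleton (hX : X.Connected) (hY : IsBlock X Y) {e f : Sym2 V}
    (he : e ∈ Y) (hf : f ∈ Y) (hef : e ≠ f) : IsUncrossed Y {e} := by
  refine ⟨⟨Set.singleton_subset_iff.2 he, ?_⟩, fun F' _ => ?_⟩
  · rw [hY.boundary_singleton hX he hf hef]
    induction e with
    | h a b => exact ⟨a, b, (hY.subset he : X.Adj a b).ne, Sym2.coe_mk⟩
  · by_cases h : e ∈ F'
    · exact Or.inl (Set.singleton_subset_iff.2 h)
    · exact Or.inr (Or.inl (Set.singleton_subset_iff.2 ⟨he, h⟩))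

theorem weight_mono (hX : X.Connected) (hlf : ∀ v, (X.neighborSet v).Finite) (hY : IsBlock X Y)
    (h : F ⊆ F') : weight Y w F ≤ weight Y w F' :=
  Set.ncard_le_ncard (fun _ hD => ⟨hD.1, hD.2.1.trans h, hD.2.2⟩)
    (finite_setOf_weight hX hlf hY w F')

theorem weight_lt_weight (hX : X.Connected) (hlf : ∀ v, (X.neighborSet v).Finite)
    (hY : IsBlock X Y) (h : F ⊂ F') (hF' : IsUncrossed Y F') (hw : w ∈ boundary Y F') :
    weight Y w F < weight Y w F' :=
  Set.ncard_lt_ncard ⟨fun _ hD => ⟨hD.1, hD.2.1.trans h.1, hD.2.2⟩,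
    fun hsub => h.2 (hsub ⟨hF', le_rfl, hw⟩).2.1⟩ (finite_setOf_weight hX hlf hY w F')

theorem weight_eq_zero (hw : w ∉ ends F) : weight Y w F = 0 := by
  have : {F' | IsUncrossed Y F' ∧ F' ⊆ F ∧ w ∈ boundary Y F'} = ∅ :=
    Set.eq_empty_of_forall_notMem fun D hD => hw (ends_mono hD.2.1 hD.2.2.1)
  rw [weight, this, Set.ncard_empty]

theorem weight_pos (hX : X.Connected) (hlf : ∀ v, (X.neighborSet v).Finite) (hY : IsBlock X Y)
    (hF : F ⊆ Y) (hne : (Y \ F).Nonempty) (hw : w ∈ ends F) : 0 < weight Y w F := by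
  obtain ⟨e, he, hwe⟩ := hw
  obtain ⟨f, hf⟩ := hne
  have hef : e ≠ f := fun h => hf.2 (h ▸ he)
  rw [weight, Set.ncard_pos (finite_setOf_weight hX hlf hY w F)]
  exact ⟨{e}, hY.isUncrossed_singleton hX (hF he) hf.1 hef, Set.singleton_subset_iff.2 he,
    (hY.boundary_singleton hX (hF he) hf.1 hef).superset hwe⟩

theorem weight_lt_of_mem_ends (hX : X.Connected) (hlf : ∀ v, (X.neighborSet v).Finite)
    (hY : IsBlock X Y) (hF : HasPairBoundary Y F) (hw : w ∈ ends F) (hwb : w ∉ boundary Y F) :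
    weight Y w (Y \ F) < weight Y w F := by
  rw [weight_eq_zero fun h => hwb ⟨hw, h⟩]
  exact weight_pos hX hlf hY hF.1 hF.compl.nonempty hw

theorem weight_lt_of_notMem_ends (hX : X.Connected) (hlf : ∀ v, (X.neighborSet v).Finite)
    (hY : IsBlock X Y) (hF : HasPairBoundary Y F) (hw : w ∈ ends Y) (hwF : w ∉ ends F) :
    weight Y w F < weight Y w (Y \ F) := by
  have := weight_lt_of_mem_ends hX hlf hY hF.compl (w := w) (mem_ends_sdiff_of_notMem hw hwF)
    fun h => hwF (boundary_sdiff hF.1 ▸ h).1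
  rwa [Set.sdiff_sdiff_cancel_left hF.1] at this

theorem IsCanonicalExtension.boundary_eq (hX : X.Connected)
    (hlf : ∀ v, (X.neighborSet v).Finite) (hY : IsBlock X Y) (hF : HasPairBoundary Y F)
    (h : IsCanonicalExtension X Y F B) : boundary X.edgeSet B = boundary Y F := by
  have mem_iff : ∀ w ∈ ends Y, w ∉ boundary Y F →
      (w ∈ heavy Y F ↔ w ∈ ends F) ∧ (w ∈ notLight Y F ↔ w ∈ ends F) := by
    intro w hw hwb
    by_cases hwF : w ∈ ends F
    · have hlt := weight_lt_of_mem_ends hX hlf hY hF hwF hwb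
      exact ⟨iff_of_true hlt hwF, iff_of_true hlt.le hwF⟩
    · have hlt := weight_lt_of_notMem_ends hX hlf hY hF hw hwF
      exact ⟨iff_of_false hlt.not_gt hwF, iff_of_false hlt.not_ge hwF⟩
  rcases h with rfl | rfl
  · exact boundary_extend hX hY hF.1 fun w hw hwb => (mem_iff w hw hwb).1
  · exact boundary_extend hX hY hF.1 fun w hw hwb => (mem_iff w hw hwb).2

theorem mem_heavy_of_mem_notLight (hX : X.Connected) (hlf : ∀ v, (X.neighborSet v).Finite)
    (hY : IsBlock X Y) (hF : IsUncrossed Y F) (hF' : IsUncrossed Y F') (h : F ⊂ F')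
    (hw : w ∈ ends Y) (hwF : w ∈ notLight Y F) : w ∈ heavy Y F' := by
  have hcompl : Y \ F' ⊂ Y \ F :=
    ⟨Set.sdiff_subset_sdiff_right h.1, fun hsub => h.2 fun e he => by_contra fun heF =>
      (hsub ⟨hF'.1.1 he, heF⟩).2 he⟩
  have hlight : weight Y w (Y \ F) ≤ weight Y w F := hwF
  change weight Y w (Y \ F') < weight Y w F'
  by_cases hwb' : w ∈ boundary Y F'
  · calc weight Y w (Y \ F') ≤ weight Y w (Y \ F) := weight_mono hX hlf hY hcompl.1
      _ ≤ weight Y w F := hlight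
      _ < weight Y w F' := weight_lt_weight hX hlf hY h hF' hwb'
  by_cases hwb : w ∈ boundary Y F
  · calc weight Y w (Y \ F') < weight Y w (Y \ F) :=
          weight_lt_weight hX hlf hY hcompl hF.compl ((boundary_sdiff hF.1.1).symm ▸ hwb)
      _ ≤ weight Y w F := hlight
      _ ≤ weight Y w F' := weight_mono hX hlf hY h.1
  by_cases hwe : w ∈ ends F
  · exact weight_lt_of_mem_ends hX hlf hY hF'.1 (ends_mono h.1 hwe) hwb'
  · exact absurd hlight (weight_lt_of_notMem_ends hX hlf hY hF.1 hw hwe).not_ge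

theorem IsCanonicalExtension.subset_or (hX : X.Connected) (hlf : ∀ v, (X.neighborSet v).Finite)
    (hY : IsBlock X Y) (hF : IsUncrossed Y F) (hF' : IsUncrossed Y F')
    (hB : IsCanonicalExtension X Y F B) (hB' : IsCanonicalExtension X Y F' B') (h : F ⊆ F') :
    B ⊆ B' ∨ B' ⊆ B := by
  have heavy_le : ∀ F, extend X Y F (heavy Y F) ⊆ extend X Y F (notLight Y F) := fun F =>
    extend_mono le_rfl fun w _ hw => heavy_subset_notLight hw
  rcases eq_or_ne F F' with rfl | hne
  · rcases hB with rfl | rfl <;> rcases hB' with rfl | rfl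
    · exact Or.inl le_rfl
    · exact Or.inl (heavy_le F)
    · exact Or.inr (heavy_le F)
    · exact Or.inl le_rfl
  · have hle : extend X Y F (notLight Y F) ⊆ extend X Y F' (heavy Y F') := extend_mono h
      fun w hw => mem_heavy_of_mem_notLight hX hlf hY hF hF' (h.ssubset_of_ne hne) hw
    left
    rcases hB with rfl | rfl <;> rcases hB' with rfl | rfl
    · exact (heavy_le F).trans hle
    · exact ((heavy_le F).trans hle).trans (heavy_le F')
    · exact hle
    · exact hle.trans (heavy_le F')

theorem IsCanonicalExtension.nested (hX : X.Connected) (hlf : ∀ v, (X.neighborSet v).Finite)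
    (hY : IsBlock X Y) (hF : IsUncrossed Y F) (hF' : IsUncrossed Y F')
    (hB : IsCanonicalExtension X Y F B) (hB' : IsCanonicalExtension X Y F' B') :
    Nested X.edgeSet B B' := by
  have hBc := hB.compl hX hY hF.1.1
  have hBc' := hB'.compl hX hY hF'.1.1
  rcases hF.2 F' hF'.1 with h | h | h | h
  · exact .of_subset_or (hB.subset_or hX hlf hY hF hF' hB' h)
  · exact (Nested.compl_right_iff hB'.subset).1
      (.of_subset_or (hB.subset_or hX hlf hY hF hF'.compl hBc' h))
  · exact (Nested.compl_left_iff hB.subset).1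
      (.of_subset_or (hBc.subset_or hX hlf hY hF.compl hF' hB' h))
  · exact (Nested.compl_left_iff hB.subset).1 ((Nested.compl_right_iff hB'.subset).1
      (.of_subset_or (hBc.subset_or hX hlf hY hF.compl hF'.compl hBc' h)))

theorem nested_extend_of_ne (hX : X.Connected) (hY : IsBlock X Y) (hY' : IsBlock X Y')
    (hne : Y ≠ Y') (hF : F ⊆ Y) (hF' : F' ⊆ Y') {W W' : Set V} :
    Nested X.edgeSet (extend X Y F W) (extend X Y' F' W') := by
  obtain ⟨M, hM, hYM, hYM'⟩ := hY.exists_hasPointBoundary_of_ne hY' hne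
  have hleft : extend X Y F W ⊆ M ∨ X.edgeSet \ extend X Y F W ⊆ M :=
    (hM.compl.subset_extend_or hX hY hF ((Set.sdiff_sdiff_cancel_left hM.1).superset.trans' hYM)
      ).symm.imp (sdiff_le_sdiff_iff_le hM.1 extend_subset).1 Set.sdiff_subset_comm.1
  have hright := hM.subset_extend_or (W := W') hX hY' hF' hYM'
  rcases hleft with hleft | hleft <;> rcases hright with hright | hright
  · exact Or.inl (hleft.trans hright)
  · exact Or.inr (Or.inl (hleft.trans hright))
  · exact Or.inr (Or.inr (Or.inl (hleft.trans hright)))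
  · exact Or.inr (Or.inr (Or.inr (hleft.trans hright)))

theorem subset_of_mem_canonicalSplits (hB : B ∈ canonicalSplits X) : B ⊆ X.edgeSet := by
  rcases hB with hB | ⟨Y, F, -, -, -, hB⟩
  · exact hB.1.1
  · exact hB.subset

theorem compl_mem_canonicalSplits (hX : X.Connected) (hB : B ∈ canonicalSplits X) :
    X.edgeSet \ B ∈ canonicalSplits X := by
  rcases hB with hB | ⟨Y, F, hY, hF, hn, hB⟩
  · exact Or.inl ⟨hB.1.compl, fun N hN => (Nested.compl_left_iff hB.1.1).2 (hB.2 N hN)⟩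
  · exact Or.inr ⟨Y, Y \ F, hY, hF.compl, hn.compl hF.1.1, hB.compl hX hY hF.1.1⟩

theorem nested_of_mem_canonicalSplits (hX : X.Connected) (hlf : ∀ v, (X.neighborSet v).Finite)
    (hB : B ∈ canonicalSplits X) (hB' : B' ∈ canonicalSplits X) : Nested X.edgeSet B B' := by
  have hsub := subset_of_mem_canonicalSplits hB
  rcases hB with hB | ⟨Y, F, hY, hF, -, hB⟩ <;> rcases hB' with hB' | ⟨Y', F', hY', hF', -, hB'⟩
  · exact hB.2 B' hB'.1
  · obtain ⟨W, rfl⟩ := hB'.exists_eq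
    exact hB.1.nested_extend hX hY' hF'.1.1
  · obtain ⟨W, rfl⟩ := hB.exists_eq
    exact (hB'.1.nested_extend hX hY hF.1.1).symm hsub
  · rcases eq_or_ne Y Y' with rfl | hne
    · exact hB.nested hX hlf hY hF hF' hB'
    · obtain ⟨W, rfl⟩ := hB.exists_eq
      obtain ⟨W', rfl⟩ := hB'.exists_eq
      exact nested_extend_of_ne hX hY hY' hne hF.1.1 hF'.1.1

theorem boundary_of_mem_canonicalSplits (hX : X.Connected)
    (hlf : ∀ v, (X.neighborSet v).Finite) (hB : B ∈ canonicalSplits X) :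
    (∃ c, boundary X.edgeSet B = {c}) ∨ ∃ u v, u ≠ v ∧ boundary X.edgeSet B = {u, v} := by
  rcases hB with hB | ⟨Y, F, hY, hF, -, hB⟩
  · exact Or.inl hB.1.2
  · exact Or.inr ((hB.boundary_eq hX hlf hY hF.1).symm ▸ hF.1.2)

theorem boundary_nonempty_of_mem_canonicalSplits (hX : X.Connected)
    (hlf : ∀ v, (X.neighborSet v).Finite) (hB : B ∈ canonicalSplits X) :
    (boundary X.edgeSet B).Nonempty := by
  rcases boundary_of_mem_canonicalSplits hX hlf hB with ⟨c, h⟩ | ⟨u, v, -, h⟩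
  · exact h ▸ Set.singleton_nonempty c
  · exact h ▸ Set.insert_nonempty u {v}

theorem nonempty_of_mem_canonicalSplits (hX : X.Connected)
    (hlf : ∀ v, (X.neighborSet v).Finite) (hB : B ∈ canonicalSplits X) : B.Nonempty := by
  obtain ⟨x, ⟨e, he, -⟩, -⟩ := boundary_nonempty_of_mem_canonicalSplits hX hlf hB
  exact ⟨e, he⟩

theorem finite_canonicalSplits_boundary (hX : X.Connected)
    (hlf : ∀ v, (X.neighborSet v).Finite) (u : V) :
    {B | B ∈ canonicalSplits X ∧ u ∈ boundary X.edgeSet B}.Finite := by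
  obtain ⟨K, hK, huK, hKu⟩ := exists_finite_of_hasPairBoundary hX hlf u
  refine (finite_of_boundary_subset hX hlf hK).subset ?_
  rintro B ⟨hB, hu⟩
  refine ⟨subset_of_mem_canonicalSplits hB, ⟨u, hu⟩, ?_⟩
  rcases hB with hB | ⟨Y, F, hY, hF, -, hB⟩
  · obtain ⟨c, hc⟩ := hB.1.2
    rw [hc] at hu ⊢
    exact Set.singleton_subset_iff.2 ((hu : u = c) ▸ huK)
  · rw [hB.boundary_eq hX hlf hY hF.1] at hu ⊢
    exact hKu Y F hY hF.1 hu

theorem finite_canonicalSplits_interval (hX : X.Connected)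
    (hlf : ∀ v, (X.neighborSet v).Finite) (hB : B ∈ canonicalSplits X)
    (hB' : B' ∈ canonicalSplits X) : {C | C ∈ canonicalSplits X ∧ B ⊆ C ∧ C ⊆ B'}.Finite := by
  obtain ⟨x, hx⟩ := ends_nonempty (nonempty_of_mem_canonicalSplits hX hlf hB)
  obtain ⟨y, hy⟩ := ends_nonempty
    (nonempty_of_mem_canonicalSplits hX hlf (compl_mem_canonicalSplits hX hB'))
  obtain ⟨p⟩ := hX.preconnected x y
  have hfin : (⋃ u ∈ {u | u ∈ p.support},
      {B | B ∈ canonicalSplits X ∧ u ∈ boundary X.edgeSet B}).Finite :=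
    p.support.finite_toSet.biUnion fun u _ => finite_canonicalSplits_boundary hX hlf u
  refine hfin.subset ?_
  rintro C ⟨hC, hBC, hCB'⟩
  by_contra hno
  have avoids : ∀ z ∈ p.support, z ∉ boundary X.edgeSet C := fun z hz hz' =>
    hno (Set.mem_biUnion (show z ∈ {u | u ∈ p.support} from hz) ⟨hC, hz'⟩)
  have hyC : y ∈ ends C := mem_ends_of_walk le_rfl p (ends_mono hBC hx) fun z hz _ => avoids z hz
  exact avoids y p.end_mem_support ⟨hyC, ends_mono (Set.sdiff_subset_sdiff_right hCB') hy⟩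

end CanonicalSplits

end TutteTree

/-! ### Orbits of canonical splits -/

namespace TutteTree

section Equivariance
open SimpleGraph

variable {V : Type*} {X : SimpleGraph V} {g : X ≃g X} {Y F F' B M : Set (Sym2 V)} {w x y : V}

theorem sym2Map_injective (g : X ≃g X) : Function.Injective (Sym2.map g) :=
  Sym2.map.injective g.injective

theorem mapEdges_symm_mapEdges (g : X ≃g X) (F : Set (Sym2 V)) :
    mapEdges g.symm (mapEdges g F) = F := by
  have : (g.symm : V → V) ∘ g = id := funext g.symm_apply_apply
  rw [mapEdges, mapEdges, ← Set.image_comp, ← Sym2.map_comp, this, Sym2.map_id, Set.image_id]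

theorem mapEdges_mapEdges_symm (g : X ≃g X) (F : Set (Sym2 V)) :
    mapEdges g (mapEdges g.symm F) = F :=
  mapEdges_symm_mapEdges g.symm F

theorem mapEdges_subset_mapEdges : mapEdges g F ⊆ mapEdges g F' ↔ F ⊆ F' :=
  Set.image_subset_image_iff (sym2Map_injective g)

theorem mapEdges_sdiff : mapEdges g (F \ F') = mapEdges g F \ mapEdges g F' :=
  Set.image_sdiff (sym2Map_injective g) F F'

theorem map_mem_mapEdges {e : Sym2 V} : Sym2.map g e ∈ mapEdges g F ↔ e ∈ F :=
  (sym2Map_injective g).mem_set_image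

theorem mapEdges_injective (g : X ≃g X) : Function.Injective (mapEdges g) :=
  (sym2Map_injective g).image_injective

theorem mapEdges_edgeSet (g : X ≃g X) : mapEdges g X.edgeSet = X.edgeSet := by
  refine (mapEdges_subset_edgeSet g le_rfl).antisymm ?_
  rw [← mapEdges_mapEdges_symm g X.edgeSet, mapEdges_subset_mapEdges, mapEdges_mapEdges_symm]
  exact mapEdges_subset_edgeSet g.symm le_rfl

theorem boundary_mapEdges : boundary (mapEdges g Y) (mapEdges g F) = g '' boundary Y F := by
  rw [boundary, ← mapEdges_sdiff, ends_mapEdges, ends_mapEdges, boundary,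
    Set.image_inter g.injective]

theorem apply_mem_boundary_mapEdges :
    g w ∈ boundary (mapEdges g Y) (mapEdges g F) ↔ w ∈ boundary Y F := by
  rw [boundary_mapEdges, g.injective.mem_set_image]

theorem HasPointBoundary.mapEdges (h : HasPointBoundary X.edgeSet M) (g : X ≃g X) :
    HasPointBoundary X.edgeSet (mapEdges g M) := by
  obtain ⟨h, c, hc⟩ := h
  refine ⟨mapEdges_subset_edgeSet g h, g c, ?_⟩
  rw [← mapEdges_edgeSet g, boundary_mapEdges, hc, Set.image_singleton]

theorem Nested.mapEdges (h : Nested Y F F') (g : X ≃g X) :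
    Nested (mapEdges g Y) (mapEdges g F) (mapEdges g F') := by
  simpa only [Nested, ← mapEdges_sdiff, mapEdges_subset_mapEdges] using h

theorem IsBlock.mapEdges (h : IsBlock X Y) (g : X ≃g X) : IsBlock X (mapEdges g Y) := by
  obtain ⟨e, he, rfl⟩ := h
  refine ⟨Sym2.map g e, mapEdges_subset_edgeSet g le_rfl ⟨e, he, rfl⟩, ?_⟩
  ext f
  constructor
  · rintro ⟨f, ⟨hf, hef⟩, rfl⟩
    refine ⟨mapEdges_subset_edgeSet g le_rfl ⟨f, hf, rfl⟩, fun M hM => ?_⟩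
    rw [← mapEdges_mapEdges_symm g M, map_mem_mapEdges, map_mem_mapEdges]
    exact hef _ (hM.mapEdges g.symm)
  · rintro ⟨hf, hef⟩
    rw [← mapEdges_edgeSet g] at hf
    obtain ⟨f, hf, rfl⟩ := hf
    refine map_mem_mapEdges.2 ⟨hf, fun M hM => ?_⟩
    have := hef _ (hM.mapEdges g)
    rwa [map_mem_mapEdges, map_mem_mapEdges] at this

theorem HasPairBoundary.mapEdges (h : HasPairBoundary Y F) (g : X ≃g X) :
    HasPairBoundary (mapEdges g Y) (mapEdges g F) := by
  obtain ⟨h, u, v, huv, hbd⟩ := h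
  exact ⟨mapEdges_subset_mapEdges.2 h, g u, g v, g.injective.ne huv,
    by rw [boundary_mapEdges, hbd, Set.image_pair]⟩

theorem IsUncrossed.mapEdges (h : IsUncrossed Y F) (g : X ≃g X) :
    IsUncrossed (mapEdges g Y) (mapEdges g F) := by
  refine ⟨h.1.mapEdges g, fun F' hF' => ?_⟩
  have := hF'.mapEdges g.symm
  rw [mapEdges_symm_mapEdges] at this
  rw [← mapEdges_mapEdges_symm g F']
  exact (h.2 _ this).mapEdges g

theorem isUncrossed_mapEdges_iff : IsUncrossed (mapEdges g Y) (mapEdges g F) ↔ IsUncrossed Y F := by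
  refine ⟨fun h => ?_, fun h => h.mapEdges g⟩
  have := h.mapEdges g.symm
  rwa [mapEdges_symm_mapEdges, mapEdges_symm_mapEdges] at this

theorem weight_mapEdges : weight (mapEdges g Y) (g w) (mapEdges g F) = weight Y w F := by
  have : {F' | IsUncrossed (mapEdges g Y) F' ∧ F' ⊆ mapEdges g F ∧
      g w ∈ boundary (mapEdges g Y) F'} =
      mapEdges g '' {F' | IsUncrossed Y F' ∧ F' ⊆ F ∧ w ∈ boundary Y F'} := by
    ext F'
    obtain ⟨F', rfl⟩ : ∃ D, mapEdges g D = F' := ⟨_, mapEdges_mapEdges_symm g F'⟩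
    rw [(mapEdges_injective g).mem_set_image, Set.mem_ofPred_eq, Set.mem_ofPred_eq,
      isUncrossed_mapEdges_iff, mapEdges_subset_mapEdges, apply_mem_boundary_mapEdges]
  rw [weight, this, Set.ncard_image_of_injective _ (mapEdges_injective g), weight]

theorem heavy_mapEdges : heavy (mapEdges g Y) (mapEdges g F) = g '' heavy Y F := by
  ext x
  obtain ⟨w, rfl⟩ := g.surjective x
  rw [g.injective.mem_set_image]
  simp only [heavy, Set.mem_ofPred_eq, ← mapEdges_sdiff, weight_mapEdges]

theorem notLight_mapEdges : notLight (mapEdges g Y) (mapEdges g F) = g '' notLight Y F := by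
  ext x
  obtain ⟨w, rfl⟩ := g.surjective x
  rw [g.injective.mem_set_image]
  simp only [notLight, Set.mem_ofPred_eq, ← mapEdges_sdiff, weight_mapEdges]

theorem reachable_deleteEdges_mapEdges (g : X ≃g X) (h : (X.deleteEdges Y).Reachable x y) :
    (X.deleteEdges (mapEdges g Y)).Reachable (g x) (g y) := by
  let f : X.deleteEdges Y →g X.deleteEdges (mapEdges g Y) :=
    ⟨g, fun {a b} hab => by
      rw [deleteEdges_adj] at hab ⊢
      exact ⟨g.map_adj_iff.2 hab.1, fun h => hab.2 (map_mem_mapEdges.1 (Sym2.map_mk .. ▸ h))⟩⟩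
  exact h.map f

theorem mapEdges_extend_subset (g : X ≃g X) (W : Set V) :
    mapEdges g (extend X Y F W) ⊆ extend X (mapEdges g Y) (mapEdges g F) (g '' W) := by
  rintro _ ⟨e, ⟨heX, he⟩, rfl⟩
  refine ⟨mapEdges_subset_edgeSet g le_rfl ⟨e, heX, rfl⟩, ?_⟩
  rcases he with he | ⟨he, w, hw, hwY, x, hx, hxw⟩
  · exact Or.inl (map_mem_mapEdges.2 he)
  · exact Or.inr ⟨fun h => he (map_mem_mapEdges.1 h), g w, ⟨w, hw, rfl⟩,
      (ends_mapEdges g).superset ⟨w, hwY, rfl⟩, g x, Sym2.mem_map.2 ⟨x, hx, rfl⟩,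
      reachable_deleteEdges_mapEdges g hxw⟩

theorem mapEdges_extend (g : X ≃g X) (W : Set V) :
    mapEdges g (extend X Y F W) = extend X (mapEdges g Y) (mapEdges g F) (g '' W) := by
  refine (mapEdges_extend_subset g W).antisymm ?_
  have hW : (g.symm : V → V) '' (g '' W) = W := g.toEquiv.symm_image_image W
  have h := mapEdges_extend_subset (Y := mapEdges g Y) (F := mapEdges g F) g.symm (g '' W)
  rwa [mapEdges_symm_mapEdges, mapEdges_symm_mapEdges, hW, ← mapEdges_subset_mapEdges (g := g),
    mapEdges_mapEdges_symm] at h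

theorem IsCanonicalExtension.mapEdges (h : IsCanonicalExtension X Y F B) (g : X ≃g X) :
    IsCanonicalExtension X (mapEdges g Y) (mapEdges g F) (mapEdges g B) := by
  rcases h with rfl | rfl
  · exact Or.inl (by rw [heavy_mapEdges, mapEdges_extend])
  · exact Or.inr (by rw [notLight_mapEdges, mapEdges_extend])

theorem IsNontrivialSplit.mapEdges (h : IsNontrivialSplit Y F) (g : X ≃g X) :
    IsNontrivialSplit (mapEdges g Y) (mapEdges g F) := by
  have ne_singleton : ∀ F : Set (Sym2 V), (∀ e, F ≠ {e}) → ∀ e, TutteTree.mapEdges g F ≠ {e} := by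
    intro F hF e he
    apply hF (Sym2.map g.symm e)
    rw [← mapEdges_symm_mapEdges g F, he, TutteTree.mapEdges, Set.image_singleton]
  exact ⟨ne_singleton F h.1, mapEdges_sdiff (g := g) ▸ ne_singleton _ h.2⟩

theorem mapEdges_mem_canonicalSplits (h : B ∈ canonicalSplits X) (g : X ≃g X) :
    mapEdges g B ∈ canonicalSplits X := by
  rcases h with h | ⟨Y, F, hY, hF, hn, hB⟩
  · refine Or.inl ⟨h.1.mapEdges g, fun N hN => ?_⟩
    have := (h.2 _ (hN.mapEdges g.symm)).mapEdges g
    rwa [mapEdges_mapEdges_symm, mapEdges_edgeSet] at this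
  · exact Or.inr ⟨mapEdges g Y, mapEdges g F, hY.mapEdges g, hF.mapEdges g, hn.mapEdges g,
      hB.mapEdges g⟩

theorem exists_finite_orbits_canonicalSplits (hX : X.Connected)
    (hlf : ∀ v, (X.neighborSet v).Finite) (hfin : IsAutFinite X) :
    ∃ S ⊆ canonicalSplits X, S.Finite ∧
      ∀ A ∈ canonicalSplits X, ∃ B ∈ S, ∃ g : X ≃g X, mapEdges g B = A := by
  obtain ⟨K, hK, hKg⟩ := hfin
  refine ⟨⋃ u ∈ K, {B | B ∈ canonicalSplits X ∧ u ∈ boundary X.edgeSet B},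
    Set.iUnion₂_subset fun u _ B hB => hB.1,
    hK.biUnion fun u _ => finite_canonicalSplits_boundary hX hlf u, fun A hA => ?_⟩
  obtain ⟨x, hx⟩ := boundary_nonempty_of_mem_canonicalSplits hX hlf hA
  obtain ⟨w, hw, g, rfl⟩ := hKg x
  rw [← mapEdges_edgeSet g, ← mapEdges_mapEdges_symm g A, apply_mem_boundary_mapEdges] at hx
  exact ⟨mapEdges g.symm A, Set.mem_biUnion hw ⟨mapEdges_mem_canonicalSplits hA g.symm, hx⟩, g,
    mapEdges_mapEdges_symm g A⟩

end Equivariance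

end TutteTree

/-! ### Crossing pair boundaries in a block -/

namespace TutteTree

section Crossing
open SimpleGraph

variable {V : Type*} {Y F R S : Set (Sym2 V)} {u v w x z : V}

/-- The edge set `Y` has no cut-point: no vertex is the whole boundary of a proper part of `Y`. -/
def IsTwoConnected (Y : Set (Sym2 V)) : Prop :=
  ∀ F ⊆ Y, F.Nonempty → (Y \ F).Nonempty → ∀ c, ¬ boundary Y F ⊆ {c}

/-- `F` and `R` cross as subsets of `Y`: all four corners are nonempty, so they are not nested. -/
structure Crossing (Y F R : Set (Sym2 V)) : Prop where
  left : F ⊆ Y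
  right : R ⊆ Y
  inter : (F ∩ R).Nonempty
  inter_compl : (F ∩ (Y \ R)).Nonempty
  compl_inter : ((Y \ F) ∩ R).Nonempty
  compl_inter_compl : ((Y \ F) ∩ (Y \ R)).Nonempty

/-- `R` divides `u` from `v` inside `Y`: all edges of `Y` at one of them lie in `R`, and none of
those at the other do. -/
def Divides (Y R : Set (Sym2 V)) (u v : V) : Prop :=
  (u ∉ ends (Y \ R) ∧ v ∉ ends R) ∨ (u ∉ ends R ∧ v ∉ ends (Y \ R))

theorem Divides.symm (h : Divides Y R u v) : Divides Y R v u :=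
  Or.symm (h.imp And.symm And.symm)

theorem crossing_of_not_nested (hF : F ⊆ Y) (hR : R ⊆ Y) (h : ¬ Nested Y F R) :
    Crossing Y F R := by
  simp only [Nested, not_or, Set.not_subset] at h
  obtain ⟨⟨a, ha, ha'⟩, ⟨b, hb, hb'⟩, ⟨c, hc, hc'⟩, ⟨d, hd, hd'⟩⟩ := h
  exact ⟨hF, hR, ⟨b, hb, by_contra fun h => hb' ⟨hF hb, h⟩⟩, ⟨a, ha, hF ha, ha'⟩,
    ⟨d, hd, by_contra fun h => hd' ⟨hd.1, h⟩⟩, ⟨c, hc, hc.1, hc'⟩⟩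

namespace Crossing

theorem symm (h : Crossing Y F R) : Crossing Y R F where
  left := h.right
  right := h.left
  inter := Set.inter_comm F R ▸ h.inter
  inter_compl := Set.inter_comm (Y \ F) R ▸ h.compl_inter
  compl_inter := Set.inter_comm F (Y \ R) ▸ h.inter_compl
  compl_inter_compl := Set.inter_comm (Y \ F) (Y \ R) ▸ h.compl_inter_compl

theorem compl_left (h : Crossing Y F R) : Crossing Y (Y \ F) R where
  left := Set.sdiff_subset
  right := h.right
  inter := h.compl_inter
  inter_compl := h.compl_inter_compl
  compl_inter := (Set.sdiff_sdiff_cancel_left h.left).symm ▸ h.inter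
  compl_inter_compl := (Set.sdiff_sdiff_cancel_left h.left).symm ▸ h.inter_compl

theorem compl_right (h : Crossing Y F R) : Crossing Y F (Y \ R) :=
  h.symm.compl_left.symm

theorem sdiff_inter_nonempty (h : Crossing Y F R) : (Y \ (F ∩ R)).Nonempty :=
  h.inter_compl.mono fun _ he => ⟨he.2.1, fun heR => he.2.2 heR.2⟩

end Crossing

theorem boundary_inter_subset : boundary Y (F ∩ R) ⊆
    {x | (x ∈ boundary Y F ∧ x ∈ ends R) ∨ (x ∈ boundary Y R ∧ x ∈ ends F)} := by
  rintro x ⟨⟨e, he, hxe⟩, ⟨f, hf, hxf⟩⟩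
  by_cases hfF : f ∈ F
  · exact Or.inr ⟨⟨⟨e, he.2, hxe⟩, f, ⟨hf.1, fun h => hf.2 ⟨hfF, h⟩⟩, hxf⟩, e, he.1, hxe⟩
  · exact Or.inl ⟨⟨⟨e, he.1, hxe⟩, f, ⟨hf.1, hfF⟩, hxf⟩, e, he.2, hxe⟩

/-- An edge containing both boundary vertices has no further vertex. -/
theorem ne_singleton_of_mem_ends (huv : u ≠ v) (hF : boundary Y F = {u, v}) (hxF : x ∈ ends F)
    (hx : x ∉ boundary Y F) (e : Sym2 V) : F ≠ {e} := by
  rintro rfl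
  have mem_edge : ∀ {y : V}, y ∈ ends ({e} : Set (Sym2 V)) → y ∈ e := by
    rintro y ⟨_, rfl, hy⟩
    exact hy
  have hu : u ∈ boundary Y {e} := hF ▸ Set.mem_insert u {v}
  have hv : v ∈ boundary Y {e} := hF ▸ Set.mem_insert_of_mem u rfl
  obtain rfl := (Sym2.mem_and_mem_iff huv).1 ⟨mem_edge hu.1, mem_edge hv.1⟩
  rcases Sym2.mem_iff.1 (mem_edge hxF) with rfl | rfl
  exacts [hx hu, hx hv]

namespace IsTwoConnected

theorem exists_mem_boundary_ne (hY : IsTwoConnected Y) (hF : F ⊆ Y) (hne : F.Nonempty)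
    (hne' : (Y \ F).Nonempty) (c : V) : ∃ x ∈ boundary Y F, x ≠ c :=
  Set.not_subset.1 (hY F hF hne hne' c)

theorem boundary_eq_pair (hY : IsTwoConnected Y) (hF : F ⊆ Y) (hne : F.Nonempty)
    (hne' : (Y \ F).Nonempty) (h : boundary Y F ⊆ {u, v}) : boundary Y F = {u, v} := by
  obtain ⟨x, hx, hxv⟩ := hY.exists_mem_boundary_ne hF hne hne' v
  obtain ⟨y, hy, hyu⟩ := hY.exists_mem_boundary_ne hF hne hne' u
  obtain rfl := (h hx).resolve_right hxv
  obtain rfl := (h hy).resolve_left hyu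
  exact h.antisymm (Set.pair_subset hx hy)

theorem exists_ne_of_crossing (hY : IsTwoConnected Y) (h : Crossing Y F R) (c : V) :
    ∃ x, x ≠ c ∧ ((x ∈ boundary Y F ∧ x ∈ ends R) ∨ (x ∈ boundary Y R ∧ x ∈ ends F)) := by
  obtain ⟨x, hx, hxc⟩ := hY.exists_mem_boundary_ne (fun _ he => h.left he.1) h.inter
    h.sdiff_inter_nonempty c
  exact ⟨x, hxc, boundary_inter_subset hx⟩

theorem boundary_eq_of_mem (hY : IsTwoConnected Y) (h : Crossing Y F R)
    (hF : HasPairBoundary Y F) (hR : HasPairBoundary Y R) (huF : u ∈ boundary Y F)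
    (huR : u ∈ boundary Y R) : boundary Y R = boundary Y F := by
  obtain ⟨v, huv, hbF⟩ := hF.exists_eq_pair huF
  obtain ⟨w, huw, hbR⟩ := hR.exists_eq_pair huR
  by_contra hne
  have hvw : v ≠ w := by
    rintro rfl
    exact hne (hbR.trans hbF.symm)
  wlog hvR : v ∉ ends R generalizing R
  · have hv : v ∉ boundary Y R := by
      rw [hbR]
      exact not_or.2 ⟨huv.symm, hvw⟩
    rw [← boundary_sdiff hR.1] at huR hbR hne
    exact this h.compl_right hR.compl huR hbR hne
      ((notMem_ends_or_of_notMem_boundary hv).resolve_left hvR)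
  wlog hwF : w ∉ ends F generalizing F
  · have hw : w ∉ boundary Y F := by
      rw [hbF]
      exact not_or.2 ⟨huw.symm, hvw.symm⟩
    rw [← boundary_sdiff hF.1] at huF hbF hne
    exact this hF.compl huF hbF h.compl_left hne
      ((notMem_ends_or_of_notMem_boundary hw).resolve_left hwF)
  obtain ⟨x, hxu, ⟨hx, hx'⟩ | ⟨hx, hx'⟩⟩ := hY.exists_ne_of_crossing h u
  · obtain rfl := (hbF.subset hx).resolve_left hxu
    exact hvR hx'
  · obtain rfl := (hbR.subset hx).resolve_left hxu
    exact hwF hx'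

theorem boundary_subset_of_disjoint (hY : IsTwoConnected Y) (h : Crossing Y F R)
    (hR : HasPairBoundary Y R) (hdisj : Disjoint (boundary Y F) (ends R)) :
    boundary Y R ⊆ boundary Y F := by
  intro w hw
  obtain ⟨z, -, hbR⟩ := hR.exists_eq_pair hw
  have mem_ends : ∀ {F}, Crossing Y F R → Disjoint (boundary Y F) (ends R) → w ∈ ends F := by
    intro F h hdisj
    obtain ⟨x, hxz, ⟨hxF, hxR⟩ | ⟨hxR, hxF⟩⟩ := hY.exists_ne_of_crossing h z
    · exact absurd hxR (Set.disjoint_left.1 hdisj hxF)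
    · obtain rfl := (hbR.subset hxR).resolve_right hxz
      exact hxF
  exact ⟨mem_ends h hdisj, mem_ends h.compl_left (by rwa [boundary_sdiff h.left])⟩

theorem divides_of_disjoint (hY : IsTwoConnected Y) (h : Crossing Y F R)
    (hR : HasPairBoundary Y R) (hF : boundary Y F = {u, v})
    (hdisj : Disjoint (boundary Y F) (boundary Y R)) : Divides Y R u v := by
  have not_disjoint_ends : ∀ {R}, Crossing Y F R → HasPairBoundary Y R →
      Disjoint (boundary Y F) (boundary Y R) → ¬ (u ∉ ends R ∧ v ∉ ends R) := by
    rintro R h hR hdisj ⟨hu, hv⟩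
    have hsub := hY.boundary_subset_of_disjoint h hR <| by
      rw [hF, Set.disjoint_left]
      rintro x (rfl | rfl)
      exacts [hu, hv]
    obtain ⟨-, w, z, -, hbR⟩ := hR
    have hw : w ∈ boundary Y R := hbR ▸ Set.mem_insert w {z}
    exact Set.disjoint_left.1 hdisj (hsub hw) hw
  have hR_ends := not_disjoint_ends h hR hdisj
  have hRc_ends := not_disjoint_ends h.compl_right hR.compl (by rwa [boundary_sdiff hR.1])
  rw [hF, Set.disjoint_left] at hdisj
  have hu := notMem_ends_or_of_notMem_boundary (hdisj (Set.mem_insert u {v}))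
  have hv := notMem_ends_or_of_notMem_boundary (hdisj (Set.mem_insert_of_mem u rfl))
  rw [Divides]
  tauto

theorem boundary_eq_or_divides (hY : IsTwoConnected Y) (h : Crossing Y F R) (huv : u ≠ v)
    (hF : boundary Y F = {u, v}) (hR : HasPairBoundary Y R) : boundary Y R = {u, v} ∨
      ∃ w z, boundary Y R = {w, z} ∧ w ∉ ends (Y \ F) ∧ z ∉ ends F ∧ Divides Y R u v := by
  have hF' : HasPairBoundary Y F := ⟨h.left, u, v, huv, hF⟩
  by_cases hdisj : Disjoint (boundary Y F) (boundary Y R)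
  · right
    obtain ⟨-, w, z, -, hbR⟩ := id hR
    have huv_div := hY.divides_of_disjoint h hR hF hdisj
    rcases hY.divides_of_disjoint h.symm hF' hbR hdisj.symm with ⟨hw, hz⟩ | ⟨hw, hz⟩
    · exact ⟨w, z, hbR, hw, hz, huv_div⟩
    · exact ⟨z, w, by rw [hbR, Set.pair_comm], hz, hw, huv_div⟩
  · obtain ⟨x, hxF, hxR⟩ := Set.not_disjoint_iff.1 hdisj
    exact Or.inl ((hY.boundary_eq_of_mem h hF' hR hxF hxR).trans hF)

theorem not_divides (hY : IsTwoConnected Y) (hS : S ⊆ Y) (hbS : boundary Y S = {u, v})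
    (hbR : boundary Y R = {w, z}) (hw : w ∉ ends S) (hz : z ∉ ends S) : ¬ Divides Y R u v := by
  intro hdiv
  wlog h : u ∉ ends (Y \ R) ∧ v ∉ ends R generalizing u v
  · exact this (hbS.trans (Set.pair_comm u v)) hdiv.symm (hdiv.resolve_left h).symm
  obtain ⟨hu, hv⟩ := h
  obtain ⟨e, he, hue⟩ := (hbS.superset (Set.mem_insert u {v})).1
  obtain ⟨f, hf, hvf⟩ := (hbS.superset (Set.mem_insert_of_mem u rfl)).1
  have heR : e ∈ R := by_contra fun h => hu ⟨e, ⟨hS he, h⟩, hue⟩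
  obtain ⟨x, hx, hxu⟩ := hY.exists_mem_boundary_ne (F := S ∩ R) (fun _ h => hS h.1) ⟨e, he, heR⟩
    ⟨f, hS hf, fun h => hv ⟨f, h.2, hvf⟩⟩ u
  rcases boundary_inter_subset hx with ⟨hxS, hxR⟩ | ⟨hxR, hxS⟩
  · obtain rfl := (hbS.subset hxS).resolve_left hxu
    exact hv hxR
  · rcases hbR.subset hxR with rfl | rfl
    exacts [hw hxS, hz hxS]

theorem not_divides_of_crossing (hY : IsTwoConnected Y) (h : Crossing Y F R)
    (hF : boundary Y F = {u, v}) (hR : boundary Y R = {u, v}) (hS : boundary Y S = {w, z})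
    (hw : w ∉ ends (Y \ F)) (hz : z ∉ boundary Y F) : ¬ Divides Y S u v := by
  wlog hzR : z ∉ ends R generalizing R
  · have hzbR : z ∉ boundary Y R := hR.trans hF.symm ▸ hz
    exact this h.compl_right ((boundary_sdiff h.right).trans hR)
      ((notMem_ends_or_of_notMem_boundary hzbR).resolve_left hzR)
  have hcorner : boundary Y ((Y \ F) ∩ R) = {u, v} := by
    refine hY.boundary_eq_pair (fun _ he => he.1.1) h.compl_inter
      h.compl_left.sdiff_inter_nonempty fun y hy => ?_
    rcases boundary_inter_subset hy with hy | hy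
    · exact hF ▸ boundary_sdiff h.left ▸ hy.1
    · exact hR ▸ hy.1
  exact hY.not_divides (fun _ he => he.1.1) hcorner hS
    (fun h => hw (ends_mono Set.inter_subset_left h))
    (fun h => hzR (ends_mono Set.inter_subset_right h))

theorem isUncrossed_componentEdges (hY : IsTwoConnected Y) (h : Crossing Y F R) (huv : u ≠ v)
    (hF : boundary Y F = {u, v}) (hR : boundary Y R = {u, v}) (hxF : x ∈ ends F)
    (hx : x ∉ ({u, v} : Set V)) : IsUncrossed Y (componentEdges Y {u, v} x) := by
  have hsub : componentEdges Y {u, v} x ⊆ F :=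
    componentEdges_subset_of_boundary_subset hF.subset hxF
  obtain ⟨e, he, hxe⟩ := hxF
  have heC : e ∈ componentEdges Y {u, v} x := mem_componentEdges hx (h.left he) hxe
  have hbC : boundary Y (componentEdges Y {u, v} x) = {u, v} :=
    hY.boundary_eq_pair componentEdges_subset ⟨e, heC⟩
      (h.compl_inter.mono fun _ hf => ⟨hf.1.1, fun hfC => hf.1.2 (hsub hfC)⟩)
      boundary_componentEdges_subset
  refine ⟨⟨componentEdges_subset, u, v, huv, hbC⟩, fun S hS => by_contra fun hnested => ?_⟩
  have hcross := crossing_of_not_nested componentEdges_subset hS.1 hnested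
  rcases hY.boundary_eq_or_divides hcross huv hbC hS with hbS | ⟨w, z, hbS, hw, hz, hdiv⟩
  · by_cases heS : e ∈ S
    · obtain ⟨f, hf⟩ := hcross.inter_compl
      exact hf.2.2 (componentEdges_subset_of_boundary_subset hbS.subset ⟨e, heS, hxe⟩ hf.1)
    · obtain ⟨f, hf⟩ := hcross.inter
      rw [← boundary_sdiff hS.1] at hbS
      exact (componentEdges_subset_of_boundary_subset hbS.subset
        ⟨e, ⟨h.left he, heS⟩, hxe⟩ hf.1).2 hf.2
  · refine hY.not_divides_of_crossing h hF hR hbS (fun hwF => hw ?_) (fun hzF => hz ?_) hdiv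
    · exact ends_mono (Set.sdiff_subset_sdiff_right hsub) hwF
    · exact (hbC.superset (hF.subset hzF)).1

end IsTwoConnected

end Crossing

end TutteTree

/-! ### Torsos -/

namespace TutteTree

section Torsos
open SimpleGraph

variable {V W : Type*} {X : SimpleGraph V} {𝒜 : Set (Set (Sym2 V))} {Z : SimpleGraph W} {f : W → V}
  {A F M R Y : Set (Sym2 V)} {S C D : Set W} {a b c d u v w z : W} {x y : V}

/-- `Z` is the torso of a node of the structure tree: `𝒜` consists of the canonical sets that start
at the node, and `f` identifies `Z` with the part of `X` outside the members of `𝒜`, with an edge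
added for each boundary pair of a member. -/
structure IsTorso (X : SimpleGraph V) (𝒜 : Set (Set (Sym2 V))) (Z : SimpleGraph W) (f : W → V) :
    Prop where
  mem_canonicalSplits : ∀ {A}, A ∈ 𝒜 → A ∈ canonicalSplits X
  subset_sdiff : ∀ {A B}, A ∈ 𝒜 → B ∈ 𝒜 → A ≠ B → A ⊆ X.edgeSet \ B
  exists_subset : ∀ {B}, B ∈ canonicalSplits X → ∃ A ∈ 𝒜, B ⊆ A ∨ X.edgeSet \ B ⊆ A
  injective : Function.Injective f
  mem_range : ∀ x, x ∈ Set.range f ↔ ∀ A ∈ 𝒜, x ∈ ends (X.edgeSet \ A)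
  adj_iff : ∀ a b, Z.Adj a b ↔ a ≠ b ∧ ((s(f a, f b) ∈ X.edgeSet ∧ ∀ A ∈ 𝒜, s(f a, f b) ∉ A) ∨
    ∃ A ∈ 𝒜, boundary X.edgeSet A = {f a, f b})

theorem mem_ends_edgeSet [Nontrivial V] (hX : X.Connected) (x : V) : x ∈ ends X.edgeSet :=
  ends_edgeSet hX ▸ Set.mem_univ x

theorem mem_ends_of_notMem_ends_sdiff (hx : x ∈ ends Y) (h : x ∉ ends (Y \ F)) : x ∈ ends F :=
  by_contra fun h' => h (mem_ends_sdiff_of_notMem hx h')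

theorem IsBlock.isTwoConnected (hX : X.Connected) (hY : IsBlock X Y) : IsTwoConnected Y :=
  fun _ hF hne hne' c => hY.not_boundary_subset hX hF hne hne' c

theorem exists_isUncrossed_of_mem_canonicalSplits (hX : X.Connected)
    (hlf : ∀ v, (X.neighborSet v).Finite) (hA : A ∈ canonicalSplits X) (hxy : x ≠ y)
    (h : boundary X.edgeSet A = {x, y}) :
    ∃ Y F W, IsBlock X Y ∧ IsUncrossed Y F ∧ A = extend X Y F W ∧ boundary Y F = {x, y} := by
  rcases hA with hA | ⟨Y, F, hY, hF, -, hA⟩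
  · obtain ⟨c, hc⟩ := hA.1.2
    rw [h] at hc
    exact absurd ((hc.subset (Set.mem_insert x {y})).trans
      (hc.subset (Set.mem_insert_of_mem x rfl)).symm) hxy
  · obtain ⟨W, hW⟩ := hA.exists_eq
    exact ⟨Y, F, W, hY, hF, hW, hA.boundary_eq hX hlf hY hF.1 ▸ h⟩

theorem isUncrossed_inter_of_mem_canonicalSplits (hX : X.Connected) (hY : IsBlock X Y)
    (hA : A ∈ canonicalSplits X) (hYA : ¬ Y ⊆ A) (hYA' : ¬ Y ⊆ X.edgeSet \ A) :
    IsUncrossed Y (A ∩ Y) := by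
  rcases hA with hA | ⟨Y', F', hY', hF', -, hB⟩
  · exact absurd (hY.subset_or hA.1) (not_or.2 ⟨hYA, hYA'⟩)
  · obtain ⟨W, rfl⟩ := hB.exists_eq
    by_cases hne : Y = Y'
    · subst hne
      rwa [extend_inter hY hF'.1.1]
    · obtain ⟨M, hM, hYM, hYM'⟩ := hY.exists_hasPointBoundary_of_ne hY' hne
      rcases hM.subset_extend_or (W := W) hX hY' hF'.1.1 hYM' with h | h
      · exact absurd (hYM.trans h) hYA
      · exact absurd (hYM.trans h) hYA'

theorem boundary_extend_empty_subset (hX : X.Connected) (hY : IsBlock X Y) (p : V) :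
    boundary X.edgeSet (extend X Y ∅ {p}) ⊆ {p} := by
  rintro x ⟨⟨e, he, hxe⟩, ⟨e', he', hxe'⟩⟩
  have heY : e ∉ Y := fun h => (mem_extend_of_mem hY h).1 he
  by_cases hxY : x ∈ ends Y
  · exact (mem_extend_of_reachable hY Y.empty_subset he.1 heY hxe hxY .rfl).1 he
  · obtain ⟨w, hw, hxw⟩ := hY.exists_reachable hX x
    have heY' : e' ∉ Y := fun h => hxY ⟨e', h, hxe'⟩
    have hwp := (mem_extend_of_reachable hY Y.empty_subset he.1 heY hxe hw hxw).1 he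
    exact absurd ((mem_extend_of_reachable hY Y.empty_subset he'.1 heY' hxe' hw hxw).2 hwp) he'.2

namespace IsTorso

theorem boundary_subset_range (T : IsTorso X 𝒜 Z f) (hA : A ∈ 𝒜) :
    boundary X.edgeSet A ⊆ Set.range f := by
  refine fun x hx => (T.mem_range x).2 fun B hB => ?_
  by_cases hAB : A = B
  · exact hAB ▸ hx.2
  · exact ends_mono (T.subset_sdiff hA hB hAB) hx.1

theorem mem_boundary (T : IsTorso X 𝒜 Z f) (hA : A ∈ 𝒜) (ha : f a ∈ ends A) :
    f a ∈ boundary X.edgeSet A :=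
  ⟨ha, (T.mem_range _).1 ⟨a, rfl⟩ A hA⟩

theorem adj_of_mem_boundary (hX : X.Connected) (hlf : ∀ v, (X.neighborSet v).Finite)
    (T : IsTorso X 𝒜 Z f) (hA : A ∈ 𝒜) (hab : a ≠ b) (ha : f a ∈ boundary X.edgeSet A)
    (hb : f b ∈ boundary X.edgeSet A) : Z.Adj a b := by
  refine (T.adj_iff a b).2 ⟨hab, Or.inr ⟨A, hA, ?_⟩⟩
  have hne := T.injective.ne hab
  have hAX := T.mem_canonicalSplits hA
  rcases boundary_of_mem_canonicalSplits hX hlf hAX with ⟨x, hx⟩ | hpair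
  · exact absurd ((hx.subset ha).trans (hx.subset hb).symm) hne
  · obtain ⟨y, -, hy⟩ := HasPairBoundary.exists_eq_pair
      ⟨subset_of_mem_canonicalSplits hAX, hpair⟩ ha
    obtain hby : f b = y := (hy.subset hb).resolve_left hne.symm
    rw [hy, hby]

theorem mem_ends_of_boundary_subset_singleton [Nontrivial V] (hX : X.Connected)
    (T : IsTorso X 𝒜 Z f) (hM : M ⊆ X.edgeSet) (hbd : boundary X.edgeSet M ⊆ {x})
    (ha : f a ∉ ends (X.edgeSet \ M)) (b : W) : f b ∈ ends M := by
  by_contra hb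
  have haM := mem_ends_of_notMem_ends_sdiff (mem_ends_edgeSet hX (f a)) ha
  have hbM := mem_ends_sdiff_of_notMem (mem_ends_edgeSet hX (f b)) hb
  have hM' : HasPointBoundary X.edgeSet M := by
    obtain ⟨e, he, -⟩ := haM
    obtain ⟨e', he', -⟩ := hbM
    exact ⟨hM, x, boundary_eq_singleton_of_subset hX ⟨e, he⟩ ⟨e', he'⟩ hbd⟩
  obtain ⟨L, hL, hnested, hLM, haL, haL'⟩ := hM'.exists_nested hX haM fun h => ha h.2
  obtain ⟨A, hA, hLA | hLA⟩ := T.exists_subset (Or.inl ⟨hL, hnested⟩)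
  · exact haL' (ends_mono (Set.sdiff_subset_sdiff_right hLA)
      (T.mem_boundary hA (ends_mono hLA haL)).2)
  · have hbA : f b ∈ ends A :=
      ends_mono ((Set.sdiff_subset_sdiff_right hLM).trans hLA) hbM
    exact hb (ends_mono ((Set.sdiff_subset_comm.1 hLA).trans hLM) (T.mem_boundary hA hbA).2)

/-- For a side `C` of a separation of the torso, the corresponding side of a separation of `X`. -/
def sideEdges (X : SimpleGraph V) (𝒜 : Set (Set (Sym2 V))) (f : W → V) (C : Set W) :
    Set (Sym2 V) :=
  {e | e ∈ X.edgeSet ∧ ((∃ A ∈ 𝒜, e ∈ A ∧ ∃ c ∈ C, f c ∈ boundary X.edgeSet A) ∨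
    ((∀ A ∈ 𝒜, e ∉ A) ∧ ∃ c ∈ C, f c ∈ e))}

theorem sideEdges_subset : sideEdges X 𝒜 f C ⊆ X.edgeSet := fun _ h => h.1

theorem subset_sideEdges_or (T : IsTorso X 𝒜 Z f) (C : Set W) (hA : A ∈ 𝒜) :
    A ⊆ sideEdges X 𝒜 f C ∨ A ⊆ X.edgeSet \ sideEdges X 𝒜 f C := by
  have hAX := subset_of_mem_canonicalSplits (T.mem_canonicalSplits hA)
  by_cases hC : ∃ c ∈ C, f c ∈ boundary X.edgeSet A
  · exact Or.inl fun e he => ⟨hAX he, Or.inl ⟨A, hA, he, hC⟩⟩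
  · refine Or.inr fun e he => ⟨hAX he, ?_⟩
    rintro ⟨-, ⟨B, hB, heB, hCB⟩ | ⟨hno, -⟩⟩
    · by_cases hAB : A = B
      · exact hC (hAB ▸ hCB)
      · exact (T.subset_sdiff hA hB hAB he).2 heB
    · exact hno A hA he

theorem notMem_ends_sdiff_sideEdges (T : IsTorso X 𝒜 Z f) (hc : c ∈ C) :
    f c ∉ ends (X.edgeSet \ sideEdges X 𝒜 f C) := by
  rintro ⟨e, he, hce⟩
  refine he.2 ⟨he.1, ?_⟩
  by_cases hA : ∃ A ∈ 𝒜, e ∈ A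
  · obtain ⟨A, hA, heA⟩ := hA
    exact Or.inl ⟨A, hA, heA, c, hc, T.mem_boundary hA ⟨e, heA, hce⟩⟩
  · push Not at hA
    exact Or.inr ⟨hA, c, hc, hce⟩

theorem notMem_ends_sideEdges (hX : X.Connected) (hlf : ∀ v, (X.neighborSet v).Finite)
    (T : IsTorso X 𝒜 Z f) (h : Separates Z S C D) (hd : d ∈ D) :
    f d ∉ ends (sideEdges X 𝒜 f C) := by
  have ne_of_mem : ∀ {c}, c ∈ C → c ≠ d := fun hc hcd => h.disj hc (hcd ▸ hd)
  rintro ⟨e, ⟨heX, ⟨A, hA, heA, c, hc, hcA⟩ | ⟨hno, c, hc, hce⟩⟩, hde⟩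
  · exact h.not_adj hc hd <| T.adj_of_mem_boundary hX hlf hA (ne_of_mem hc) hcA
      (T.mem_boundary hA ⟨e, heA, hde⟩)
  · obtain rfl := (Sym2.mem_and_mem_iff (T.injective.ne (ne_of_mem hc))).1 ⟨hce, hde⟩
    exact h.not_adj hc hd ((T.adj_iff c d).2 ⟨ne_of_mem hc, Or.inl ⟨heX, hno⟩⟩)

theorem boundary_sideEdges_subset (hX : X.Connected) (hlf : ∀ v, (X.neighborSet v).Finite)
    (T : IsTorso X 𝒜 Z f) (h : Separates Z S C D) :
    boundary X.edgeSet (sideEdges X 𝒜 f C) ⊆ f '' S := by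
  intro x hx
  by_cases hxr : x ∈ Set.range f
  · obtain ⟨w, rfl⟩ := hxr
    rcases h.cover w with hw | hw | hw
    · exact ⟨w, hw, rfl⟩
    · exact absurd hx.2 (T.notMem_ends_sdiff_sideEdges hw)
    · exact absurd hx.1 (T.notMem_ends_sideEdges hX hlf h hw)
  · rw [T.mem_range] at hxr
    push Not at hxr
    obtain ⟨A, hA, hxA⟩ := hxr
    have mem_of_mem : ∀ e ∈ X.edgeSet, x ∈ e → e ∈ A := fun e he hxe =>
      by_contra fun h => hxA ⟨e, ⟨he, h⟩, hxe⟩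
    obtain ⟨⟨e, he, hxe⟩, ⟨e', he', hxe'⟩⟩ := hx
    rcases T.subset_sideEdges_or C hA with hAC | hAC
    · exact absurd (hAC (mem_of_mem e' he'.1 hxe')) he'.2
    · exact absurd he (hAC (mem_of_mem e he.1 hxe)).2

theorem not_subset_singleton [Nontrivial V] (hX : X.Connected)
    (hlf : ∀ v, (X.neighborSet v).Finite) (T : IsTorso X 𝒜 Z f) (h : Separates Z S C D) (s : W) :
    ¬ S ⊆ {s} := by
  intro hS
  obtain ⟨c, hc⟩ := h.left_nonempty
  obtain ⟨d, hd⟩ := h.right_nonempty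
  have hbd : boundary X.edgeSet (sideEdges X 𝒜 f C) ⊆ {f s} :=
    (T.boundary_sideEdges_subset hX hlf h).trans (Set.image_singleton ▸ Set.image_mono hS)
  exact T.notMem_ends_sideEdges hX hlf h hd <| T.mem_ends_of_boundary_subset_singleton hX
    sideEdges_subset hbd (T.notMem_ends_sdiff_sideEdges hc) d

theorem exists_adj [Nontrivial V] [Nontrivial W] (hX : X.Connected)
    (hlf : ∀ v, (X.neighborSet v).Finite) (T : IsTorso X 𝒜 Z f) : ∃ a b, Z.Adj a b := by
  by_contra! hno
  obtain ⟨a, b, hab⟩ := exists_pair_ne W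
  have h : Separates Z ∅ {a} ({a} ∪ ∅)ᶜ := by
    refine separates_compl ⟨a, rfl⟩ ⟨b, ?_⟩ (fun x hx => hx.elim)
      fun x _ y hxy => absurd hxy (hno x y)
    simpa using hab.symm
  exact T.not_subset_singleton hX hlf h a (Set.empty_subset _)

theorem exists_block_of_adj (hX : X.Connected) (hlf : ∀ v, (X.neighborSet v).Finite)
    (T : IsTorso X 𝒜 Z f) (hab : Z.Adj a b) :
    ∃ Y, IsBlock X Y ∧ f a ∈ ends Y ∧ f b ∈ ends Y := by
  obtain ⟨hne, ⟨he, -⟩ | ⟨A, hA, hbd⟩⟩ := (T.adj_iff a b).1 hab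
  · obtain ⟨Y, hY, heY⟩ := IsBlock.exists_mem he
    exact ⟨Y, hY, ⟨_, heY, Sym2.mem_mk_left _ _⟩, ⟨_, heY, Sym2.mem_mk_right _ _⟩⟩
  · obtain ⟨Y, F, -, hY, hF, -, hbF⟩ := exists_isUncrossed_of_mem_canonicalSplits hX hlf
      (T.mem_canonicalSplits hA) (T.injective.ne hne) hbd
    have hFY : boundary Y F ⊆ ends Y := fun x hx => ends_mono hF.1.1 hx.1
    exact ⟨Y, hY, hFY (hbF ▸ Set.mem_insert _ _), hFY (hbF ▸ Set.mem_insert_of_mem _ rfl)⟩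

theorem mem_ends_of_isBlock [Nontrivial V] (hX : X.Connected) (T : IsTorso X 𝒜 Z f)
    (hY : IsBlock X Y) (hab : a ≠ b) (ha : f a ∈ ends Y) (hb : f b ∈ ends Y) (w : W) :
    f w ∈ ends Y := by
  by_contra hw
  obtain ⟨p, hp, hwp⟩ := hY.exists_reachable hX (f w)
  obtain ⟨d, hd, hdp⟩ : ∃ d, f d ∈ ends Y ∧ f d ≠ p := by
    by_cases hap : f a = p
    · exact ⟨b, hb, fun hbp => hab (T.injective (hap.trans hbp.symm))⟩
    · exact ⟨a, ha, hap⟩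
  have hw' : f w ∉ ends (X.edgeSet \ extend X Y ∅ {p}) := by
    rintro ⟨e, he, hwe⟩
    have heY : e ∉ Y := fun h => hw ⟨e, h, hwe⟩
    exact he.2 ((mem_extend_of_reachable hY Y.empty_subset he.1 heY hwe hp hwp).2 rfl)
  obtain ⟨e, he, hde⟩ := T.mem_ends_of_boundary_subset_singleton hX extend_subset
    (boundary_extend_empty_subset hX hY p) hw' d
  have heY : e ∉ Y := fun h => (mem_extend_of_mem hY h).1 he
  exact hdp ((mem_extend_of_reachable hY Y.empty_subset he.1 heY hde hd .rfl).1 he)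

theorem exists_block [Nontrivial V] [Nontrivial W] (hX : X.Connected)
    (hlf : ∀ v, (X.neighborSet v).Finite) (T : IsTorso X 𝒜 Z f) :
    ∃ Y, IsBlock X Y ∧ ∀ w, f w ∈ ends Y := by
  obtain ⟨a, b, hab⟩ := T.exists_adj hX hlf
  obtain ⟨Y, hY, ha, hb⟩ := T.exists_block_of_adj hX hlf hab
  exact ⟨Y, hY, T.mem_ends_of_isBlock hX hY hab.ne ha hb⟩

theorem mem_ends_of_isUncrossed (hX : X.Connected) (hlf : ∀ v, (X.neighborSet v).Finite)
    (T : IsTorso X 𝒜 Z f) (hY : IsBlock X Y) (hF : IsUncrossed Y F) (hZY : ∀ w, f w ∈ ends Y)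
    (ha : f a ∉ ends (Y \ F)) (b : W) : f b ∈ ends F := by
  by_contra hb
  have haF := mem_ends_of_notMem_ends_sdiff (hZY a) ha
  have hbF := mem_ends_sdiff_of_notMem (hZY b) hb
  obtain ⟨u, v, huv, hbd⟩ := hF.1.2
  have hbd' : boundary Y (Y \ F) = {u, v} := (boundary_sdiff hF.1.1).trans hbd
  have hnt : IsNontrivialSplit Y F :=
    ⟨ne_singleton_of_mem_ends huv hbd haF fun h => ha h.2,
      ne_singleton_of_mem_ends huv hbd' hbF fun h => hb (boundary_sdiff hF.1.1 ▸ h).1⟩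
  have hB : IsCanonicalExtension X Y F (extend X Y F (heavy Y F)) := Or.inl rfl
  set B := extend X Y F (heavy Y F)
  have hbB : boundary X.edgeSet B = boundary Y F := hB.boundary_eq hX hlf hY hF.1
  have haB : f a ∈ ends B := ends_mono (subset_extend hY hF.1.1) haF
  have hFB : Y \ F ⊆ X.edgeSet \ B := fun e he =>
    ⟨hY.subset he.1, fun h => he.2 ((mem_extend_of_mem hY he.1).1 h)⟩
  have hbB' : f b ∈ ends (X.edgeSet \ B) := ends_mono hFB hbF
  obtain ⟨A, hA, hBA | hBA⟩ := T.exists_subset (Or.inr ⟨Y, F, hY, hF, hnt, hB⟩)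
  · have haA := T.mem_boundary hA (ends_mono hBA haB)
    exact ha (hbB.subset ⟨haB, ends_mono (Set.sdiff_subset_sdiff_right hBA) haA.2⟩).2
  · have hbA := T.mem_boundary hA (ends_mono hBA hbB')
    exact hb (hbB.subset ⟨ends_mono (Set.sdiff_subset_comm.1 hBA) hbA.2, hbB'⟩).1

theorem mem_range_of_crossing (hX : X.Connected) (T : IsTorso X 𝒜 Z f) (hY : IsBlock X Y)
    (hM : ∀ A ∈ 𝒜, A ⊆ M ∨ A ⊆ X.edgeSet \ M) (hR : HasPairBoundary Y R)
    (hc : Crossing Y (M ∩ Y) R) (hx : x ∈ boundary Y R) : x ∈ Set.range f := by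
  rw [T.mem_range]
  by_contra! hno
  obtain ⟨A, hA, hxA⟩ := hno
  have mem_of_mem : ∀ e ∈ Y, x ∈ e → e ∈ A := fun e he hxe =>
    by_contra fun h => hxA ⟨e, ⟨hY.subset he, h⟩, hxe⟩
  have not_subset : ∀ S, (M ∩ Y ∩ S).Nonempty → ((Y \ (M ∩ Y)) ∩ S).Nonempty → ¬ S ⊆ A := by
    rintro S ⟨e, he⟩ ⟨e', he'⟩ hS
    rcases hM A hA with h | h
    · exact he'.1.2 ⟨h (hS he'.2), he'.1.1⟩
    · exact (h (hS he.2)).2 he.1.1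
  have hYA : ¬ Y ⊆ A := not_subset Y (hc.inter.mono fun _ he => ⟨he.1, he.1.2⟩)
    (hc.compl_inter.mono fun _ he => ⟨he.1, he.1.1⟩)
  have hYA' : ¬ Y ⊆ X.edgeSet \ A := fun h => hxA (ends_mono (hR.1.trans h) hx.1)
  have hU := isUncrossed_inter_of_mem_canonicalSplits hX hY (T.mem_canonicalSplits hA) hYA hYA'
  obtain ⟨⟨e, he, hxe⟩, ⟨e', he', hxe'⟩⟩ := hx
  rcases hU.2 R hR with h | h | h | h
  · exact he'.2 (h ⟨mem_of_mem e' he'.1 hxe', he'.1⟩)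
  · exact (h ⟨mem_of_mem e (hR.1 he) hxe, hR.1 he⟩).2 he
  · exact not_subset (Y \ R) hc.inter_compl hc.compl_inter_compl
      fun g hg => (Set.sdiff_subset_comm.1 h hg).1
  · exact not_subset R hc.inter hc.compl_inter
      fun g hg => by_contra fun hgA => (h ⟨hR.1 hg, fun h' => hgA h'.1⟩).2 hg

theorem not_adj_of_hasPairBoundary (hX : X.Connected) (hlf : ∀ v, (X.neighborSet v).Finite)
    (T : IsTorso X 𝒜 Z f) (hY : IsBlock X Y) (hZY : ∀ w, f w ∈ ends Y) (hR : HasPairBoundary Y R)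
    (ha : f a ∉ ends (Y \ R)) (hb : f b ∉ ends R) : ¬ Z.Adj a b := by
  intro hab
  obtain ⟨hne, ⟨he, -⟩ | ⟨A, hA, hbd⟩⟩ := (T.adj_iff a b).1 hab
  · have heY : s(f a, f b) ∈ Y := hY.mem_of_adj (hZY a) (hZY b) he
    by_cases heR : s(f a, f b) ∈ R
    · exact hb ⟨_, heR, Sym2.mem_mk_right _ _⟩
    · exact ha ⟨_, ⟨heY, heR⟩, Sym2.mem_mk_left _ _⟩
  · obtain ⟨Y', F, -, hY', hF, -, hbF⟩ := exists_isUncrossed_of_mem_canonicalSplits hX hlf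
      (T.mem_canonicalSplits hA) (T.injective.ne hne) hbd
    have haF : f a ∈ boundary Y' F := hbF ▸ Set.mem_insert _ _
    have hbF : f b ∈ boundary Y' F := hbF ▸ Set.mem_insert_of_mem _ rfl
    obtain rfl := hY.eq_of_mem_ends hY' (T.injective.ne hne) (hZY a) (hZY b)
      (ends_mono hF.1.1 haF.1) (ends_mono hF.1.1 hbF.1)
    rcases hF.2 R hR with h | h | h | h
    · exact hb (ends_mono h hbF.1)
    · exact ha (ends_mono h haF.1)
    · exact hb (ends_mono h hbF.2)
    · exact ha (ends_mono h haF.2)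

theorem separates_of_hasPairBoundary (hX : X.Connected) (hlf : ∀ v, (X.neighborSet v).Finite)
    (T : IsTorso X 𝒜 Z f) (hY : IsBlock X Y) (hZY : ∀ w, f w ∈ ends Y) (hR : HasPairBoundary Y R)
    (hwz : boundary Y R = {f w, f z}) (hu : f u ∉ ends (Y \ R)) (hv : f v ∉ ends R) :
    Separates Z {w, z} {x | f x ∉ ends (Y \ R)} {x | f x ∉ ends R} := by
  have mem_iff : ∀ {x}, x ∈ ({w, z} : Set W) ↔ f x ∈ boundary Y R := fun {x} => by
    rw [hwz, ← Set.image_pair, T.injective.mem_set_image]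
  refine ⟨fun x => ?_, fun hx h => h (mem_iff.1 hx).2, fun hx h => h (mem_iff.1 hx).1,
    fun h h' => h (mem_ends_sdiff_of_notMem (hZY _) h'),
    fun hx hy => T.not_adj_of_hasPairBoundary hX hlf hY hZY hR hx hy, ⟨u, hu⟩, ⟨v, hv⟩⟩
  rw [mem_iff]
  by_cases hx : f x ∈ boundary Y R
  · exact Or.inl hx
  · exact Or.inr (notMem_ends_or_of_notMem_boundary hx).symm

theorem exists_separates_of_divides (hX : X.Connected) (hlf : ∀ v, (X.neighborSet v).Finite)
    (T : IsTorso X 𝒜 Z f) (hY : IsBlock X Y) (hZY : ∀ w, f w ∈ ends Y) (hR : HasPairBoundary Y R)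
    (hwz : boundary Y R = {f w, f z}) (h : Divides Y R (f u) (f v)) :
    ∃ Cu Cv, Separates Z {w, z} Cu Cv ∧ u ∈ Cu ∧ v ∈ Cv := by
  rcases h with ⟨hu, hv⟩ | ⟨hu, hv⟩
  · exact ⟨_, _, T.separates_of_hasPairBoundary hX hlf hY hZY hR hwz hu hv, hu, hv⟩
  · exact ⟨_, _, (T.separates_of_hasPairBoundary hX hlf hY hZY hR hwz hv hu).symm, hu, hv⟩

theorem exists_crossing (hX : X.Connected) (hlf : ∀ v, (X.neighborSet v).Finite)
    (T : IsTorso X 𝒜 Z f) (hY : IsBlock X Y) (hZY : ∀ w, f w ∈ ends Y) (hF : F ⊆ Y) (huv : u ≠ v)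
    (hbd : boundary Y F = {f u, f v}) (hc : f c ∉ ends (Y \ F)) (hd : f d ∉ ends F) :
    ∃ R, HasPairBoundary Y R ∧ Crossing Y F R ∧ ∃ x y, boundary Y R = {x, y} ∧
      x ∉ ends (Y \ F) ∧ y ∉ ends F ∧ Divides Y R (f u) (f v) := by
  have hY2 := hY.isTwoConnected hX
  have hfuv := T.injective.ne huv
  have not_isUncrossed : ¬ IsUncrossed Y F := fun hU =>
    hd (T.mem_ends_of_isUncrossed hX hlf hY hU hZY hc d)
  obtain ⟨R, hR, hnested⟩ : ∃ R, HasPairBoundary Y R ∧ ¬ Nested Y F R := by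
    by_contra! h
    exact not_isUncrossed ⟨⟨hF, f u, f v, hfuv, hbd⟩, h⟩
  have hcross := crossing_of_not_nested hF hR.1 hnested
  refine ⟨R, hR, hcross, (hY2.boundary_eq_or_divides hcross hfuv hbd hR).resolve_left fun hbR => ?_⟩
  have hcuv : f c ∉ ({f u, f v} : Set V) := fun h => hc (hbd.superset h).2
  have hcF := mem_ends_of_notMem_ends_sdiff (hZY c) hc
  have hU := hY2.isUncrossed_componentEdges hcross hfuv hbd hbR hcF hcuv
  have hc' : f c ∉ ends (Y \ componentEdges Y {f u, f v} (f c)) := by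
    rintro ⟨e, he, hce⟩
    exact he.2 (mem_componentEdges hcuv he.1 hce)
  exact hd (ends_mono (componentEdges_subset_of_boundary_subset hbd.subset hcF)
    (T.mem_ends_of_isUncrossed hX hlf hY hU hZY hc' d))

theorem isTotallyCrossed [Nontrivial V] (hX : X.Connected) (hlf : ∀ v, (X.neighborSet v).Finite)
    (T : IsTorso X 𝒜 Z f) : IsTotallyCrossed Z := by
  intro u v C D huv h
  have : Nontrivial W := ⟨u, v, huv⟩
  obtain ⟨Y, hY, hZY⟩ := T.exists_block hX hlf
  set F := sideEdges X 𝒜 f C ∩ Y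
  have hFc : Y \ F ⊆ X.edgeSet \ sideEdges X 𝒜 f C := fun e he =>
    ⟨hY.subset he.1, fun h => he.2 ⟨h, he.1⟩⟩
  have hC : ∀ c ∈ C, f c ∉ ends (Y \ F) := fun c hc h' =>
    T.notMem_ends_sdiff_sideEdges hc (ends_mono hFc h')
  have hD : ∀ d ∈ D, f d ∉ ends F := fun d hd h' =>
    T.notMem_ends_sideEdges hX hlf h hd (ends_mono Set.inter_subset_left h')
  obtain ⟨c, hc⟩ := h.left_nonempty
  obtain ⟨d, hd⟩ := h.right_nonempty
  have hbF : boundary Y F = {f u, f v} := by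
    obtain ⟨e, he, -⟩ := mem_ends_of_notMem_ends_sdiff (hZY c) (hC c hc)
    obtain ⟨e', he', -⟩ := mem_ends_sdiff_of_notMem (hZY d) (hD d hd)
    refine (hY.isTwoConnected hX).boundary_eq_pair Set.inter_subset_right ⟨e, he⟩ ⟨e', he'⟩ ?_
    refine fun x hx => Set.image_pair f u v ▸ T.boundary_sideEdges_subset hX hlf h ⟨?_, ?_⟩
    exacts [ends_mono Set.inter_subset_left hx.1, ends_mono hFc hx.2]
  obtain ⟨R, hR, hcross, x, y, hbR, hx, hy, hdiv⟩ :=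
    T.exists_crossing hX hlf hY hZY Set.inter_subset_right huv hbF (hC c hc) (hD d hd)
  have hRr : boundary Y R ⊆ Set.range f := fun _ =>
    T.mem_range_of_crossing hX hY (fun A => T.subset_sideEdges_or C) hR hcross
  obtain ⟨w, rfl⟩ := hRr (hbR.superset (Set.mem_insert x {y}))
  obtain ⟨z, rfl⟩ := hRr (hbR.superset (Set.mem_insert_of_mem (f w) rfl))
  have mem_boundary : ∀ {s}, s ∈ ({u, v} : Set W) → f s ∈ boundary Y F := fun hs =>
    hbF ▸ Set.image_pair f u v ▸ Set.mem_image_of_mem f hs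
  refine ⟨w, ?_, z, ?_, T.exists_separates_of_divides hX hlf hY hZY hR hbR hdiv⟩
  · exact ((h.cover w).resolve_left fun hw => hx (mem_boundary hw).2).resolve_right fun hw =>
      hx (mem_ends_sdiff_of_notMem (hZY w) (hD w hw))
  · exact ((h.cover z).resolve_left fun hz => hy (mem_boundary hz).1).resolve_left fun hz =>
      hy (mem_ends_of_notMem_ends_sdiff (hZY z) (hC z hz))

theorem isCycleGraph_or_isThreeConnected [Nontrivial V] [Nontrivial W] (hX : X.Connected)
    (hlf : ∀ v, (X.neighborSet v).Finite) (T : IsTorso X 𝒜 Z f) :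
    IsCycleGraph Z ∨ IsThreeConnected Z := by
  refine or_iff_not_imp_right.2 fun hZ => ?_
  obtain ⟨S, hS, hpre⟩ : ∃ S : Set W, S.encard ≤ 2 ∧ ¬ (Z.induce Sᶜ).Preconnected := by
    by_contra! h
    exact hZ ⟨‹_›, h⟩
  obtain ⟨C, D, hsep⟩ := exists_separates hpre
  have hS_two : S.encard = 2 := by
    refine le_antisymm hS (not_lt.1 fun hlt => ?_)
    have hle : S.encard ≤ 1 := Order.le_of_lt_add_one (by rwa [one_add_one_eq_two])
    obtain ⟨s, hs⟩ : ∃ s, S ⊆ {s} := by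
      obtain ⟨c, -⟩ := hsep.left_nonempty
      rcases S.eq_empty_or_nonempty with rfl | ⟨s, hs⟩
      · exact ⟨c, Set.empty_subset _⟩
      · exact ⟨s, fun x hx => Set.encard_le_one_iff_subsingleton.1 hle hx hs⟩
    exact T.not_subset_singleton hX hlf hsep s hs
  obtain ⟨u, v, huv, rfl⟩ := Set.encard_eq_two.1 hS_two
  exact (T.isTotallyCrossed hX hlf).isCycleGraph
    (fun c _ _ h => T.not_subset_singleton hX hlf h c le_rfl) huv hsep

end IsTorso

end Torsos

end TutteTree

/-! ### Torsos as subdivisions -/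

namespace TutteTree

section TorsoSubdivision
open SimpleGraph

variable {V W : Type*} {X : SimpleGraph V} {𝒜 : Set (Set (Sym2 V))} {Z : SimpleGraph W} {f : W → V}
  {A F : Set (Sym2 V)} {a b c d : W} {x y z : V}

theorem mem_ends_of_mem_support (p : (fromEdgeSet F).Walk x y) (hx : x ∈ ends F)
    (hz : z ∈ p.support) : z ∈ ends F := by
  induction p with
  | nil => exact List.mem_singleton.1 hz ▸ hx
  | cons h p ih =>
    rcases List.mem_cons.1 (Walk.support_cons h p ▸ hz) with rfl | hz
    · exact hx
    · exact ih ⟨_, h.1, Sym2.mem_mk_right _ _⟩ hz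

theorem exists_path_of_mem_canonicalSplits (hX : X.Connected)
    (hlf : ∀ v, (X.neighborSet v).Finite) (hA : A ∈ canonicalSplits X) (hxy : x ≠ y)
    (h : boundary X.edgeSet A = {x, y}) :
    ∃ p : X.Walk x y, p.IsPath ∧ ∀ z ∈ p.support, z ∈ ends A := by
  obtain ⟨Y, F, W, hY, hF, rfl, hbF⟩ := exists_isUncrossed_of_mem_canonicalSplits hX hlf hA hxy h
  have hFY := hF.1.1
  have hle : fromEdgeSet F ≤ X := fun _ _ h => hY.subset (hFY h.1)
  have hx : x ∈ ends F := (hbF.superset (Set.mem_insert x {y})).1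
  obtain ⟨p, hp⟩ := (hY.reachable_of_boundary hX hFY hxy hbF).exists_isPath
  refine ⟨p.mapLe hle, hp.mapLe hle, fun z hz => ends_mono (subset_extend hY hFY) ?_⟩
  rw [Walk.support_mapLe_eq_support] at hz
  exact mem_ends_of_mem_support p hx hz

theorem exists_symm_walks {P : ∀ {x y}, X.Walk x y → Prop}
    (hP : ∀ {x y} {p : X.Walk x y}, P p → P p.reverse)
    (h : ∀ a b, Z.Adj a b → ∃ p : X.Walk (f a) (f b), P p) :
    ∃ p : ∀ a b, Z.Adj a b → X.Walk (f a) (f b),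
      (∀ a b h, p b a h.symm = (p a b h).reverse) ∧ ∀ a b h, P (p a b h) := by
  classical
  let : LinearOrder W := linearOrderOfSTO WellOrderingRel
  choose q hq using h
  refine ⟨fun a b h => if a < b then q a b h else (q b a h.symm).reverse, fun a b h => ?_,
    fun a b h => ?_⟩
  · dsimp only
    rcases lt_or_gt_of_ne h.ne with hab | hab
    · rw [if_neg hab.asymm, if_pos hab]
    · rw [if_pos hab, if_neg hab.asymm, Walk.reverse_reverse]
  · dsimp only
    split_ifs
    exacts [hq a b h, hP (hq b a h.symm)]

/-- A path that can represent an edge of a torso in a subdivision: it has no inner vertices, or it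
runs inside a member of `𝒜` whose boundary consists of the ends of the path. -/
def IsTorsoPath (𝒜 : Set (Set (Sym2 V))) (p : X.Walk x y) : Prop :=
  p.IsPath ∧ ((∀ z ∈ p.support, z ∈ ({x, y} : Set V)) ∨
    ∃ A ∈ 𝒜, boundary X.edgeSet A = {x, y} ∧ ∀ z ∈ p.support, z ∈ ends A)

theorem IsTorsoPath.reverse {p : X.Walk x y} (hp : IsTorsoPath 𝒜 p) : IsTorsoPath 𝒜 p.reverse := by
  refine ⟨hp.1.reverse, ?_⟩
  simp only [Walk.support_reverse, List.mem_reverse, Set.pair_comm y x]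
  exact hp.2

namespace IsTorso

theorem exists_isTorsoPath (hX : X.Connected) (hlf : ∀ v, (X.neighborSet v).Finite)
    (T : IsTorso X 𝒜 Z f) (h : Z.Adj a b) : ∃ p : X.Walk (f a) (f b), IsTorsoPath 𝒜 p := by
  obtain ⟨hne, ⟨hab, -⟩ | ⟨A, hA, hbd⟩⟩ := (T.adj_iff a b).1 h
  · rw [mem_edgeSet] at hab
    exact ⟨hab.toWalk, hab.isPath_toWalk, Or.inl fun z hz => by simpa using hz⟩
  · obtain ⟨p, hp, hpA⟩ := exists_path_of_mem_canonicalSplits hX hlf (T.mem_canonicalSplits hA)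
      (T.injective.ne hne) hbd
    exact ⟨p, hp, Or.inr ⟨A, hA, hbd, hpA⟩⟩

theorem eq_or_eq_of_isTorsoPath (T : IsTorso X 𝒜 Z f) {p : X.Walk (f a) (f b)}
    (hp : IsTorsoPath 𝒜 p) (hc : f c ∈ p.support) : c = a ∨ c = b := by
  have hcab : f c ∈ ({f a, f b} : Set V) := by
    rcases hp.2 with hpab | ⟨A, hA, hbd, hpA⟩
    · exact hpab _ hc
    · exact hbd.subset (T.mem_boundary hA (hpA _ hc))
  exact hcab.imp (T.injective ·) (T.injective ·)

theorem mem_range_of_isTorsoPath (T : IsTorso X 𝒜 Z f) {p : X.Walk (f a) (f b)}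
    {q : X.Walk (f c) (f d)} (hp : IsTorsoPath 𝒜 p) (hq : IsTorsoPath 𝒜 q)
    (hne : s(a, b) ≠ s(c, d)) (hxp : x ∈ p.support) (hxq : x ∈ q.support) : x ∈ Set.range f := by
  rcases hp.2 with hpab | ⟨A, hA, hbA, hpA⟩
  · rcases hpab x hxp with rfl | rfl <;> exact Set.mem_range_self _
  rcases hq.2 with hqcd | ⟨B, hB, hbB, hqB⟩
  · rcases hqcd x hxq with rfl | rfl <;> exact Set.mem_range_self _
  have hAB : B ≠ A := by
    rintro rfl
    refine hne (Sym2.map.injective T.injective (Sym2.eq_iff.2 ?_))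
    exact Set.pair_eq_pair_iff.1 (hbA.symm.trans hbB)
  exact T.boundary_subset_range hA ⟨hpA x hxp, ends_mono (T.subset_sdiff hB hA hAB) (hqB x hxq)⟩

theorem hasSubdivisionIn (hX : X.Connected) (hlf : ∀ v, (X.neighborSet v).Finite)
    (T : IsTorso X 𝒜 Z f) : HasSubdivisionIn Z X := by
  obtain ⟨p, hp_symm, hp⟩ := exists_symm_walks (P := IsTorsoPath 𝒜) IsTorsoPath.reverse
    fun a b h => T.exists_isTorsoPath hX hlf h
  exact ⟨f, p, T.injective, fun a b h => (hp a b h).1, hp_symm,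
    fun a b h c => T.eq_or_eq_of_isTorsoPath (hp a b h),
    fun a b h c d h' hne x => T.mem_range_of_isTorsoPath (hp a b h) (hp c d h') hne⟩

end IsTorso

end TorsoSubdivision

end TutteTree

/-! ### The canonical separations -/

namespace TutteTree

section CanonicalSeparations
open SimpleGraph

variable {V : Type*} {X : SimpleGraph V} {A Y F : Set (Sym2 V)} {S : X.Subgraph}
  {v : Set X.Subgraph}

/-- The separations whose structure tree decomposes `X`: its oriented edges. -/
def canonicalSeparations (X : SimpleGraph V) : Set X.Subgraph := ofEdgeSet X '' canonicalSplits X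

theorem opp_mem_canonicalSeparations [Nontrivial V] (hX : X.Connected)
    (hS : S ∈ canonicalSeparations X) : opp S ∈ canonicalSeparations X := by
  obtain ⟨A, hA, rfl⟩ := hS
  rw [opp_ofEdgeSet (ends_edgeSet hX) (subset_of_mem_canonicalSplits hA)]
  exact Set.mem_image_of_mem _ (compl_mem_canonicalSplits hX hA)

theorem translate_mem_canonicalSeparations (g : X ≃g X) (hS : S ∈ canonicalSeparations X) :
    translate g S ∈ canonicalSeparations X := by
  obtain ⟨A, hA, rfl⟩ := hS
  rw [translate_ofEdgeSet g (subset_of_mem_canonicalSplits hA)]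
  exact Set.mem_image_of_mem _ (mapEdges_mem_canonicalSplits hA g)

theorem isTreeSet_canonicalSeparations [Nontrivial V] (hX : X.Connected)
    (hlf : ∀ v, (X.neighborSet v).Finite) : IsTreeSet (canonicalSeparations X) where
  opp_mem := opp_mem_canonicalSeparations hX
  opp_opp := by
    rintro _ ⟨A, hA, rfl⟩
    have hAX := subset_of_mem_canonicalSplits hA
    rw [opp_ofEdgeSet (ends_edgeSet hX) hAX, opp_ofEdgeSet (ends_edgeSet hX) Set.sdiff_subset,
      Set.sdiff_sdiff_cancel_left hAX]
  anti := by
    rintro _ _ ⟨A, hA, rfl⟩ ⟨B, hB, rfl⟩ h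
    have hAX := subset_of_mem_canonicalSplits hA
    have hBX := subset_of_mem_canonicalSplits hB
    rw [opp_ofEdgeSet (ends_edgeSet hX) hAX, opp_ofEdgeSet (ends_edgeSet hX) hBX,
      ofEdgeSet_le_ofEdgeSet Set.sdiff_subset Set.sdiff_subset]
    exact Set.sdiff_subset_sdiff_right ((ofEdgeSet_le_ofEdgeSet hAX hBX).1 h)
  nested := by
    rintro _ _ ⟨A, hA, rfl⟩ ⟨B, hB, rfl⟩
    have hAX := subset_of_mem_canonicalSplits hA
    have hBX := subset_of_mem_canonicalSplits hB
    rw [opp_ofEdgeSet (ends_edgeSet hX) hAX, opp_ofEdgeSet (ends_edgeSet hX) hBX,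
      ofEdgeSet_le_ofEdgeSet hAX hBX, ofEdgeSet_le_ofEdgeSet hAX Set.sdiff_subset,
      ofEdgeSet_le_ofEdgeSet Set.sdiff_subset hBX,
      ofEdgeSet_le_ofEdgeSet Set.sdiff_subset Set.sdiff_subset]
    exact nested_of_mem_canonicalSplits hX hlf hA hB
  not_le_opp := by
    rintro _ _ ⟨A, hA, rfl⟩ ⟨B, hB, rfl⟩ hAB hAB'
    have hAX := subset_of_mem_canonicalSplits hA
    have hBX := subset_of_mem_canonicalSplits hB
    rw [ofEdgeSet_le_ofEdgeSet hAX hBX] at hAB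
    rw [opp_ofEdgeSet (ends_edgeSet hX) hBX, ofEdgeSet_le_ofEdgeSet hAX Set.sdiff_subset] at hAB'
    obtain ⟨e, he⟩ := nonempty_of_mem_canonicalSplits hX hlf hA
    exact (hAB' he).2 (hAB he)
  finite_interval := by
    rintro _ _ ⟨A, hA, rfl⟩ ⟨B, hB, rfl⟩ -
    refine ((finite_canonicalSplits_interval hX hlf hA hB).image (ofEdgeSet X)).subset ?_
    rintro _ ⟨⟨C, hC, rfl⟩, hAC, hCB⟩
    have hCX := subset_of_mem_canonicalSplits hC
    rw [ofEdgeSet_le_ofEdgeSet (subset_of_mem_canonicalSplits hA) hCX] at hAC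
    rw [ofEdgeSet_le_ofEdgeSet hCX (subset_of_mem_canonicalSplits hB)] at hCB
    exact Set.mem_image_of_mem _ ⟨hC, hAC, hCB⟩

theorem exists_finite_orbits_canonicalSeparations (hX : X.Connected)
    (hlf : ∀ v, (X.neighborSet v).Finite) (hfin : IsAutFinite X) :
    ∃ K ⊆ canonicalSeparations X, K.Finite ∧
      ∀ S ∈ canonicalSeparations X, ∃ S' ∈ K, ∃ g : X ≃g X, translate g S' = S := by
  obtain ⟨K, hK, hKfin, hKorb⟩ := exists_finite_orbits_canonicalSplits hX hlf hfin
  refine ⟨ofEdgeSet X '' K, Set.image_mono hK, hKfin.image _, ?_⟩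
  rintro _ ⟨A, hA, rfl⟩
  obtain ⟨B, hB, g, rfl⟩ := hKorb A hA
  exact ⟨_, ⟨B, hB, rfl⟩, g, translate_ofEdgeSet g (subset_of_mem_canonicalSplits (hK hB))⟩

theorem exists_adj_of_mem_boundary {x : V} (hA : A ⊆ X.edgeSet) (hx : x ∈ boundary X.edgeSet A) :
    ∃ y, (ofEdgeSet X A).Adj x y := by
  obtain ⟨y, hxy⟩ := mem_ends_iff.1 hx.1
  exact ⟨y, (ofEdgeSet_adj hA).2 hxy⟩

theorem HasPointBoundary.isOneSeparation (hA : HasPointBoundary X.edgeSet A) :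
    IsOneSeparation (ofEdgeSet X A) := by
  obtain ⟨hAX, c, hc⟩ := hA
  exact ⟨c, (hinge_ofEdgeSet hAX).trans hc,
    exists_adj_of_mem_boundary hAX (hc.superset (Set.mem_singleton c))⟩

theorem HasPairBoundary.isTwoSeparation (hA : HasPairBoundary X.edgeSet A)
    (hn : IsNontrivialSplit X.edgeSet A) : IsTwoSeparation (ofEdgeSet X A) := by
  obtain ⟨hAX, x, y, hxy, h⟩ := hA
  have exists_adj : ∀ z ∈ ({x, y} : Set V), ∃ z', (ofEdgeSet X A).Adj z z' := fun z hz =>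
    exists_adj_of_mem_boundary hAX (h.superset hz)
  refine ⟨⟨x, y, hxy, (hinge_ofEdgeSet hAX).trans h, exists_adj x (Set.mem_insert x {y}),
    exists_adj y (Set.mem_insert_of_mem x rfl)⟩, fun a b hab => ⟨fun hS => ?_, fun hS => ?_⟩⟩
  · have hA := congrArg Subgraph.edgeSet hS
    rw [edgeSet_ofEdgeSet hAX, edgeSet_subgraphOfAdj] at hA
    exact hn.1 _ hA
  · have hA : A = X.edgeSet \ {s(a, b)} := by
      rw [← edgeSet_ofEdgeSet hAX, hS]
      ext ⟨z, w⟩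
      rfl
    refine hn.2 s(a, b) ?_
    exact hA ▸ Set.sdiff_sdiff_cancel_left (Set.singleton_subset_iff.2 (X.mem_edgeSet.2 hab))

theorem IsNontrivialSplit.of_inter (hF : HasPairBoundary Y F) (hn : IsNontrivialSplit Y F)
    (hY : Y ⊆ X.edgeSet) (hAF : A ∩ Y = F) : IsNontrivialSplit X.edgeSet A := by
  have hYF : Y \ F ⊆ X.edgeSet \ A := fun e he => ⟨hY he.1, fun h => he.2 (hAF ▸ ⟨h, he.1⟩)⟩
  refine ⟨fun e he => hn.1 e ?_, fun e he => hn.2 e ?_⟩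
  · exact hF.nonempty.subset_singleton_iff.1 (he ▸ hAF ▸ Set.inter_subset_left)
  · exact hF.compl.nonempty.subset_singleton_iff.1 (he ▸ hYF)

theorem canonicalSeparations_subset_separations (hX : X.Connected)
    (hlf : ∀ v, (X.neighborSet v).Finite) : canonicalSeparations X ⊆ separations X := by
  rintro _ ⟨A, hA | ⟨Y, F, hY, hF, hn, hA⟩, rfl⟩
  · exact Or.inl hA.1.isOneSeparation
  · have hApair : HasPairBoundary X.edgeSet A :=
      ⟨hA.subset, hA.boundary_eq hX hlf hY hF.1 ▸ hF.1.2⟩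
    obtain ⟨W, rfl⟩ := hA.exists_eq
    exact Or.inr (hApair.isTwoSeparation (hn.of_inter hF.1 hY.subset (extend_inter hY hF.1.1)))

/-- The edge sets of the oriented edges of the structure tree that belong to `v`. -/
def nodeSplits (v : Set X.Subgraph) : Set (Set (Sym2 V)) :=
  {A | A ∈ canonicalSplits X ∧ ofEdgeSet X A ∈ v}

theorem image_nodeSplits (hv : IsNode (canonicalSeparations X) v) :
    ofEdgeSet X '' nodeSplits v = v := by
  refine Set.Subset.antisymm (Set.image_subset_iff.2 fun A hA => hA.2) fun S hS => ?_
  obtain ⟨A, hA, rfl⟩ := subset_of_isNode hv hS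
  exact ⟨A, ⟨hA, hS⟩, rfl⟩

theorem forall_mem_node_iff (hv : IsNode (canonicalSeparations X) v) (P : X.Subgraph → Prop) :
    (∀ S ∈ v, P S) ↔ ∀ A ∈ nodeSplits v, P (ofEdgeSet X A) := by
  conv_lhs => rw [← image_nodeSplits hv, Set.forall_mem_image]

theorem exists_mem_node_iff (hv : IsNode (canonicalSeparations X) v) (P : X.Subgraph → Prop) :
    (∃ S ∈ v, P S) ↔ ∃ A ∈ nodeSplits v, P (ofEdgeSet X A) := by
  conv_lhs => rw [← image_nodeSplits hv, Set.exists_mem_image]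

theorem isTorso_vertexGraph [Nontrivial V] (hX : X.Connected)
    (hlf : ∀ v, (X.neighborSet v).Finite) (hv : IsNode (canonicalSeparations X) v) :
    IsTorso X (nodeSplits v) (vertexGraph v) Subtype.val where
  mem_canonicalSplits hA := hA.1
  subset_sdiff {A B} hA hB hne := by
    have hAX := subset_of_mem_canonicalSplits hA.1
    have hBX := subset_of_mem_canonicalSplits hB.1
    have hle := (isTreeSet_canonicalSeparations hX hlf).le_opp_of_mem_node hv hA.2 hB.2
      (ofEdgeSet_injOn.ne hAX hBX hne)
    rwa [opp_ofEdgeSet (ends_edgeSet hX) hBX, ofEdgeSet_le_ofEdgeSet hAX Set.sdiff_subset] at hle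
  exists_subset {B} hB := by
    have hBX := subset_of_mem_canonicalSplits hB
    obtain ⟨A, hA, hBA⟩ := (exists_mem_node_iff hv _).1 <|
      (isTreeSet_canonicalSeparations hX hlf).exists_mem_node_le_or_opp_le hv
        (Set.mem_image_of_mem (ofEdgeSet X) hB)
    have hAX := subset_of_mem_canonicalSplits hA.1
    rw [opp_ofEdgeSet (ends_edgeSet hX) hBX, ofEdgeSet_le_ofEdgeSet hBX hAX,
      ofEdgeSet_le_ofEdgeSet Set.sdiff_subset hAX] at hBA
    exact ⟨A, hA, hBA⟩
  injective := Subtype.val_injective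
  mem_range x := by
    rw [Subtype.range_coe, mem_core, forall_mem_node_iff hv]
    refine forall₂_congr fun A hA => ?_
    rw [opp_ofEdgeSet (ends_edgeSet hX) (subset_of_mem_canonicalSplits hA.1),
      verts_ofEdgeSet Set.sdiff_subset]
  adj_iff a b := by
    rw [vertexGraph_adj, forall_mem_node_iff hv fun S => ¬ S.Adj a b,
      exists_mem_node_iff hv fun S => hinge S = {(a : V), (b : V)}]
    refine and_congr_right' (or_congr (and_congr_right' ?_) (exists_congr fun A => ?_))
    · exact forall₂_congr fun A hA =>
        not_congr (ofEdgeSet_adj (subset_of_mem_canonicalSplits hA.1))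
    · exact and_congr_right fun hA => by
        rw [hinge_ofEdgeSet (subset_of_mem_canonicalSplits hA.1)]

theorem exists_isCutPointNode [Nontrivial V] (hX : X.Connected)
    (hlf : ∀ v, (X.neighborSet v).Finite) (hv : IsNode (canonicalSeparations X) v)
    (hcore : (core v).verts.Subsingleton) : ∃ c, IsCutPointNode v c := by
  have hsub : ∀ A ∈ nodeSplits v, boundary X.edgeSet A ⊆ (core v).verts := fun A hA =>
    ((isTorso_vertexGraph hX hlf hv).boundary_subset_range hA).trans Subtype.range_coe.subset
  obtain ⟨A, hA⟩ : (nodeSplits v).Nonempty := by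
    refine Set.nonempty_iff_ne_empty.2 fun hempty => ?_
    have hmem : ∀ x, x ∈ (core v).verts := fun x =>
      mem_core.2 ((forall_mem_node_iff hv _).2 (hempty ▸ fun A hA => hA.elim))
    obtain ⟨x, y, hxy⟩ := exists_pair_ne V
    exact hxy (hcore (hmem x) (hmem y))
  obtain ⟨c, hc⟩ := boundary_nonempty_of_mem_canonicalSplits hX hlf hA.1
  have hcore_eq : (core v).verts = {c} := hcore.eq_singleton_of_mem (hsub A hA hc)
  have boundary_eq : ∀ B ∈ nodeSplits v, boundary X.edgeSet B = {c} := fun B hB =>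
    (boundary_nonempty_of_mem_canonicalSplits hX hlf hB.1).subset_singleton_iff.1
      (hcore_eq ▸ hsub B hB)
  refine ⟨c, isCutPoint_of_boundary (subset_of_mem_canonicalSplits hA.1) (boundary_eq A hA),
    (forall_mem_node_iff hv _).2 fun B hB => ?_, hcore_eq⟩
  rw [hinge_ofEdgeSet (subset_of_mem_canonicalSplits hB.1), boundary_eq B hB]

theorem vertexGraph_trichotomy [Nontrivial V] (hX : X.Connected)
    (hlf : ∀ v, (X.neighborSet v).Finite) (hv : IsNode (canonicalSeparations X) v) :
    (∃ c, IsCutPointNode v c) ∨ IsCycleGraph (vertexGraph v) ∨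
      (IsThreeConnected (vertexGraph v) ∧ HasSubdivisionIn (vertexGraph v) X ∧
        (IsPlanar X → IsPlanar (vertexGraph v))) := by
  rcases subsingleton_or_nontrivial (core v).verts with hcore | hcore
  · exact Or.inl (exists_isCutPointNode hX hlf hv ((Set.subsingleton_coe _).1 hcore))
  · have T := isTorso_vertexGraph hX hlf hv
    have hsub := T.hasSubdivisionIn hX hlf
    exact Or.inr <| (T.isCycleGraph_or_isThreeConnected hX hlf).imp_right fun hthree =>
      ⟨hthree, hsub, isPlanar_of_hasSubdivisionIn hsub⟩

theorem ncard_verts_inf_opp [Nontrivial V] (hX : X.Connected)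
    (hlf : ∀ v, (X.neighborSet v).Finite) (hS : S ∈ canonicalSeparations X) :
    (S ⊓ opp S).verts.ncard = 1 ∨ (S ⊓ opp S).verts.ncard = 2 := by
  obtain ⟨A, hA, rfl⟩ := hS
  rw [verts_ofEdgeSet_inf_opp (ends_edgeSet hX) (subset_of_mem_canonicalSplits hA)]
  rcases boundary_of_mem_canonicalSplits hX hlf hA with ⟨c, h⟩ | ⟨x, y, hxy, h⟩
  · exact Or.inl (h ▸ Set.ncard_singleton c)
  · exact Or.inr (h ▸ Set.ncard_pair hxy)

theorem sup_opp_of_mem_canonicalSeparations [Nontrivial V] (hX : X.Connected)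
    (hS : S ∈ canonicalSeparations X) : S ⊔ opp S = ⊤ := by
  obtain ⟨A, hA, rfl⟩ := hS
  exact ofEdgeSet_sup_opp (ends_edgeSet hX) (subset_of_mem_canonicalSplits hA)

end CanonicalSeparations

end TutteTree

theorem theorem3p7 {V : Type*} [Nontrivial V] (X : SimpleGraph V) (hconn : X.Connected)
    (hlf : ∀ v, (X.neighborSet v).Finite) (hfin : TutteTree.IsAutFinite X) :
    ∃ E : Set X.Subgraph,
      -- a `G`-finite `G`-set of separations, closed under the involution
      E ⊆ TutteTree.separations X ∧
      (∀ g : X ≃g X, ∀ A ∈ E, TutteTree.translate g A ∈ E) ∧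
      (∀ A ∈ E, TutteTree.opp A ∈ E) ∧
      (∃ F ⊆ E, F.Finite ∧ ∀ A ∈ E, ∃ B ∈ F, ∃ g : X ≃g X, TutteTree.translate g B = A) ∧
      -- it is nested
      (∀ A ∈ E, ∀ B ∈ E, A ≤ B ∨ A ≤ TutteTree.opp B ∨ TutteTree.opp A ≤ B ∨
        TutteTree.opp A ≤ TutteTree.opp B) ∧
      -- it satisfies the finite interval condition
      (∀ A ∈ E, ∀ B ∈ E, A ≤ B → {C | C ∈ E ∧ A ≤ C ∧ C ≤ B}.Finite) ∧
      -- `T` is a tree on which `G` acts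
      (TutteTree.structureTree E).IsTree ∧
      (∃ ρ : (X ≃g X) →* (TutteTree.structureTree E ≃g TutteTree.structureTree E),
        ∀ g v, (ρ g v).1 = TutteTree.translate g '' v.1) ∧
      -- its oriented edges are the elements of `E`, and each gives a decomposition of `X`
      (∃ Φ : E ≃ (TutteTree.structureTree E).Dart,
        ∀ A : E, A.1 ∈ (Φ A).fst.1 ∧ TutteTree.opp A.1 ∈ (Φ A).snd.1) ∧
      (∀ A ∈ E, A ⊔ TutteTree.opp A = ⊤ ∧ (A ⊓ TutteTree.opp A).edgeSet = ∅ ∧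
        ((A ⊓ TutteTree.opp A).verts.ncard = 1 ∨ (A ⊓ TutteTree.opp A).verts.ncard = 2)) ∧
      -- the vertices of `T`
      (∀ v : TutteTree.Node E,
        -- the stabilizer of `v` acts on the graph associated with `v`
        (∀ g : X ≃g X, TutteTree.translate g '' v.1 = v.1 →
          ∃ ψ : TutteTree.vertexGraph v.1 ≃g TutteTree.vertexGraph v.1,
            ∀ z, (ψ z : V) = g (z : V)) ∧
        ((∃ c, TutteTree.IsCutPointNode v.1 c) ∨
          TutteTree.IsCycleGraph (TutteTree.vertexGraph v.1) ∨
          (TutteTree.IsThreeConnected (TutteTree.vertexGraph v.1) ∧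
            TutteTree.HasSubdivisionIn (TutteTree.vertexGraph v.1) X ∧
            (TutteTree.IsPlanar X → TutteTree.IsPlanar (TutteTree.vertexGraph v.1))))) := by
  have hE := TutteTree.isTreeSet_canonicalSeparations hconn hlf
  have translate_mem : ∀ g : X ≃g X, ∀ A ∈ TutteTree.canonicalSeparations X,
      TutteTree.translate g A ∈ TutteTree.canonicalSeparations X := fun g _ hA =>
    TutteTree.translate_mem_canonicalSeparations g hA
  exact ⟨TutteTree.canonicalSeparations X,
    TutteTree.canonicalSeparations_subset_separations hconn hlf, translate_mem,
    fun A hA => hE.opp_mem hA, TutteTree.exists_finite_orbits_canonicalSeparations hconn hlf hfin,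
    fun A hA B hB => hE.nested hA hB, fun A hA B hB => hE.finite_interval hA hB, hE.isTree,
    TutteTree.exists_structureTree_action translate_mem, hE.exists_equiv_dart,
    fun A hA => ⟨TutteTree.sup_opp_of_mem_canonicalSeparations hconn hA,
      TutteTree.edgeSet_inf_opp A, TutteTree.ncard_verts_inf_opp hconn hlf hA⟩,
    fun v => ⟨fun g hg => TutteTree.exists_vertexGraph_iso hg,
      TutteTree.vertexGraph_trichotomy hconn hlf v.2⟩⟩
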